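/- Let $T>0$, $\alpha\in(0,1)$, $e,k,d\in\mathbb N$. Write $I^{\beta}_{r^+}w(t)=\frac1{\Gamma(\beta)}\int_r^t (t-s)^{\beta-1}w_s\,ds$. Let $AC^\alpha=AC^\alpha([0,T],\mathbb R^k)$ be the set of paths $\gamma_t=\gamma_0+I^\alpha_{0^+}u(t)$ with $u\in L^\infty([0,T],\mathbb R^k)$, with the sup norm; let $D^\alpha_{0^+}(\gamma-\gamma_0)(t)=\frac{d}{dt}I^{1-\alpha}_{0^+}(\gamma-\gamma_0)(t)$, and for $n\in\mathbb N$ let $AC_n$ be the set of $\gamma\in AC^\alpha$ with $\|D^\alpha_{0^+}(\gamma-\gamma_0)\|_\infty\le n$ and $|\gamma_0|\le n$. For $u\in L^\infty([r,T],\mathbb R^k)$ let $\nu^{r,\gamma,u}$ be the path that equals $\gamma$ on $[0,r]$ and, for $t\in(r,T]$, $$\nu^{r,\gamma,u}_t=\gamma_0+\frac1{\Gamma(\alpha)}\int_0^r\frac{D^\alpha_{0^+}(\gamma-\gamma_0)(s)}{(t-s)^{1-\alpha}}ds+I^\alpha_{r^+}u(t).$$ Let $b:\mathbb R^e\times\mathbb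 R^k\to\mathbb R^e$ be bounded and Lipschitz, $\lambda:\mathbb R^e\times\mathbb R^k\to L(\mathbb R^d,\mathbb R^e)$ be $C^1$, bounded with bounded derivative, and $\eta\in C^1([0,T],\mathbb R^d)$. For a continuous control path $w$ let $X^{r,x,w}$ be the solution of $dX_s=b(X_s,w_s)ds+\lambda(X_s,w_s)d\eta_s$ on $[r,T]$, $X_r=x$. Let $f:\mathbb R^e\times\mathbb R^k\times\mathbb R^k\to\mathbb R$, $\psi:\mathbb R^e\times\mathbb R^k\to(\mathbb R^d)^*$, $g:\mathbb R^e\times\mathbb R^k\to\mathbb R$, and, with $\nu=\nu^{r,\gamma,u}$ and $X=X^{r,x,\nu}$, $$v(r,x,\gamma)=\inf_{u\in L^\infty([r,T],\mathbb R^k)}\Big\{\int_r^T f(X_s,\nu_s,u_s)ds+\int_r^T\psi(X_s,\nu_s)d\eta_s+g(X_T,\nu_T)\Big\}.$$ Assume: (A.1) $f,\psi,g$ are continuous. (A.2) $g$ is bounded below. (A.3) There is $\tilde p>1$ such that for all $\epsilon>0$ and all $p>1$ with $\lfloor p\rfloor/p<\alpha$ there is a constant $C$ with $$\Big|\int_r^t\psi(X^{r,x,\gamma}_s,\gamma_s)d\eta_s\Big|\le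 C\Big(1+\int_r^t|u_s|^{\tilde p}ds+\Big(\int_0^r|u_s|^{\tilde p}ds\Big)|t-r|^{1+\epsilon}\Big),\qquad u=D^\alpha_{0^+}(\gamma-\gamma_0),$$ for all $0\le r\le t\le T$, $x\in\mathbb R^e$, $n\in\mathbb N$, $\gamma\in AC_n$. (A.4) There are $f_0,C_0>0$ and $q>\max(\tilde p,1/\alpha)$ with $f(x,a,u)\ge f_0|u|^q-C_0$ for all $x,a,u$. (A.5) $\psi$ and $g$ are Lipschitz; $f$ is Lipschitz in $(x,a)$ uniformly in $u$; and for all $x,a$ the map $u\mapsto f(x,a,u)$ is uniformly continuous on bounded sets. A functional $\varphi:[0,T]\times\mathbb R^e\times AC^\alpha\to\mathbb R$ is ci-differentiable at $(t,x,\gamma)$, $t<T$, with derivatives $\frac{\partial^\alpha}{\partial t}\varphi\in\mathbb R$, $\nabla^\alpha_x\varphi\in\mathbb R^e$, $\nabla^\alpha_\gamma\varphi\in\mathbb R^k$ at that point if, for every $\nu\in AC^\alpha$ with $\nu=\gamma$ on $[0,t]$, $$\varphi(z,y,\nu)-\varphi(t,x,\gamma)=\tfrac{\partial^\alpha}{\partial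 t}\varphi\,(z-t)+\langle\nabla^\alpha_x\varphi,y-x\rangle+\langle\nabla^\alpha_\gamma\varphi,I^{1-\alpha}_{0^+}(\nu-\gamma_0)(z)-I^{1-\alpha}_{0^+}(\gamma-\gamma_0)(t)\rangle+o(z-t+|y-x|)$$ as $(z,y)\to(t,x)$, $z>t$, where the remainder may depend on $\nu$. It is ci-smooth if it is continuous (for the product of the usual topologies and the sup norm topology), ci-differentiable at every point with $t<T$, and its three ci-derivatives are continuous on $[0,T)\times\mathbb R^e\times AC^\alpha$. Let $H(x,a,\phi)=\sup_{u\in\mathbb R^k}\{-\langle\phi,u\rangle-f(x,a,u)\}$. Then the infimum defining $v$ and the supremum defining $H$ are finite, and $v$ is a fractional viscosity solution of $$-\tfrac{\partial^\alpha}{\partial t}v-\langle\nabla^\alpha_xv,\,b(x,\gamma_r)+\lambda(x,\gamma_r)\dot\eta_r\rangle+H(x,\gamma_r,\nabla^\alpha_\gamma v)-\psi(x,\gamma_r)\dot\eta_r=0\ \text{ for } r<T,\qquad v(T,x,\gamma)=g(x,\gamma_T).$$ This means: $v$ is continuous on $[0,T]\times\mathbb R^e\times AC^\alpha$, satisfies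 the terminal condition, and for every ci-smooth $\varphi$ and every $n\in\mathbb N$, if $v-\varphi$ has a local maximum (respectively minimum) in $[0,T]\times\mathbb R^e\times AC^\alpha$ at a point $(r,x,\gamma)\in[0,T)\times\overline{B(0,n)}\times AC_n$, then the left-hand side of the equation at $(r,x,\gamma)$, with the ci-derivatives of $\varphi$ in place of those of $v$, is $\le0$ (respectively $\ge0$). -/

import Mathlib

open MeasureTheory Set Filter Topology Asymptotics
open scoped NNReal ENNReal

noncomputable section

namespace FracHJB

/-- `ℝⁿ` with the Euclidean norm. -/
abbrev E (n : ℕ) := EuclideanSpace ℝ (Fin n)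

/-! ### Fractional calculus -/

/-- Riemann-Liouville integral of order `α` with base point `r`:
`(1 / Γ(α)) ∫_r^t u_s / (t - s)^(1 - α) ds`. -/
def rlIntegral {k : ℕ} (α r : ℝ) (u : ℝ → E k) (t : ℝ) : E k :=
  (Real.Gamma α)⁻¹ • ∫ s in r..t, ((t - s) ^ (α - 1)) • u s

/-- Riemann-Liouville derivative of order `α` with base point `0`:
`(1 / Γ(1 - α)) d/dt ∫_0^t u_s / (t - s)^α ds`. -/
def rlDeriv {k : ℕ} (α : ℝ) (u : ℝ → E k) (t : ℝ) : E k :=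
  deriv (rlIntegral (1 - α) 0 u) t

/-- The point `0` of `[0, T]`. -/
def zeroTime (T : ℝ) [hT : Fact (0 < T)] : Icc (0 : ℝ) T :=
  ⟨0, left_mem_Icc.2 hT.out.le⟩

/-- The point `T` of `[0, T]`. -/
def endTime (T : ℝ) [hT : Fact (0 < T)] : Icc (0 : ℝ) T :=
  ⟨T, right_mem_Icc.2 hT.out.le⟩

/-- The class `AC^α([0, T], ℝ^k)`: the paths `γ_t = γ_0 + I^α u (t)` with `u ∈ L^∞([0, T], ℝ^k)`.
As a subtype of `C([0, T], ℝ^k)` it carries the sup norm topology. -/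
abbrev AC (α T : ℝ) [Fact (0 < T)] (k : ℕ) :=
  {γ : C(Icc (0 : ℝ) T, E k) //
    ∃ u : ℝ → E k, MemLp u ⊤ (volume.restrict (Icc 0 T)) ∧
      ∀ t : Icc (0 : ℝ) T, γ t = γ (zeroTime T) + rlIntegral α 0 u t}

section Paths

variable {α T : ℝ} [hT : Fact (0 < T)] {k : ℕ}

/-- `γ_t` for a real `t` (only used for `t ∈ [0, T]`; constant extension outside). -/
def AC.ext (γ : AC α T k) : ℝ → E k := IccExtend hT.out.le γ.1

/-- Caputo derivative `D^α_{0+} (γ - γ_0)`. -/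
def caputo (γ : AC α T k) : ℝ → E k :=
  rlDeriv α (fun s => AC.ext γ s - AC.ext γ 0)

/-- The set `AC_n` of all `γ ∈ AC^α` with `‖D^α (γ - γ_0)‖_∞ ≤ n` and `|γ_0| ≤ n`. -/
def ACn (α T : ℝ) [Fact (0 < T)] (k n : ℕ) : Set (AC α T k) :=
  {γ | (∀ᵐ s ∂(volume.restrict (Icc 0 T)), ‖caputo γ s‖ ≤ n) ∧ ‖AC.ext γ 0‖ ≤ n}

/-- The path `ν^{r, γ, T, u}`: it agrees with `γ` on `[0, r]` and has fractional derivative `u`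
on `[r, T]`. -/
def nu (r : ℝ) (γ : AC α T k) (u : ℝ → E k) (t : ℝ) : E k :=
  if t ≤ r then AC.ext γ t
  else AC.ext γ 0
    + (Real.Gamma α)⁻¹ • (∫ s in (0 : ℝ)..r, ((t - s) ^ (α - 1)) • caputo γ s)
    + rlIntegral α r u t

end Paths

/-! ### Functionals on `[0, T] × ℝ^e × AC^α` and co-invariant derivatives -/

/-- The space `[0, T] × ℝ^e × AC^α([0, T], ℝ^k)`, with the topology of the norm
`max {t, |x|, ‖γ‖_∞}`. -/
abbrev Pt (α T : ℝ) [Fact (0 < T)] (e k : ℕ) := Icc (0 : ℝ) T × E e × AC α T k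

section Functionals

variable {α T : ℝ} [hT : Fact (0 < T)] {e k d : ℕ}

/-- `φ` is ci-differentiable of order `α` at `p = (t, x, γ)` with derivatives
`∂_t^α φ = τ`, `∇_x^α φ = ξ`, `∇_γ^α φ = ζ`.  The remainder may depend on the continuation `ν`
of `γ` after time `t`. -/
def HasCiDeriv (φ : Pt α T e k → ℝ) (p : Pt α T e k) (τ : ℝ) (ξ : E e) (ζ : E k) : Prop :=
  ∀ ν : AC α T k, (∀ s : Icc (0 : ℝ) T, s ≤ p.1 → ν.1 s = p.2.2.1 s) →
    (fun q : Icc (0 : ℝ) T × E e =>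
        φ (q.1, q.2, ν) - φ p
          - (τ * ((q.1 : ℝ) - (p.1 : ℝ)) + inner ℝ ξ (q.2 - p.2.1)
            + inner ℝ ζ
                (rlIntegral (1 - α) 0 (fun s => AC.ext ν s - AC.ext p.2.2 0) (q.1 : ℝ)
                  - rlIntegral (1 - α) 0 (fun s => AC.ext p.2.2 s - AC.ext p.2.2 0) (p.1 : ℝ))))
      =o[𝓝[{q : Icc (0 : ℝ) T × E e | p.1 < q.1}] (p.1, p.2.1)]
    (fun q : Icc (0 : ℝ) T × E e => ((q.1 : ℝ) - (p.1 : ℝ)) + ‖q.2 - p.2.1‖)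

/-- `φ` is ci-smooth, with ci-derivatives `Dt`, `Dx`, `Dγ` on `[0, T) × ℝ^e × AC^α`
(they are uniquely determined there). -/
structure IsCiSmooth (φ : Pt α T e k → ℝ) (Dt : Pt α T e k → ℝ) (Dx : Pt α T e k → E e)
    (Dγ : Pt α T e k → E k) : Prop where
  hasCiDeriv : ∀ p : Pt α T e k, (p.1 : ℝ) < T → HasCiDeriv φ p (Dt p) (Dx p) (Dγ p)
  continuous : Continuous φ
  continuousOn_t : ContinuousOn Dt {p | (p.1 : ℝ) < T}
  continuousOn_x : ContinuousOn Dx {p | (p.1 : ℝ) < T}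
  continuousOn_γ : ContinuousOn Dγ {p | (p.1 : ℝ) < T}

/-! ### The control problem -/

/-- The data of the control problem: drift, diffusion coefficient, driving signal, running
costs, terminal cost. -/
structure Coeffs (e k d : ℕ) where
  b : E e → E k → E e
  lam : E e → E k → (E d →L[ℝ] E e)
  eta : ℝ → E d
  f : E e → E k → E k → ℝ
  psi : E e → E k → (E d →L[ℝ] ℝ)
  g : E e → E k → ℝ

/-- The derivative of the driver on `[0, T]` (one-sided at the end points). -/
def Coeffs.etaDot (c : Coeffs e k d) (T : ℝ) (s : ℝ) : E d := derivWithin c.eta (Icc 0 T) s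

/-- `X` solves `dX = b(X, w) ds + λ(X, w) dη` on `[r, T]`, `X_r = x`, for the control path `w`. -/
def Coeffs.IsState (c : Coeffs e k d) (T r : ℝ) (x : E e) (w : ℝ → E k) (X : ℝ → E e) : Prop :=
  ContinuousOn X (Icc r T) ∧
    ∀ t ∈ Icc r T,
      X t = x + ∫ s in r..t, (c.b (X s) (w s) + c.lam (X s) (w s) (c.etaDot T s))

/-- The cost of the pseudo-control `u` for the initial time `r` and the initial path `γ`, where
`X` is the controlled state. -/
def Coeffs.cost (c : Coeffs e k d) (r : ℝ) (γ : AC α T k) (u : ℝ → E k) (X : ℝ → E e) : ℝ :=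
  (∫ s in r..T, c.f (X s) (nu r γ u s) (u s))
    + (∫ s in r..T, c.psi (X s) (nu r γ u s) (c.etaDot T s))
    + c.g (X T) (nu r γ u T)

/-- All costs `J(r, x, γ, u)`, `u ∈ L^∞([r, T], ℝ^k)`. -/
def Coeffs.costSet (c : Coeffs e k d) (p : Pt α T e k) : Set ℝ :=
  {y | ∃ (u : ℝ → E k) (X : ℝ → E e), MemLp u ⊤ (volume.restrict (Icc (p.1 : ℝ) T)) ∧
      c.IsState T p.1 p.2.1 (nu p.1 p.2.2 u) X ∧ y = c.cost p.1 p.2.2 u X}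

/-- The value functional `v(r, x, γ) = inf_u J(r, x, γ, u)`. -/
def Coeffs.value (c : Coeffs e k d) (p : Pt α T e k) : ℝ := sInf (c.costSet p)

/-! ### The fractional HJB equation -/

/-- `H(x, γ, φ) = sup_u { -⟨φ, u⟩ - f(x, γ, u) }`. -/
def Coeffs.hamiltonian (c : Coeffs e k d) (x : E e) (a φ : E k) : ℝ :=
  ⨆ u : E k, (-(inner ℝ φ u) - c.f x a u)

/-- Left-hand side of the HJB equation at `p = (t, x, γ)` with the values `τ`, `ξ`, `ζ` in place of
the time, state and path derivatives. -/
def Coeffs.hjb (c : Coeffs e k d) (p : Pt α T e k) (τ : ℝ) (ξ : E e) (ζ : E k) : ℝ :=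
  -τ
    - inner ℝ ξ (c.b p.2.1 (p.2.2.1 p.1) + c.lam p.2.1 (p.2.2.1 p.1) (c.etaDot T p.1))
    + c.hamiltonian p.2.1 (p.2.2.1 p.1) ζ
    - c.psi p.2.1 (p.2.2.1 p.1) (c.etaDot T p.1)

/-- Fractional viscosity subsolution. -/
structure Coeffs.IsViscositySubsolution (c : Coeffs e k d) (v : Pt α T e k → ℝ) : Prop where
  continuous : Continuous v
  terminal : ∀ (x : E e) (γ : AC α T k), v (endTime T, x, γ) = c.g x (γ.1 (endTime T))
  test : ∀ (φ Dt : Pt α T e k → ℝ) (Dx : Pt α T e k → E e) (Dγ : Pt α T e k → E k),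
    IsCiSmooth φ Dt Dx Dγ →
    ∀ (n : ℕ) (p : Pt α T e k), (p.1 : ℝ) < T → ‖p.2.1‖ ≤ n → p.2.2 ∈ ACn α T k n →
      IsLocalMax (fun q => v q - φ q) p → c.hjb p (Dt p) (Dx p) (Dγ p) ≤ 0

/-- Fractional viscosity supersolution. -/
structure Coeffs.IsViscositySupersolution (c : Coeffs e k d) (v : Pt α T e k → ℝ) : Prop where
  continuous : Continuous v
  terminal : ∀ (x : E e) (γ : AC α T k), v (endTime T, x, γ) = c.g x (γ.1 (endTime T))
  test : ∀ (φ Dt : Pt α T e k → ℝ) (Dx : Pt α T e k → E e) (Dγ : Pt α T e k → E k),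
    IsCiSmooth φ Dt Dx Dγ →
    ∀ (n : ℕ) (p : Pt α T e k), (p.1 : ℝ) < T → ‖p.2.1‖ ≤ n → p.2.2 ∈ ACn α T k n →
      IsLocalMin (fun q => v q - φ q) p → 0 ≤ c.hjb p (Dt p) (Dx p) (Dγ p)

/-- Fractional viscosity solution of the HJB equation with its terminal condition. -/
def Coeffs.IsViscositySolution (c : Coeffs e k d) (v : Pt α T e k → ℝ) : Prop :=
  c.IsViscositySubsolution v ∧ c.IsViscositySupersolution v

/-! ### Standing assumptions -/

/-- `b ∈ Lip_b`, `λ ∈ C^1_b`, `η ∈ C^1([0, T])`. -/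
structure Coeffs.RegularDynamics (c : Coeffs e k d) (T : ℝ) : Prop where
  b_bounded : ∃ M : ℝ, ∀ x a, ‖c.b x a‖ ≤ M
  b_lipschitz : ∃ L : ℝ≥0, LipschitzWith L (fun p : E e × E k => c.b p.1 p.2)
  lam_contDiff : ContDiff ℝ 1 (fun p : E e × E k => c.lam p.1 p.2)
  lam_bounded : ∃ M : ℝ, ∀ p : E e × E k,
    ‖c.lam p.1 p.2‖ ≤ M ∧ ‖fderiv ℝ (fun p : E e × E k => c.lam p.1 p.2) p‖ ≤ M
  eta_contDiff : ContDiffOn ℝ 1 c.eta (Icc 0 T)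

/-- A.1: the costs are continuous. -/
structure Coeffs.A1 (c : Coeffs e k d) : Prop where
  f_cont : Continuous (fun p : E e × E k × E k => c.f p.1 p.2.1 p.2.2)
  psi_cont : Continuous (fun p : E e × E k => c.psi p.1 p.2)
  g_cont : Continuous (fun p : E e × E k => c.g p.1 p.2)

/-- A.2: the terminal cost is bounded below. -/
def Coeffs.A2 (c : Coeffs e k d) : Prop := ∃ m : ℝ, ∀ x a, m ≤ c.g x a

/-- A.3 with exponent `pt`: growth of the integral of `ψ` against `η`.  Here `X` is the state
started from `x` at time `r` and controlled by `γ`, and `u` is the Caputo derivative of `γ`; the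
constant may depend on `p` and `ε` and on the data, but not on `x`, `γ`, `n`, `r`, `t`. -/
def Coeffs.A3 (c : Coeffs e k d) (α T : ℝ) [Fact (0 < T)] (pt : ℝ) : Prop :=
  ∀ ε > (0 : ℝ), ∀ p > (1 : ℝ), (⌊p⌋₊ : ℝ) / p < α → ∃ C : ℝ,
    ∀ (n : ℕ) (x : E e), ∀ γ ∈ ACn α T k n, ∀ r t : ℝ, 0 ≤ r → r ≤ t → t ≤ T →
      ∀ X : ℝ → E e, c.IsState T r x (AC.ext γ) X →
        |∫ s in r..t, c.psi (X s) (AC.ext γ s) (c.etaDot T s)| ≤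
          C * (1 + (∫ s in r..t, ‖caputo γ s‖ ^ pt)
            + (∫ s in (0 : ℝ)..r, ‖caputo γ s‖ ^ pt) * |t - r| ^ (1 + ε))

/-- A.4 with exponent `q`: coercivity of the running cost. -/
def Coeffs.A4 (c : Coeffs e k d) (q : ℝ) : Prop :=
  ∃ f₀ > (0 : ℝ), ∃ C₀ > (0 : ℝ), ∀ x a u, f₀ * ‖u‖ ^ q - C₀ ≤ c.f x a u

/-- A.5: the costs are Lipschitz in `(x, γ)`, uniformly in `u`, and `f` is uniformly continuous
in `u` on bounded sets of `u`.  (Uniform continuity on all of `ℝ^k` would contradict A.4.) -/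
structure Coeffs.A5 (c : Coeffs e k d) : Prop where
  f_lip : ∃ L : ℝ≥0, ∀ u, LipschitzWith L (fun p : E e × E k => c.f p.1 p.2 u)
  psi_lip : ∃ L : ℝ≥0, LipschitzWith L (fun p : E e × E k => c.psi p.1 p.2)
  g_lip : ∃ L : ℝ≥0, LipschitzWith L (fun p : E e × E k => c.g p.1 p.2)
  f_unif : ∀ (x : E e) (a : E k) (R : ℝ), UniformContinuousOn (c.f x a) (Metric.closedBall 0 R)

end Functionals

end FracHJB

end

open FracHJB

/-!
The value functional is shown to be a viscosity solution by dynamic programming, in three layers.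

*Paths.* By the semigroup property of Riemann-Liouville integrals and Lebesgue's differentiation
theorem the Caputo derivative recovers the density of a path (`caputo_ae_eq`), so `ν^{r,γ,u}` is the
path whose density is the Caputo derivative of `γ` on `[0, r]` and `u` afterwards (`nu_eq`). Two
estimates control its dependence on `γ` and `u`. First, freezing the control at `0`
after time `r` does not increase the sup norm: the continued path is a Poisson integral of its own
past, with a positive kernel of mass at most one (`norm_continuation_le`, from the explicit integral
`lintegral_poisson`). Hence `ν^{r,γ,u}` is Lipschitz in `γ` for the sup norm, uniformly in `u`, no
matter how large the Caputo derivative of `γ` is (`norm_nu_sub_nu_le`). Second, as `q > 1 / α`, the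
kernel `(t - s) ^ (α - 1)` lies in the dual of `L^q`, so that a control bounded in `L^q` moves a
path little in a short time (`exists_norm_nu_concat_sub_le`).

*Value.* The running cost, the terminal cost and the velocity are Lipschitz in state and path, so
Grönwall's inequality gives the stability of the cost to go (`Coeffs.Bounds.abs_cost_sub_le`). From
it both halves of dynamic programming follow, with an explicit error for data that lie off the
trajectory (`Coeffs.Bounds.value_le_cost_sub`, `Coeffs.Bounds.value_le_integral_add`). Since `ψ` and
`g` grow at most linearly and `f` at least like `|u| ^ q` with `q > 1`, nearly optimal controls are
bounded in `L^q` (`Coeffs.Bounds.exists_le_cost`). This makes the value finite and, together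
with dynamic programming, continuous (`Coeffs.Bounds.continuous_value`).

*Equation.* A ci-smooth functional satisfies a chain rule along controlled trajectories
(`IsCiSmooth.le_increment`), obtained from right increments alone. Inserted into dynamic programming
over `[r, r + δ]` it gives the viscosity inequalities. A local extremum only controls paths that are
close on all of `[0, T]`; therefore the path is steered back to the Caputo derivative of `γ` after
time `r + δ`, which leaves the cost on `[r, r + δ]` unchanged
(`Coeffs.Bounds.eventually_increment`). Constant controls give the subsolution property; for the
supersolution property a `δ ^ 2`-optimal control is used, and the resulting error `ε |u|` is
absorbed by the coercivity of `f` (`Coeffs.exists_neg_hamiltonian_sub_le`).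
-/

namespace FracHJB

/-! ### Kernel integrals -/

theorem integrableOn_and_integral_eq_of_lintegral_ofReal {μ : Measure ℝ} {f : ℝ → ℝ} {S : Set ℝ}
    {C : ℝ} (hS : MeasurableSet S) (hf : Measurable f) (h0 : ∀ s ∈ S, 0 ≤ f s) (hC : 0 ≤ C)
    (h : ∫⁻ s in S, ENNReal.ofReal (f s) ∂μ = ENNReal.ofReal C) :
    IntegrableOn f S μ ∧ ∫ s in S, f s ∂μ = C := by
  have h0' : 0 ≤ᵐ[μ.restrict S] f := (ae_restrict_iff' hS).2 (Eventually.of_forall h0)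
  refine ⟨(lintegral_ofReal_ne_top_iff_integrable hf.aestronglyMeasurable h0').1 ?_, ?_⟩
  · rw [h]; exact ENNReal.ofReal_ne_top
  · rw [integral_eq_lintegral_of_nonneg_ae h0' hf.aestronglyMeasurable, h,
      ENNReal.toReal_ofReal hC]

theorem lintegral_beta_unit {α : ℝ} (hα0 : 0 < α) (hα1 : α < 1) :
    ∫⁻ y in Ioo (0 : ℝ) 1, ENNReal.ofReal (y ^ (α - 1) * (1 - y) ^ (-α)) =
      ENNReal.ofReal (Real.Gamma α * Real.Gamma (1 - α)) := by
  have h1 := ProbabilityTheory.lintegral_betaPDF_eq_one hα0 (sub_pos.2 hα1)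
  have hb : ProbabilityTheory.beta α (1 - α) = Real.Gamma α * Real.Gamma (1 - α) := by
    simp [ProbabilityTheory.beta]
  have hbp := ProbabilityTheory.beta_pos hα0 (sub_pos.2 hα1)
  rw [ProbabilityTheory.lintegral_betaPDF] at h1
  rw [← hb]
  have h2 : ∀ y : ℝ, ENNReal.ofReal (y ^ (α - 1) * (1 - y) ^ (-α)) =
      ENNReal.ofReal (ProbabilityTheory.beta α (1 - α)) * ENNReal.ofReal
        (1 / ProbabilityTheory.beta α (1 - α) * y ^ (α - 1) * (1 - y) ^ (1 - α - 1)) := by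
    intro y
    rw [← ENNReal.ofReal_mul hbp.le]
    congr 1
    rw [show 1 - α - 1 = -α by ring]
    field_simp
  simp_rw [h2]
  rw [lintegral_const_mul', h1, mul_one]
  exact ENNReal.ofReal_ne_top

theorem lintegral_beta {α τ r : ℝ} (hα0 : 0 < α) (hα1 : α < 1) (h : τ < r) :
    ∫⁻ s in Ioo τ r, ENNReal.ofReal ((r - s) ^ (-α) * (s - τ) ^ (α - 1)) =
      ENNReal.ofReal (Real.Gamma α * Real.Gamma (1 - α)) := by
  have hR : 0 < r - τ := sub_pos.2 h
  have him : (fun y : ℝ => τ + (r - τ) * y) '' Ioo 0 1 = Ioo τ r := by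
    ext s
    simp only [mem_image, mem_Ioo]
    constructor
    · rintro ⟨y, ⟨h0, h1⟩, rfl⟩
      constructor <;> nlinarith
    · rintro ⟨h0, h1⟩
      refine ⟨(s - τ) / (r - τ), ⟨div_pos (by linarith) hR, (div_lt_one hR).2 (by linarith)⟩, ?_⟩
      field_simp
      ring
  rw [← him, lintegral_image_eq_lintegral_abs_deriv_mul (f' := fun _ => r - τ) measurableSet_Ioo,
    ← lintegral_beta_unit hα0 hα1]
  · refine setLIntegral_congr_fun measurableSet_Ioo fun y hy => ?_
    rw [abs_of_pos hR, ← ENNReal.ofReal_mul hR.le]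
    congr 1
    have hy1 : 0 < 1 - y := by linarith [hy.2]
    rw [show r - (τ + (r - τ) * y) = (r - τ) * (1 - y) by ring,
      show τ + (r - τ) * y - τ = (r - τ) * y by ring, Real.mul_rpow hR.le hy1.le,
      Real.mul_rpow hR.le hy.1.le, Real.rpow_sub_one hR.ne', Real.rpow_neg hR.le]
    have := Real.rpow_pos_of_pos hR α
    field_simp
  · intro y _
    have := ((hasDerivAt_id y).const_mul (r - τ)).const_add τ
    simpa using this.hasDerivWithinAt
  · intro y _ z _ hyz
    simpa [hR.ne'] using hyz

/-- The substitution `s = τ + (h + R) R y / (h + R y)`, with `R = r - τ` and `h = t - r`, is a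
Möbius map of `(0, 1)` onto `(τ, r)` which absorbs the factor `1 / (t - s)` and leaves the Beta
integral. -/
theorem lintegral_poisson {α τ r t : ℝ} (hα0 : 0 < α) (hα1 : α < 1) (h : τ < r) (hrt : r < t) :
    ∫⁻ s in Ioo τ r, ENNReal.ofReal ((r - s) ^ (-α) / (t - s) * (s - τ) ^ (α - 1)) =
      ENNReal.ofReal (Real.Gamma α * Real.Gamma (1 - α) *
        ((t - r) ^ (-α) * (t - τ) ^ (α - 1))) := by
  obtain ⟨R, rfl⟩ : ∃ R, r = τ + R := ⟨r - τ, by ring⟩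
  obtain ⟨H, rfl⟩ : ∃ H, t = τ + R + H := ⟨t - (τ + R), by ring⟩
  have hR : 0 < R := by linarith
  have hH : 0 < H := by linarith
  have hA : 0 < H + R := by linarith
  have hB : ∀ y ∈ Ioo (0 : ℝ) 1, 0 < H + R * y := fun y hy => by nlinarith [hy.1]
  have him : (fun y : ℝ => τ + (H + R) * R * y / (H + R * y)) '' Ioo 0 1 = Ioo τ (τ + R) := by
    ext s
    simp only [mem_image]
    constructor
    · rintro ⟨y, hy, rfl⟩
      have hb := hB y hy
      have h1 : 0 < (H + R) * R * y / (H + R * y) := by have := hy.1; positivity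
      have h2 : (H + R) * R * y / (H + R * y) < R := by
        rw [div_lt_iff₀ hb]; nlinarith [mul_pos hR hH, hy.2]
      constructor <;> linarith
    · rintro ⟨h0, h1⟩
      have hden : 0 < H + R - (s - τ) := by linarith
      refine ⟨H * (s - τ) / (R * (H + R - (s - τ))), ⟨?_, ?_⟩, ?_⟩
      · have : 0 < s - τ := by linarith
        positivity
      · rw [div_lt_one (by positivity)]
        nlinarith
      · have h3 : H + R * (H * (s - τ) / (R * (H + R - (s - τ)))) =
            H * (H + R) / (H + R - (s - τ)) := by
          field_simp; ring
        rw [h3]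
        field_simp
        ring
  have hpos : 0 ≤ (τ + R + H - (τ + R)) ^ (-α) * (τ + R + H - τ) ^ (α - 1) :=
    mul_nonneg (Real.rpow_nonneg (by linarith) _) (Real.rpow_nonneg (by linarith) _)
  rw [← him, lintegral_image_eq_lintegral_abs_deriv_mul
    (f' := fun y => (H + R) * R * H / (H + R * y) ^ 2) measurableSet_Ioo,
    mul_comm (Real.Gamma α * _), ENNReal.ofReal_mul hpos,
    ← lintegral_beta_unit hα0 hα1, ← lintegral_const_mul' _ _ ENNReal.ofReal_ne_top]
  · refine setLIntegral_congr_fun measurableSet_Ioo fun y hy => ?_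
    have hb := hB y hy
    have hy0 := hy.1
    have hy1 : 0 < 1 - y := by linarith [hy.2]
    rw [abs_of_pos (by positivity), ← ENNReal.ofReal_mul (by positivity),
      ← ENNReal.ofReal_mul hpos]
    congr 1
    rw [show τ + R - (τ + (H + R) * R * y / (H + R * y)) = R * H * (1 - y) / (H + R * y) by
        field_simp; ring,
      show τ + (H + R) * R * y / (H + R * y) - τ = (H + R) * R * y / (H + R * y) by ring,
      show τ + R + H - (τ + (H + R) * R * y / (H + R * y)) = (H + R) * H / (H + R * y) by
        field_simp; ring,
      show τ + R + H - (τ + R) = H by ring, show τ + R + H - τ = H + R by ring,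
      Real.div_rpow (by positivity) hb.le, Real.div_rpow (by positivity) hb.le,
      Real.mul_rpow (by positivity) hy1.le, Real.mul_rpow hR.le hH.le,
      Real.mul_rpow (by positivity) hy0.le, Real.mul_rpow hA.le hR.le,
      Real.rpow_sub_one hA.ne', Real.rpow_sub_one hR.ne', Real.rpow_sub_one hb.ne',
      Real.rpow_neg hR.le, Real.rpow_neg hb.le]
    have := Real.rpow_pos_of_pos hR α
    have := Real.rpow_pos_of_pos hA α
    have := Real.rpow_pos_of_pos hb α
    field_simp
  · intro y hy
    have hb := hB y hy
    have h1 : HasDerivAt (fun y : ℝ => (H + R) * R * y) ((H + R) * R) y := by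
      simpa using (hasDerivAt_id y).const_mul ((H + R) * R)
    have h2 : HasDerivAt (fun y : ℝ => H + R * y) R y := by
      simpa using ((hasDerivAt_id y).const_mul R).const_add H
    have h3 := (h1.div h2 hb.ne').const_add τ
    have e : (H + R) * R * H / (H + R * y) ^ 2 =
        ((H + R) * R * (H + R * y) - (H + R) * R * y * R) / (H + R * y) ^ 2 := by
      ring
    rw [e]
    exact h3.hasDerivWithinAt
  · intro y hy z hz hyz
    have hb := hB y hy
    have hb' := hB z hz
    simp only [add_right_inj] at hyz
    rw [div_eq_div_iff hb.ne' hb'.ne'] at hyz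
    have : (H + R) * R * H * (y - z) = 0 := by linarith
    have h4 : (H + R) * R * H ≠ 0 := by positivity
    simpa [h4, sub_eq_zero] using this

/-- Fubini's theorem on the triangle `0 < τ < s < r`, for the Abel kernel `(s - τ) ^ (α - 1)` and a
weight `K` in the outer variable. -/
theorem integral_weight_abel {F : Type*} [NormedAddCommGroup F] [NormedSpace ℝ F]
    [CompleteSpace F] {α r : ℝ} {K κ : ℝ → ℝ} {w : ℝ → F} (hK : Measurable K)
    (hK0 : ∀ s ∈ Ioo 0 r, 0 ≤ K s)
    (hκ0 : ∀ τ ∈ Ioo 0 r, 0 ≤ κ τ)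
    (hw : AEStronglyMeasurable w (volume.restrict (Ioo 0 r)))
    (hκ : ∀ τ ∈ Ioo 0 r,
      ∫⁻ s in Ioo τ r, ENNReal.ofReal (K s * (s - τ) ^ (α - 1)) = ENNReal.ofReal (κ τ))
    (hi : IntegrableOn (fun τ => κ τ • w τ) (Ioo 0 r)) :
    ∫ s in Ioo 0 r, K s • ∫ τ in Ioo 0 s, ((s - τ) ^ (α - 1)) • w τ =
      ∫ τ in Ioo 0 r, κ τ • w τ := by
  set μ := volume.restrict (Ioo (0 : ℝ) r) with hμ
  set Φ : ℝ → ℝ → F := fun s τ => (if τ < s then K s * (s - τ) ^ (α - 1) else 0) • w τ with hΦ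
  have hkm : Measurable fun z : ℝ × ℝ => if z.2 < z.1 then K z.1 * (z.1 - z.2) ^ (α - 1) else 0 :=
    Measurable.ite (measurableSet_lt measurable_snd measurable_fst)
      ((hK.comp measurable_fst).mul ((measurable_fst.sub measurable_snd).pow_const _))
      measurable_const
  have hm : AEStronglyMeasurable (Function.uncurry Φ) (μ.prod μ) :=
    hkm.aestronglyMeasurable.smul hw.comp_snd
  have hker : ∀ τ ∈ Ioo 0 r,
      IntegrableOn (fun s => if τ < s then K s * (s - τ) ^ (α - 1) else 0) (Ioo 0 r) ∧
      ∫ s in Ioo 0 r, (if τ < s then K s * (s - τ) ^ (α - 1) else 0) = κ τ := by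
    intro τ hτ
    have hsub : Ioo τ r ⊆ Ioo 0 r := Ioo_subset_Ioo_left hτ.1.le
    obtain ⟨h1, h2⟩ := integrableOn_and_integral_eq_of_lintegral_ofReal (μ := volume)
      (f := fun s => K s * (s - τ) ^ (α - 1)) measurableSet_Ioo
      (hK.mul ((measurable_id.sub_const τ).pow_const _))
      (fun s hs => mul_nonneg (hK0 s (hsub hs)) (Real.rpow_nonneg (by linarith [hs.1]) _))
      (hκ0 τ hτ) (hκ τ hτ)
    have hset : Ioo 0 r ∩ Ioi τ = Ioo τ r := by
      ext s; simp only [mem_inter_iff, mem_Ioo, mem_Ioi]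
      constructor
      · rintro ⟨⟨_, h⟩, h'⟩; exact ⟨h', h⟩
      · rintro ⟨h, h'⟩; exact ⟨⟨hτ.1.trans h, h'⟩, h⟩
    have hind : (fun s => if τ < s then K s * (s - τ) ^ (α - 1) else 0) =
        (Ioi τ).indicator (fun s => K s * (s - τ) ^ (α - 1)) := by
      ext s; simp [indicator]
    rw [hind]
    constructor
    · rw [IntegrableOn, integrable_indicator_iff measurableSet_Ioi, IntegrableOn,
        Measure.restrict_restrict measurableSet_Ioi, inter_comm, hset]
      exact h1
    · rw [setIntegral_indicator measurableSet_Ioi, hset, h2]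
  have hint : Integrable (Function.uncurry Φ) (μ.prod μ) := by
    rw [integrable_prod_iff' hm]
    constructor
    · refine (ae_restrict_iff' measurableSet_Ioo).2 (Eventually.of_forall fun τ hτ => ?_)
      exact (hker τ hτ).1.smul_const (w τ)
    · refine hi.norm.congr ((ae_restrict_iff' measurableSet_Ioo).2
        (Eventually.of_forall fun τ hτ => ?_))
      simp only [Function.uncurry_apply_pair, hΦ, norm_smul]
      rw [integral_mul_const]
      congr 1
      rw [Real.norm_of_nonneg (hκ0 τ hτ), ← (hker τ hτ).2]
      refine setIntegral_congr_fun measurableSet_Ioo fun s hs => ?_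
      split_ifs with hlt
      · rw [Real.norm_of_nonneg]
        exact mul_nonneg (hK0 s hs) (Real.rpow_nonneg (by linarith) _)
      · simp
  have hswap := integral_integral_swap hint
  have hl : ∫ s, ∫ τ, Φ s τ ∂μ ∂μ =
      ∫ s in Ioo 0 r, K s • ∫ τ in Ioo 0 s, ((s - τ) ^ (α - 1)) • w τ := by
    refine setIntegral_congr_fun measurableSet_Ioo fun s hs => ?_
    have hset : Ioo 0 r ∩ Iio s = Ioo 0 s := by
      ext τ; simp only [mem_inter_iff, mem_Ioo, mem_Iio]
      constructor
      · rintro ⟨⟨h, _⟩, h'⟩; exact ⟨h, h'⟩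
      · rintro ⟨h, h'⟩; exact ⟨⟨h, h'.trans hs.2⟩, h'⟩
    have hind : (fun τ => Φ s τ) =
        (Iio s).indicator (fun τ => (K s * (s - τ) ^ (α - 1)) • w τ) := by
      ext τ
      by_cases h : τ < s <;> simp [hΦ, indicator, h]
    simp only [hind]
    rw [hμ, setIntegral_indicator measurableSet_Iio, hset, ← integral_smul]
    simp_rw [mul_smul]
  have hr : ∫ τ, ∫ s, Φ s τ ∂μ ∂μ = ∫ τ in Ioo 0 r, κ τ • w τ := by
    refine setIntegral_congr_fun measurableSet_Ioo fun τ hτ => ?_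
    simp only [hΦ]
    rw [integral_smul_const, (hker τ hτ).2]
  rw [← hl, hswap, hr]

/-! ### Riemann-Liouville integrals of bounded functions -/

theorem intervalIntegral_eq_integral_Ioo {F : Type*} [NormedAddCommGroup F] [NormedSpace ℝ F]
    {a b : ℝ} (h : a ≤ b) (f : ℝ → F) : ∫ s in a..b, f s = ∫ s in Ioo a b, f s := by
  rw [intervalIntegral.integral_of_le h, integral_Ioc_eq_integral_Ioo]

theorem intervalIntegrable_sub_rpow {β : ℝ} (hβ : -1 < β) (a b t : ℝ) :
    IntervalIntegrable (fun s => (t - s) ^ β) volume a b := by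
  have := (intervalIntegral.intervalIntegrable_rpow' (a := t - a) (b := t - b) hβ).comp_sub_left t
  simpa using this

theorem integral_sub_rpow {β : ℝ} (hβ : -1 < β) (a b t : ℝ) :
    ∫ s in a..b, (t - s) ^ β = ((t - a) ^ (β + 1) - (t - b) ^ (β + 1)) / (β + 1) := by
  rw [intervalIntegral.integral_comp_sub_left (fun x => x ^ β) t, integral_rpow (Or.inl hβ)]

theorem _root_.MeasureTheory.MemLp.ae_norm_le_bound {F : Type*} [NormedAddCommGroup F]
    {μ : Measure ℝ} {w : ℝ → F}
    (hw : MemLp w ⊤ μ) : ∃ N : ℝ, 0 ≤ N ∧ ∀ᵐ s ∂μ, ‖w s‖ ≤ N := by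
  refine ⟨(eLpNorm w ⊤ μ).toReal, ENNReal.toReal_nonneg, ?_⟩
  have h := ae_le_eLpNormEssSup (f := w) (μ := μ)
  filter_upwards [h] with s hs
  rw [← eLpNorm_exponent_top] at hs
  have := ENNReal.toReal_mono hw.eLpNorm_ne_top hs
  simpa using this

theorem intervalIntegrable_smul_of_memLp_top {F : Type*} [NormedAddCommGroup F] [NormedSpace ℝ F]
    {a b : ℝ} (hab : a ≤ b) {k : ℝ → ℝ} {w : ℝ → F} (hk : IntervalIntegrable k volume a b)
    (hw : MemLp w ⊤ (volume.restrict (Icc a b))) :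
    IntervalIntegrable (fun s => k s • w s) volume a b := by
  rw [intervalIntegrable_iff_integrableOn_Icc_of_le hab] at hk ⊢
  obtain ⟨N, hN0, hN⟩ := hw.ae_norm_le_bound
  refine (hk.norm.mul_const N).mono (hk.aestronglyMeasurable.smul hw.1) ?_
  filter_upwards [hN] with s hs
  rw [norm_smul, norm_mul, norm_norm, Real.norm_of_nonneg hN0]
  gcongr

theorem memLp_top_Icc_mono {F : Type*} [NormedAddCommGroup F] {a b a' b' : ℝ} {w : ℝ → F}
    (hw : MemLp w ⊤ (volume.restrict (Icc a b))) (ha : a ≤ a') (hb : b' ≤ b) :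
    MemLp w ⊤ (volume.restrict (Icc a' b')) :=
  hw.mono_measure (Measure.restrict_mono (Icc_subset_Icc ha hb) le_rfl)

theorem intervalIntegrable_of_memLp_top {F : Type*} [NormedAddCommGroup F] [NormedSpace ℝ F]
    {a b : ℝ} (hab : a ≤ b) {w : ℝ → F} (hw : MemLp w ⊤ (volume.restrict (Icc a b))) :
    IntervalIntegrable w volume a b := by
  simpa using intervalIntegrable_smul_of_memLp_top hab (k := fun _ => 1) (by simp) hw

theorem norm_integral_smul_le_of_ae_bound {F : Type*} [NormedAddCommGroup F] [NormedSpace ℝ F]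
    {a b N : ℝ} (hab : a ≤ b) {k : ℝ → ℝ} {w : ℝ → F} (hk : IntervalIntegrable k volume a b)
    (hk0 : ∀ s ∈ Ioo a b, 0 ≤ k s) (hN : ∀ᵐ s ∂volume.restrict (Ioo a b), ‖w s‖ ≤ N) :
    ‖∫ s in a..b, k s • w s‖ ≤ N * ∫ s in a..b, k s := by
  rw [intervalIntegral_eq_integral_Ioo hab, intervalIntegral_eq_integral_Ioo hab,
    ← integral_const_mul]
  rw [intervalIntegrable_iff_integrableOn_Ioo_of_le hab] at hk
  refine norm_integral_le_of_norm_le (hk.const_mul N) ?_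
  filter_upwards [hN, ae_restrict_mem measurableSet_Ioo] with s hs hm
  rw [norm_smul, Real.norm_of_nonneg (hk0 s hm), mul_comm]
  exact mul_le_mul_of_nonneg_right hs (hk0 s hm)

variable {k : ℕ} {α T : ℝ}

/-- The Riemann-Liouville integral of order `α` of a bounded function is `α`-Hölder continuous. -/
theorem norm_rlIntegral_sub_le (hα0 : 0 < α) (hα1 : α < 1) {N : ℝ} {w : ℝ → E k}
    (hw : MemLp w ⊤ (volume.restrict (Icc 0 T)))
    (hN : ∀ᵐ s ∂volume.restrict (Icc 0 T), ‖w s‖ ≤ N) (hN0 : 0 ≤ N)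
    {t t' : ℝ} (ht : 0 ≤ t) (htt : t ≤ t') (ht' : t' ≤ T) :
    ‖rlIntegral α 0 w t' - rlIntegral α 0 w t‖ ≤
      (Real.Gamma α)⁻¹ * (2 * N / α * (t' - t) ^ α) := by
  have hβ : -1 < α - 1 := by linarith
  have hG := Real.Gamma_pos_of_pos hα0
  have i1 := intervalIntegrable_smul_of_memLp_top ht (intervalIntegrable_sub_rpow hβ 0 t t')
    (memLp_top_Icc_mono hw le_rfl (htt.trans ht'))
  have i2 := intervalIntegrable_smul_of_memLp_top htt (intervalIntegrable_sub_rpow hβ t t' t')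
    (memLp_top_Icc_mono hw ht ht')
  have i3 := intervalIntegrable_smul_of_memLp_top ht (intervalIntegrable_sub_rpow hβ 0 t t)
    (memLp_top_Icc_mono hw le_rfl (htt.trans ht'))
  have hNI : ∀ {a b : ℝ}, 0 ≤ a → b ≤ T → ∀ᵐ s ∂volume.restrict (Ioo a b), ‖w s‖ ≤ N :=
    fun ha hb => ae_restrict_of_ae_restrict_of_subset
      (Ioo_subset_Icc_self.trans (Icc_subset_Icc ha hb)) hN
  have e1 : rlIntegral α 0 w t' - rlIntegral α 0 w t = (Real.Gamma α)⁻¹ •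
      ((∫ s in t..t', ((t' - s) ^ (α - 1)) • w s) -
        ∫ s in (0 : ℝ)..t, ((t - s) ^ (α - 1) - (t' - s) ^ (α - 1)) • w s) := by
    simp only [rlIntegral, ← smul_sub, sub_smul]
    rw [intervalIntegral.integral_sub i3 i1,
      ← intervalIntegral.integral_add_adjacent_intervals i1 i2]
    congr 1
    abel
  rw [e1, norm_smul, norm_inv, Real.norm_of_nonneg hG.le]
  refine mul_le_mul_of_nonneg_left ?_ (by positivity)
  have b1 := norm_integral_smul_le_of_ae_bound htt (intervalIntegrable_sub_rpow hβ t t' t')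
    (fun s hs => Real.rpow_nonneg (by linarith [hs.2]) _) (hNI ht ht')
  have b2 := norm_integral_smul_le_of_ae_bound ht
    ((intervalIntegrable_sub_rpow hβ 0 t t).sub (intervalIntegrable_sub_rpow hβ 0 t t'))
    (fun s hs => sub_nonneg.2 (Real.rpow_le_rpow_of_nonpos (by linarith [hs.2]) (by linarith)
      (by linarith))) (hNI le_rfl (htt.trans ht'))
  rw [intervalIntegral.integral_sub (intervalIntegrable_sub_rpow hβ 0 t t)
    (intervalIntegrable_sub_rpow hβ 0 t t')] at b2
  simp only [integral_sub_rpow hβ, sub_add_cancel, sub_self, sub_zero,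
    Real.zero_rpow hα0.ne'] at b1 b2
  have h3 : t ^ α ≤ t' ^ α := Real.rpow_le_rpow ht htt hα0.le
  have h4 : N * (t ^ α / α - (t' ^ α - (t' - t) ^ α) / α) ≤ N * ((t' - t) ^ α / α) := by
    refine mul_le_mul_of_nonneg_left ?_ hN0
    rw [← sub_div]
    exact div_le_div_of_nonneg_right (by linarith) hα0.le
  refine (norm_sub_le _ _).trans ?_
  calc _ ≤ N * ((t' - t) ^ α / α) + N * ((t' - t) ^ α / α) := by linarith
    _ = _ := by ring

theorem continuousOn_rlIntegral (hα0 : 0 < α) (hα1 : α < 1) {w : ℝ → E k}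
    (hw : MemLp w ⊤ (volume.restrict (Icc 0 T))) :
    ContinuousOn (rlIntegral α 0 w) (Icc 0 T) := by
  obtain ⟨N, hN0, hN⟩ := hw.ae_norm_le_bound
  have key : ∀ t ∈ Icc 0 T, ∀ t' ∈ Icc 0 T, ‖rlIntegral α 0 w t' - rlIntegral α 0 w t‖ ≤
      (Real.Gamma α)⁻¹ * (2 * N / α * |t' - t| ^ α) := by
    intro t ht t' ht'
    rcases le_total t t' with h | h
    · rw [abs_of_nonneg (sub_nonneg.2 h)]
      exact norm_rlIntegral_sub_le hα0 hα1 hw hN hN0 ht.1 h ht'.2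
    · rw [abs_of_nonpos (sub_nonpos.2 h), neg_sub, norm_sub_rev]
      exact norm_rlIntegral_sub_le hα0 hα1 hw hN hN0 ht'.1 h ht.2
  intro t ht
  rw [ContinuousWithinAt, tendsto_iff_norm_sub_tendsto_zero]
  have h0 : Tendsto (fun t' => (Real.Gamma α)⁻¹ * (2 * N / α * |t' - t| ^ α)) (𝓝[Icc 0 T] t)
      (𝓝 0) := by
    have hc : Continuous fun t' : ℝ => (Real.Gamma α)⁻¹ * (2 * N / α * |t' - t| ^ α) := by
      have : Continuous fun t' : ℝ => |t' - t| ^ α :=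
        (continuous_id.sub continuous_const).abs.rpow_const fun _ => Or.inr hα0.le
      fun_prop
    have := (hc.tendsto t).mono_left (nhdsWithin_le_nhds (s := Icc 0 T))
    simpa [Real.zero_rpow hα0.ne'] using this
  refine squeeze_zero' (Eventually.of_forall fun _ => norm_nonneg _) ?_ h0
  filter_upwards [self_mem_nhdsWithin] with t' ht' using key t ht t' ht'

theorem rlIntegral_rlIntegral (hα0 : 0 < α) (hα1 : α < 1) {w : ℝ → E k} {t : ℝ} (ht : 0 ≤ t)
    (hw : MemLp w ⊤ (volume.restrict (Icc 0 t))) :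
    rlIntegral (1 - α) 0 (rlIntegral α 0 w) t = ∫ s in (0 : ℝ)..t, w s := by
  have hG := Real.Gamma_pos_of_pos hα0
  have hG' := Real.Gamma_pos_of_pos (sub_pos.2 hα1)
  have key := integral_weight_abel (α := α) (r := t) (K := fun s => (t - s) ^ (-α))
    (κ := fun _ => Real.Gamma α * Real.Gamma (1 - α)) (w := w)
    ((measurable_const.sub measurable_id).pow_const _)
    (fun s hs => Real.rpow_nonneg (by linarith [hs.2]) _) (fun _ _ => by positivity)
    (hw.1.mono_measure (Measure.restrict_mono Ioo_subset_Icc_self le_rfl))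
    (fun τ hτ => lintegral_beta hα0 hα1 hτ.2)
    (Integrable.smul (Real.Gamma α * Real.Gamma (1 - α))
      ((intervalIntegrable_iff_integrableOn_Ioo_of_le ht).1
        (intervalIntegrable_of_memLp_top ht hw)) :)
  rw [integral_smul] at key
  rw [rlIntegral, intervalIntegral_eq_integral_Ioo ht, intervalIntegral_eq_integral_Ioo ht,
    show 1 - α - 1 = -α by ring]
  have e : ∫ s in Ioo 0 t, (t - s) ^ (-α) • rlIntegral α 0 w s = (Real.Gamma α)⁻¹ •
      ∫ s in Ioo 0 t, (t - s) ^ (-α) • ∫ τ in Ioo 0 s, ((s - τ) ^ (α - 1)) • w τ := by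
    rw [← integral_smul]
    refine setIntegral_congr_fun measurableSet_Ioo fun s hs => ?_
    rw [rlIntegral, intervalIntegral_eq_integral_Ioo hs.1.le, smul_comm]
  rw [e, key, smul_smul, smul_smul]
  rw [show (Real.Gamma (1 - α))⁻¹ * (Real.Gamma α)⁻¹ * (Real.Gamma α * Real.Gamma (1 - α)) = 1 by
    field_simp, one_smul]

/-- Total mass of the Poisson kernel: it represents the function which is constant on `(0, r)`, the
fractional integral of a multiple of `τ ^ (-α)`, whose continuation past `r` is not larger. -/
theorem integral_poisson_le (hα0 : 0 < α) (hα1 : α < 1) {r t : ℝ} (hr : 0 < r) (hrt : r < t) :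
    IntegrableOn (fun s => (r - s) ^ (-α) / (t - s)) (Ioo 0 r) ∧
    ∫ s in Ioo 0 r, (r - s) ^ (-α) / (t - s) ≤
      Real.Gamma α * Real.Gamma (1 - α) * (t - r) ^ (-α) := by
  have hG := Real.Gamma_pos_of_pos hα0
  have hG' := Real.Gamma_pos_of_pos (sub_pos.2 hα1)
  set c := Real.Gamma α * Real.Gamma (1 - α) with hc
  have hc0 : 0 < c := by positivity
  have hmK : Measurable fun s => (r - s) ^ (-α) / (t - s) :=
    ((measurable_const.sub measurable_id).pow_const _).div (measurable_const.sub measurable_id)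
  have hK0 : ∀ s ∈ Ioo 0 r, 0 ≤ (r - s) ^ (-α) / (t - s) := fun s hs =>
    div_nonneg (Real.rpow_nonneg (by linarith [hs.2]) _) (by linarith [hs.2])
  have hKi : IntegrableOn (fun s => (r - s) ^ (-α) / (t - s)) (Ioo 0 r) := by
    have h1 := (intervalIntegrable_iff_integrableOn_Ioo_of_le hr.le).1
      (intervalIntegrable_sub_rpow (β := -α) (by linarith) 0 r r)
    refine (h1.div_const (t - r)).mono hmK.aestronglyMeasurable ?_
    filter_upwards [ae_restrict_mem measurableSet_Ioo] with s hs
    have h2 : 0 ≤ (r - s) ^ (-α) := Real.rpow_nonneg (by linarith [hs.2]) _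
    have h3 : 0 < t - r := by linarith
    rw [Real.norm_of_nonneg (hK0 s hs), Real.norm_of_nonneg (by positivity)]
    exact div_le_div_of_nonneg_left h2 h3 (by linarith [hs.2])
  refine ⟨hKi, ?_⟩
  have hbeta : ∀ x : ℝ, 0 < x →
      IntegrableOn (fun τ => (x - τ) ^ (α - 1) * τ ^ (-α)) (Ioo 0 x) ∧
      ∫ τ in Ioo 0 x, (x - τ) ^ (α - 1) * τ ^ (-α) = c := by
    intro x hx
    have h1 := lintegral_beta (α := 1 - α) (sub_pos.2 hα1) (by linarith) hx
    simp only [sub_zero, sub_sub_cancel] at h1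
    rw [show -(1 - α) = α - 1 by ring, show 1 - α - 1 = -α by ring, mul_comm, ← hc] at h1
    exact integrableOn_and_integral_eq_of_lintegral_ofReal measurableSet_Ioo
      (((measurable_const.sub measurable_id).pow_const _).mul (measurable_id.pow_const _))
      (fun s hs => mul_nonneg (Real.rpow_nonneg (by linarith [hs.2]) _)
        (Real.rpow_nonneg hs.1.le _)) hc0.le h1
  -- the continuation past `r` of the constant function: `∫_0^r` is part of the Beta integral
  -- over `(0, t)`
  have hdom := (hbeta t (hr.trans hrt)).1.mono_set (Ioo_subset_Ioo_right hrt.le)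
  have hdomi : IntegrableOn (fun τ => (c * ((t - r) ^ (-α) * (t - τ) ^ (α - 1))) • τ ^ (-α))
      (Ioo 0 r) := by
    refine IntegrableOn.congr_fun (hdom.const_mul (c * (t - r) ^ (-α))) (fun τ _ => ?_)
      measurableSet_Ioo
    simp only [smul_eq_mul]; ring
  have key := integral_weight_abel (α := α) (r := r) (K := fun s => (r - s) ^ (-α) / (t - s))
    (κ := fun τ => c * ((t - r) ^ (-α) * (t - τ) ^ (α - 1))) (w := fun τ => τ ^ (-α)) hmK hK0
    (fun τ hτ => mul_nonneg hc0.le (mul_nonneg (Real.rpow_nonneg (by linarith) _)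
      (Real.rpow_nonneg (by linarith [hτ.2]) _)))
    (measurable_id.pow_const _).aestronglyMeasurable
    (fun τ hτ => lintegral_poisson hα0 hα1 hτ.2 hrt) hdomi
  have hl : ∫ s in Ioo 0 r, ((r - s) ^ (-α) / (t - s)) •
      ∫ τ in Ioo 0 s, ((s - τ) ^ (α - 1)) • τ ^ (-α) =
      (∫ s in Ioo 0 r, (r - s) ^ (-α) / (t - s)) * c := by
    rw [← integral_mul_const]
    refine setIntegral_congr_fun measurableSet_Ioo fun s hs => ?_
    simp only [smul_eq_mul, (hbeta s hs.1).2]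
  have hr' : ∫ τ in Ioo 0 r, (c * ((t - r) ^ (-α) * (t - τ) ^ (α - 1))) • τ ^ (-α) ≤
      c * (t - r) ^ (-α) * c := by
    have e : ∫ τ in Ioo 0 r, (c * ((t - r) ^ (-α) * (t - τ) ^ (α - 1))) • τ ^ (-α) =
        c * (t - r) ^ (-α) * ∫ τ in Ioo 0 r, (t - τ) ^ (α - 1) * τ ^ (-α) := by
      rw [← integral_const_mul]
      refine setIntegral_congr_fun measurableSet_Ioo fun s _ => ?_
      simp only [smul_eq_mul]; ring
    rw [e]
    have h0 : 0 ≤ (t - r) ^ (-α) := Real.rpow_nonneg (by linarith) _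
    refine mul_le_mul_of_nonneg_left ?_ (by positivity)
    rw [← (hbeta t (hr.trans hrt)).2]
    refine setIntegral_mono_set (hbeta t (hr.trans hrt)).1 ?_
      (Ioo_subset_Ioo_right hrt.le).eventuallyLE
    filter_upwards [ae_restrict_mem measurableSet_Ioo] with s hs
    exact mul_nonneg (Real.rpow_nonneg (by linarith [hs.2]) _) (Real.rpow_nonneg hs.1.le _)
  rw [← key, hl] at hr'
  exact le_of_mul_le_mul_right hr' hc0

/-- Maximum principle: freezing the control at `0` after time `r` does not increase the sup norm of
a fractional integral.  The continuation is a Poisson integral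
`Γ(α)⁻¹ Γ(1 - α)⁻¹ ∫_0^r (t - r)^α (r - s)^(-α) / (t - s) I^α w(s) ds` of the values on `[0, r]`,
with a positive kernel of mass at most `1`. -/
theorem norm_continuation_le (hα0 : 0 < α) (hα1 : α < 1) {r t G : ℝ} (hr : 0 ≤ r) (hrt : r < t)
    {w : ℝ → E k} (hw : MemLp w ⊤ (volume.restrict (Icc 0 r)))
    (hG : ∀ s ∈ Icc 0 r, ‖rlIntegral α 0 w s‖ ≤ G) :
    ‖(Real.Gamma α)⁻¹ • ∫ s in (0 : ℝ)..r, ((t - s) ^ (α - 1)) • w s‖ ≤ G := by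
  have hG0 : 0 ≤ G := (norm_nonneg _).trans (hG 0 ⟨le_rfl, hr⟩)
  rcases hr.eq_or_lt with rfl | hr
  · simpa using hG0
  have hΓ := Real.Gamma_pos_of_pos hα0
  have hΓ' := Real.Gamma_pos_of_pos (sub_pos.2 hα1)
  set c := Real.Gamma α * Real.Gamma (1 - α) with hc
  have hc0 : 0 < c := by positivity
  set P := (t - r) ^ (-α) with hP
  have hP0 : 0 < P := Real.rpow_pos_of_pos (by linarith) _
  obtain ⟨hKi, hKm⟩ := integral_poisson_le hα0 hα1 hr hrt
  have hmK : Measurable fun s => (r - s) ^ (-α) / (t - s) :=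
    ((measurable_const.sub measurable_id).pow_const _).div (measurable_const.sub measurable_id)
  have hK0 : ∀ s ∈ Ioo 0 r, 0 ≤ (r - s) ^ (-α) / (t - s) := fun s hs =>
    div_nonneg (Real.rpow_nonneg (by linarith [hs.2]) _) (by linarith [hs.2])
  have hii : IntegrableOn (fun τ => (t - τ) ^ (α - 1) • w τ) (Ioo 0 r) :=
    (intervalIntegrable_iff_integrableOn_Ioo_of_le hr.le).1
      (intervalIntegrable_smul_of_memLp_top hr.le
        (intervalIntegrable_sub_rpow (by linarith) 0 r t) hw)
  have key := integral_weight_abel (α := α) (r := r) (K := fun s => (r - s) ^ (-α) / (t - s))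
    (κ := fun τ => c * (P * (t - τ) ^ (α - 1))) (w := w) hmK hK0
    (fun τ hτ => mul_nonneg hc0.le (mul_nonneg hP0.le (Real.rpow_nonneg (by linarith [hτ.2]) _)))
    (hw.1.mono_measure (Measure.restrict_mono Ioo_subset_Icc_self le_rfl))
    (fun τ hτ => lintegral_poisson hα0 hα1 hτ.2 hrt) (by
      refine IntegrableOn.congr_fun (hii.smul (c * P)) (fun τ _ => ?_) measurableSet_Ioo
      simp only [Pi.smul_apply, smul_smul, mul_assoc])
  have e1 : ∫ τ in Ioo 0 r, (c * (P * (t - τ) ^ (α - 1))) • w τ =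
      (c * P) • ∫ s in (0 : ℝ)..r, ((t - s) ^ (α - 1)) • w s := by
    rw [intervalIntegral_eq_integral_Ioo hr.le, ← integral_smul]
    refine setIntegral_congr_fun measurableSet_Ioo fun s _ => ?_
    simp only [smul_smul, mul_assoc]
  have e2 : ∫ s in Ioo 0 r, ((r - s) ^ (-α) / (t - s)) •
      ∫ τ in Ioo 0 s, ((s - τ) ^ (α - 1)) • w τ =
      Real.Gamma α • ∫ s in Ioo 0 r, ((r - s) ^ (-α) / (t - s)) • rlIntegral α 0 w s := by
    rw [← integral_smul]
    refine setIntegral_congr_fun measurableSet_Ioo fun s hs => ?_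
    simp only [rlIntegral]
    rw [intervalIntegral_eq_integral_Ioo hs.1.le, smul_comm, smul_smul (Real.Gamma α),
      mul_inv_cancel₀ hΓ.ne', one_smul]
  have e3 : (Real.Gamma α)⁻¹ • ∫ s in (0 : ℝ)..r, ((t - s) ^ (α - 1)) • w s =
      (c * P)⁻¹ • ∫ s in Ioo 0 r, ((r - s) ^ (-α) / (t - s)) • rlIntegral α 0 w s := by
    rw [e1, e2] at key
    have := congrArg (fun x => ((Real.Gamma α)⁻¹ * (c * P)⁻¹) • x) key
    simp only [smul_smul] at this
    rw [show (Real.Gamma α)⁻¹ * (c * P)⁻¹ * (c * P) = (Real.Gamma α)⁻¹ by field_simp,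
      show (Real.Gamma α)⁻¹ * (c * P)⁻¹ * Real.Gamma α = (c * P)⁻¹ by field_simp] at this
    exact this.symm
  have hb : ‖∫ s in Ioo 0 r, ((r - s) ^ (-α) / (t - s)) • rlIntegral α 0 w s‖ ≤
      (∫ s in Ioo 0 r, (r - s) ^ (-α) / (t - s)) * G := by
    rw [← integral_mul_const]
    refine norm_integral_le_of_norm_le (hKi.mul_const G) ?_
    filter_upwards [ae_restrict_mem measurableSet_Ioo] with s hs
    rw [norm_smul, Real.norm_of_nonneg (hK0 s hs)]
    exact mul_le_mul_of_nonneg_left (hG s (Ioo_subset_Icc_self hs)) (hK0 s hs)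
  rw [e3, norm_smul, norm_inv, Real.norm_of_nonneg (by positivity),
    inv_mul_le_iff₀ (by positivity)]
  exact hb.trans (mul_le_mul_of_nonneg_right hKm hG0)

/-- Hölder's inequality for the Abel kernel, which belongs to `L^{q'}` because `q > 1 / α`. -/
theorem exists_norm_abel_le_rpow (hα0 : 0 < α) (hα1 : α < 1) {q : ℝ} (hq : 1 / α < q) :
    ∃ C : ℝ, 0 ≤ C ∧ ∀ (a b t : ℝ) (w : ℝ → E k), a ≤ b → b ≤ t →
      MemLp w ⊤ (volume.restrict (Icc a b)) →
      ‖∫ s in a..b, ((t - s) ^ (α - 1)) • w s‖ ≤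
        C * (b - a) ^ (α - 1 / q) * (∫ s in a..b, ‖w s‖ ^ q) ^ (1 / q) := by
  have hq1 : 1 < q := lt_trans (by rw [lt_div_iff₀ hα0]; linarith) hq
  have hq0 : 0 < q := by linarith
  set p := q.conjExponent with hp
  have hpq : p.HolderConjugate q := (Real.HolderConjugate.conjExponent hq1).symm
  have hp0 : 0 < p := hpq.pos
  have hinv : p⁻¹ = 1 - q⁻¹ := by have := hpq.inv_add_inv_eq_one; linarith
  have hqα : q⁻¹ < α := by
    rw [inv_lt_comm₀ hq0 hα0]; simpa using hq
  have hβ : -1 < (α - 1) * p := by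
    have : (1 - α) < p⁻¹ := by rw [hinv]; linarith
    have := mul_lt_mul_of_pos_right this hp0
    rw [inv_mul_cancel₀ hp0.ne'] at this
    linarith
  set β := (α - 1) * p + 1 with hβd
  have hβ0 : 0 < β := by linarith
  refine ⟨(β⁻¹) ^ (1 / p), by positivity, fun a b t w hab hbt hw => ?_⟩
  have hwq : MemLp (fun s => ‖w s‖) (ENNReal.ofReal q) (volume.restrict (Ioo a b)) :=
    ((hw.mono_measure (Measure.restrict_mono Ioo_subset_Icc_self le_rfl)).mono_exponent
      le_top).norm
  have hker0 : ∀ s ∈ Ioo a b, 0 ≤ (t - s) ^ (α - 1) :=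
    fun s hs => Real.rpow_nonneg (by linarith [hs.2]) _
  have hpow : ∀ s ∈ Ioo a b, ((t - s) ^ (α - 1)) ^ p = (t - s) ^ ((α - 1) * p) := fun s hs => by
    rw [← Real.rpow_mul (by linarith [hs.2])]
  have hi := (intervalIntegrable_iff_integrableOn_Ioo_of_le hab).1
    (intervalIntegrable_sub_rpow hβ a b t)
  have hkm : Measurable fun s => (t - s) ^ (α - 1) :=
    (measurable_const.sub measurable_id).pow_const _
  have hkp : MemLp (fun s => (t - s) ^ (α - 1)) (ENNReal.ofReal p)
      (volume.restrict (Ioo a b)) := by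
    rw [← integrable_norm_rpow_iff hkm.aestronglyMeasurable (by simpa using hp0)
      ENNReal.ofReal_ne_top, ENNReal.toReal_ofReal hp0.le]
    refine IntegrableOn.congr_fun hi (fun s hs => ?_) measurableSet_Ioo
    rw [Real.norm_of_nonneg (hker0 s hs), hpow s hs]
  have hH := integral_mul_le_Lp_mul_Lq_of_nonneg (μ := volume.restrict (Ioo a b)) hpq
    (f := fun s => (t - s) ^ (α - 1)) (g := fun s => ‖w s‖)
    ((ae_restrict_iff' measurableSet_Ioo).2 (Eventually.of_forall hker0))
    (Eventually.of_forall fun _ => norm_nonneg _) hkp hwq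
  have h1 : ‖∫ s in a..b, ((t - s) ^ (α - 1)) • w s‖ ≤
      ∫ s in Ioo a b, (t - s) ^ (α - 1) * ‖w s‖ := by
    rw [intervalIntegral_eq_integral_Ioo hab]
    refine (norm_integral_le_integral_norm _).trans_eq ?_
    refine setIntegral_congr_fun measurableSet_Ioo fun s hs => ?_
    simp only [norm_smul]
    rw [Real.norm_of_nonneg (hker0 s hs)]
  -- the kernel is largest for `t = b`, where its integral is explicit
  have h2 : ∫ s in Ioo a b, ((t - s) ^ (α - 1)) ^ p ≤ β⁻¹ * (b - a) ^ β := by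
    have hi' := (intervalIntegrable_iff_integrableOn_Ioo_of_le hab).1
      (intervalIntegrable_sub_rpow hβ a b b)
    calc ∫ s in Ioo a b, ((t - s) ^ (α - 1)) ^ p = ∫ s in Ioo a b, (t - s) ^ ((α - 1) * p) :=
          setIntegral_congr_fun measurableSet_Ioo hpow
      _ ≤ ∫ s in Ioo a b, (b - s) ^ ((α - 1) * p) := by
          refine setIntegral_mono_on hi hi' measurableSet_Ioo fun s hs => ?_
          exact Real.rpow_le_rpow_of_nonpos (by linarith [hs.2]) (by linarith)
            (mul_nonpos_of_nonpos_of_nonneg (by linarith) hp0.le)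
      _ = β⁻¹ * (b - a) ^ β := by
          rw [← intervalIntegral_eq_integral_Ioo hab, integral_sub_rpow hβ, sub_self, ← hβd,
            Real.zero_rpow hβ0.ne', sub_zero, div_eq_inv_mul]
  have hba : 0 ≤ b - a := sub_nonneg.2 hab
  have h3 : (∫ s in Ioo a b, ((t - s) ^ (α - 1)) ^ p) ^ (1 / p) ≤
      (β⁻¹) ^ (1 / p) * (b - a) ^ (α - 1 / q) := by
    calc _ ≤ (β⁻¹ * (b - a) ^ β) ^ (1 / p) :=
          Real.rpow_le_rpow (setIntegral_nonneg measurableSet_Ioo fun s hs =>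
            Real.rpow_nonneg (hker0 s hs) _) h2 (by positivity)
      _ = _ := by
          rw [Real.mul_rpow (by positivity) (by positivity), ← Real.rpow_mul hba]
          congr 2
          rw [hβd, one_div, one_div, add_mul, one_mul, mul_assoc, mul_inv_cancel₀ hp0.ne', hinv]
          ring
  rw [intervalIntegral_eq_integral_Ioo hab (fun s => ‖w s‖ ^ q)]
  refine h1.trans (hH.trans ?_)
  exact mul_le_mul_of_nonneg_right h3 (Real.rpow_nonneg (integral_nonneg fun s =>
    Real.rpow_nonneg (norm_nonneg _) _) _)

/-! ### Paths of bounded fractional derivative -/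

section PathLemmas

variable {α T : ℝ} {k : ℕ}

theorem rlIntegral_congr_ae {a b r t : ℝ} {w w' : ℝ → E k} (ha : a ≤ r) (hrt : r ≤ t) (hb : t ≤ b)
    (h : w =ᵐ[volume.restrict (Icc a b)] w') : rlIntegral α r w t = rlIntegral α r w' t := by
  rw [rlIntegral, rlIntegral, intervalIntegral_eq_integral_Ioo hrt,
    intervalIntegral_eq_integral_Ioo hrt]
  congr 1
  refine integral_congr_ae ?_
  filter_upwards [ae_restrict_of_ae_restrict_of_subset
    (Ioo_subset_Icc_self.trans (Icc_subset_Icc ha hb)) h] with s hs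
  rw [hs]

theorem rlIntegral_sub (hα0 : 0 < α) {r t : ℝ} {w w' : ℝ → E k} (hrt : r ≤ t)
    (hw : MemLp w ⊤ (volume.restrict (Icc r t))) (hw' : MemLp w' ⊤ (volume.restrict (Icc r t))) :
    rlIntegral α r (fun s => w s - w' s) t = rlIntegral α r w t - rlIntegral α r w' t := by
  have hβ : -1 < α - 1 := by linarith
  simp only [rlIntegral, smul_sub]
  rw [intervalIntegral.integral_sub
    (intervalIntegrable_smul_of_memLp_top hrt (intervalIntegrable_sub_rpow hβ r t t) hw)
    (intervalIntegrable_smul_of_memLp_top hrt (intervalIntegrable_sub_rpow hβ r t t) hw'),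
    smul_sub]

theorem rlIntegral_eq_add (hα0 : 0 < α) {a r t : ℝ} {w : ℝ → E k} (har : a ≤ r) (hrt : r ≤ t)
    (hw : MemLp w ⊤ (volume.restrict (Icc a t))) :
    rlIntegral α a w t =
      (Real.Gamma α)⁻¹ • (∫ s in a..r, ((t - s) ^ (α - 1)) • w s) + rlIntegral α r w t := by
  have hβ : -1 < α - 1 := by linarith
  rw [rlIntegral, rlIntegral, ← smul_add, intervalIntegral.integral_add_adjacent_intervals
    (intervalIntegrable_smul_of_memLp_top har (intervalIntegrable_sub_rpow hβ a r t)
      (memLp_top_Icc_mono hw le_rfl hrt))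
    (intervalIntegrable_smul_of_memLp_top hrt (intervalIntegrable_sub_rpow hβ r t t)
      (memLp_top_Icc_mono hw har le_rfl))]

theorem rlIntegral_increment_of_density (hα0 : 0 < α) (hα1 : α < 1) {f : ℝ → E k} {u : ℝ → E k}
    {a : E k} (hu : MemLp u ⊤ (volume.restrict (Icc 0 T)))
    (h : ∀ t ∈ Icc 0 T, f t = a + rlIntegral α 0 u t) {t : ℝ} (ht : t ∈ Icc 0 T) :
    rlIntegral (1 - α) 0 (fun s => f s - a) t = ∫ s in (0 : ℝ)..t, u s := by
  rw [← rlIntegral_rlIntegral hα0 hα1 ht.1 (memLp_top_Icc_mono hu le_rfl ht.2)]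
  refine rlIntegral_congr_ae le_rfl ht.1 le_rfl ?_
  filter_upwards [ae_restrict_mem measurableSet_Icc] with s hs
  rw [h s ⟨hs.1, hs.2.trans ht.2⟩, add_sub_cancel_left]

variable [hT : Fact (0 < T)]

theorem AC.ext_apply (γ : AC α T k) (t : Icc (0 : ℝ) T) : AC.ext γ t = γ.1 t :=
  IccExtend_val _ _ _

theorem AC.continuous_ext (γ : AC α T k) : Continuous (AC.ext γ) :=
  γ.1.continuous.Icc_extend'

theorem AC.norm_ext_le (γ : AC α T k) (t : ℝ) : ‖AC.ext γ t‖ ≤ ‖γ.1‖ :=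
  γ.1.norm_coe_le_norm _

theorem AC.norm_ext_sub_le (γ γ' : AC α T k) (t : ℝ) :
    ‖AC.ext γ t - AC.ext γ' t‖ ≤ dist γ γ' := by
  rw [← dist_eq_norm]
  exact ContinuousMap.dist_apply_le_dist _

theorem AC.exists_density (γ : AC α T k) : ∃ u : ℝ → E k,
    MemLp u ⊤ (volume.restrict (Icc 0 T)) ∧
      ∀ t ∈ Icc 0 T, AC.ext γ t = AC.ext γ 0 + rlIntegral α 0 u t := by
  obtain ⟨u, hu, h⟩ := γ.2
  refine ⟨u, hu, fun t ht => ?_⟩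
  have := h ⟨t, ht⟩
  rw [← AC.ext_apply γ ⟨t, ht⟩, ← AC.ext_apply γ (zeroTime T)] at this
  exact this

/-- The Caputo derivative inverts the Riemann-Liouville integral, by Lebesgue's differentiation
theorem. -/
theorem caputo_ae_eq (hα0 : 0 < α) (hα1 : α < 1) (γ : AC α T k) {u : ℝ → E k}
    (hu : MemLp u ⊤ (volume.restrict (Icc 0 T)))
    (h : ∀ t ∈ Icc 0 T, AC.ext γ t = AC.ext γ 0 + rlIntegral α 0 u t) :
    caputo γ =ᵐ[volume.restrict (Icc 0 T)] u := by
  have hT0 := hT.out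
  have hae := (intervalIntegrable_of_memLp_top hT0.le hu).ae_hasDerivAt_integral
  rw [← Measure.restrict_congr_set Ioo_ae_eq_Icc, EventuallyEq, ae_restrict_iff' measurableSet_Ioo]
  filter_upwards [hae] with t hd ht
  rw [uIcc_of_le hT0.le] at hd
  have hd' := hd (Ioo_subset_Icc_self ht) 0 ⟨le_rfl, hT0.le⟩
  rw [caputo, rlDeriv, ← hd'.deriv]
  refine EventuallyEq.deriv_eq ?_
  filter_upwards [Ioo_mem_nhds ht.1 ht.2] with s hs
  exact rlIntegral_increment_of_density hα0 hα1 hu h (Ioo_subset_Icc_self hs)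

theorem memLp_caputo (hα0 : 0 < α) (hα1 : α < 1) (γ : AC α T k) :
    MemLp (caputo γ) ⊤ (volume.restrict (Icc 0 T)) := by
  obtain ⟨u, hu, h⟩ := AC.exists_density γ
  exact hu.ae_eq (caputo_ae_eq hα0 hα1 γ hu h).symm

theorem AC.ext_eq (hα0 : 0 < α) (hα1 : α < 1) (γ : AC α T k) {t : ℝ} (ht : t ∈ Icc 0 T) :
    AC.ext γ t = AC.ext γ 0 + rlIntegral α 0 (caputo γ) t := by
  obtain ⟨u, hu, h⟩ := AC.exists_density γ
  rw [h t ht, rlIntegral_congr_ae le_rfl ht.1 ht.2 (caputo_ae_eq hα0 hα1 γ hu h)]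

theorem rlIntegral_increment (hα0 : 0 < α) (hα1 : α < 1) (γ : AC α T k) {t : ℝ}
    (ht : t ∈ Icc 0 T) :
    rlIntegral (1 - α) 0 (fun s => AC.ext γ s - AC.ext γ 0) t = ∫ s in (0 : ℝ)..t, caputo γ s :=
  rlIntegral_increment_of_density hα0 hα1 (memLp_caputo hα0 hα1 γ)
    (fun _ hs => AC.ext_eq hα0 hα1 γ hs) ht

theorem exists_path (hα0 : 0 < α) (hα1 : α < 1) (a : E k) {w : ℝ → E k}
    (hw : MemLp w ⊤ (volume.restrict (Icc 0 T))) :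
    ∃ ν : AC α T k, (∀ t ∈ Icc 0 T, AC.ext ν t = a + rlIntegral α 0 w t) ∧
      caputo ν =ᵐ[volume.restrict (Icc 0 T)] w := by
  have hc := continuousOn_rlIntegral hα0 hα1 hw
  let f : C(Icc (0 : ℝ) T, E k) :=
    ⟨fun t => a + rlIntegral α 0 w t, continuous_const.add hc.domRestrict⟩
  have h0 : f (zeroTime T) = a := by simp [f, zeroTime, rlIntegral]
  have hf : ∀ t : Icc (0 : ℝ) T, f t = f (zeroTime T) + rlIntegral α 0 w t := by
    intro t; rw [h0]; rfl
  let ν : AC α T k := ⟨f, w, hw, hf⟩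
  have h1 : ∀ t ∈ Icc 0 T, AC.ext ν t = a + rlIntegral α 0 w t := by
    intro t ht
    exact AC.ext_apply ν ⟨t, ht⟩
  refine ⟨ν, h1, caputo_ae_eq hα0 hα1 ν hw fun t ht => ?_⟩
  rw [h1 t ht, h1 0 ⟨le_rfl, hT.out.le⟩]
  simp [rlIntegral]

/-- The control that equals `w` up to time `r` and `u` afterwards. -/
noncomputable def concat {F : Type*} (r : ℝ) (w u : ℝ → F) (s : ℝ) : F := if s ≤ r then w s else u s

theorem concat_of_le {F : Type*} {r s : ℝ} (w u : ℝ → F) (h : s ≤ r) : concat r w u s = w s :=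
  if_pos h

theorem concat_of_lt {F : Type*} {r s : ℝ} (w u : ℝ → F) (h : r < s) : concat r w u s = u s :=
  if_neg h.not_ge

theorem memLp_concat {a r b : ℝ} {w u : ℝ → E k}
    (hw : MemLp w ⊤ (volume.restrict (Icc a r))) (hu : MemLp u ⊤ (volume.restrict (Icc r b))) :
    MemLp (concat r w u) ⊤ (volume.restrict (Icc a b)) := by
  have : concat r w u = (Iic r).piecewise w u := by
    ext s; simp [concat, Set.piecewise]
  rw [this]
  refine MemLp.piecewise measurableSet_Iic ?_ ?_
  · rw [Measure.restrict_restrict measurableSet_Iic]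
    refine hw.mono_measure (Measure.restrict_mono (?_ : Iic r ∩ Icc a b ⊆ Icc a r) le_rfl)
    exact fun s hs => ⟨hs.2.1, hs.1⟩
  · rw [Measure.restrict_restrict measurableSet_Iic.compl]
    refine hu.mono_measure (Measure.restrict_mono (?_ : (Iic r)ᶜ ∩ Icc a b ⊆ Icc r b) le_rfl)
    exact fun s hs => ⟨(notMem_Iic.1 hs.1).le, hs.2.2⟩

theorem memLp_density (hα0 : 0 < α) (hα1 : α < 1) (γ : AC α T k) {r : ℝ} (hr : r ∈ Icc 0 T)
    {u : ℝ → E k} (hu : MemLp u ⊤ (volume.restrict (Icc r T))) :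
    MemLp (concat r (caputo γ) u) ⊤ (volume.restrict (Icc 0 T)) :=
  memLp_concat (memLp_top_Icc_mono (memLp_caputo hα0 hα1 γ) le_rfl hr.2) hu

theorem rlIntegral_congr_Ioo {r t : ℝ} {w w' : ℝ → E k} (hrt : r ≤ t)
    (h : ∀ s ∈ Ioo r t, w s = w' s) : rlIntegral α r w t = rlIntegral α r w' t := by
  rw [rlIntegral, rlIntegral, intervalIntegral_eq_integral_Ioo hrt,
    intervalIntegral_eq_integral_Ioo hrt]
  congr 1
  refine setIntegral_congr_fun measurableSet_Ioo fun s hs => ?_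
  simp only [h s hs]

theorem nu_of_le {r t : ℝ} (γ : AC α T k) (u : ℝ → E k) (h : t ≤ r) :
    nu r γ u t = AC.ext γ t := if_pos h

theorem nu_of_lt {r t : ℝ} (γ : AC α T k) (u : ℝ → E k) (h : r < t) :
    nu r γ u t = AC.ext γ 0
      + (Real.Gamma α)⁻¹ • (∫ s in (0 : ℝ)..r, ((t - s) ^ (α - 1)) • caputo γ s)
      + rlIntegral α r u t := if_neg h.not_ge

/-- `ν^{r,γ,u}` is the path with the density `caputo γ` up to time `r` and `u` afterwards. -/
theorem nu_eq (hα0 : 0 < α) (hα1 : α < 1) (γ : AC α T k) {r t : ℝ} (hr : r ∈ Icc 0 T)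
    (ht : t ∈ Icc 0 T) {u : ℝ → E k} (hu : MemLp u ⊤ (volume.restrict (Icc r T))) :
    nu r γ u t = AC.ext γ 0 + rlIntegral α 0 (concat r (caputo γ) u) t := by
  rcases le_or_gt t r with h | h
  · rw [nu_of_le γ u h, AC.ext_eq hα0 hα1 γ ht]
    congr 1
    exact rlIntegral_congr_Ioo ht.1 fun s hs => (concat_of_le _ _ (hs.2.le.trans h)).symm
  · rw [nu_of_lt γ u h, rlIntegral_eq_add hα0 hr.1 h.le
      (memLp_top_Icc_mono (memLp_density hα0 hα1 γ hr hu) le_rfl ht.2), add_assoc]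
    congr 2
    · congr 1
      refine intervalIntegral.integral_congr fun s hs => ?_
      rw [uIcc_of_le hr.1] at hs
      simp only [concat_of_le _ _ hs.2]
    · exact rlIntegral_congr_Ioo h.le fun s hs => (concat_of_lt _ _ hs.1).symm

theorem exists_nu_path (hα0 : 0 < α) (hα1 : α < 1) (γ : AC α T k) {r : ℝ} (hr : r ∈ Icc 0 T)
    {u : ℝ → E k} (hu : MemLp u ⊤ (volume.restrict (Icc r T))) :
    ∃ ν : AC α T k, (∀ t ∈ Icc 0 T, AC.ext ν t = nu r γ u t) ∧
      caputo ν =ᵐ[volume.restrict (Icc 0 T)] concat r (caputo γ) u := by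
  obtain ⟨ν, h1, h2⟩ := exists_path hα0 hα1 (AC.ext γ 0) (memLp_density hα0 hα1 γ hr hu)
  exact ⟨ν, fun t ht => by rw [h1 t ht, nu_eq hα0 hα1 γ hr ht hu], h2⟩

theorem continuousOn_nu (hα0 : 0 < α) (hα1 : α < 1) (γ : AC α T k) {r : ℝ} (hr : r ∈ Icc 0 T)
    {u : ℝ → E k} (hu : MemLp u ⊤ (volume.restrict (Icc r T))) :
    ContinuousOn (nu r γ u) (Icc 0 T) := by
  obtain ⟨ν, h1, -⟩ := exists_nu_path hα0 hα1 γ hr hu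
  exact (AC.continuous_ext ν).continuousOn.congr fun t ht => (h1 t ht).symm

theorem nu_caputo (hα0 : 0 < α) (hα1 : α < 1) (γ : AC α T k) {r t : ℝ} (hr : r ∈ Icc 0 T)
    (ht : t ∈ Icc 0 T) : nu r γ (caputo γ) t = AC.ext γ t := by
  rw [nu_eq hα0 hα1 γ hr ht (memLp_top_Icc_mono (memLp_caputo hα0 hα1 γ) hr.1 le_rfl),
    AC.ext_eq hα0 hα1 γ ht]
  congr 1
  refine rlIntegral_congr_Ioo ht.1 fun s _ => ?_
  simp [concat]

/-- Two controlled paths with a common control after time `r'` differ by at most three times their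
difference on `[0, r']`. -/
theorem norm_nu_sub_nu_le (hα0 : 0 < α) (hα1 : α < 1) (γ γ' : AC α T k) {r r' : ℝ}
    (hr : r ∈ Icc 0 T) (hr' : r' ∈ Icc 0 T) (hrr : r ≤ r') {u u' : ℝ → E k}
    (hu : MemLp u ⊤ (volume.restrict (Icc r T))) (huu : ∀ s ∈ Ioc r' T, u' s = u s) {D : ℝ}
    (hD : ∀ s ∈ Icc 0 r', ‖AC.ext γ' s - nu r γ u s‖ ≤ D) {t : ℝ} (ht : t ∈ Icc 0 T) :
    ‖nu r' γ' u' t - nu r γ u t‖ ≤ 3 * D := by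
  have hD0 : 0 ≤ D := (norm_nonneg _).trans (hD 0 ⟨le_rfl, hr'.1⟩)
  rcases le_or_gt t r' with h | h
  · rw [nu_of_le γ' u' h]
    linarith [hD t ⟨ht.1, h⟩]
  set cc := concat r (caputo γ) u with hcc
  have hccm : MemLp cc ⊤ (volume.restrict (Icc 0 T)) := memLp_density hα0 hα1 γ hr hu
  have hγm := memLp_caputo hα0 hα1 γ'
  have hβ : -1 < α - 1 := by linarith
  have hcc' := memLp_top_Icc_mono hccm le_rfl hr'.2
  have hγm' := memLp_top_Icc_mono hγm le_rfl hr'.2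
  have e1 : nu r' γ' u' t - nu r γ u t = (AC.ext γ' 0 - AC.ext γ 0) +
      (Real.Gamma α)⁻¹ • ∫ s in (0 : ℝ)..r', ((t - s) ^ (α - 1)) • (caputo γ' s - cc s) := by
    rw [nu_of_lt γ' u' h, nu_eq hα0 hα1 γ hr ht hu, rlIntegral_eq_add hα0 hr'.1 h.le
      (memLp_top_Icc_mono hccm le_rfl ht.2)]
    have e2 : rlIntegral α r' u' t = rlIntegral α r' cc t :=
      rlIntegral_congr_Ioo h.le fun s hs => by
        rw [hcc, concat_of_lt _ _ (hrr.trans_lt hs.1), huu s ⟨hs.1, hs.2.le.trans ht.2⟩]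
    rw [e2]
    simp only [smul_sub]
    rw [intervalIntegral.integral_sub
      (intervalIntegrable_smul_of_memLp_top hr'.1 (intervalIntegrable_sub_rpow hβ 0 r' t) hγm')
      (intervalIntegrable_smul_of_memLp_top hr'.1 (intervalIntegrable_sub_rpow hβ 0 r' t) hcc'),
      smul_sub]
    abel
  have h0 : ‖AC.ext γ' 0 - AC.ext γ 0‖ ≤ D := by
    have := hD 0 ⟨le_rfl, hr'.1⟩
    rwa [nu_of_le γ u hr.1] at this
  have hG : ∀ s ∈ Icc 0 r', ‖rlIntegral α 0 (fun s => caputo γ' s - cc s) s‖ ≤ 2 * D := by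
    intro s hs
    have hsT : s ∈ Icc 0 T := ⟨hs.1, hs.2.trans hr'.2⟩
    rw [rlIntegral_sub hα0 hs.1 (memLp_top_Icc_mono hγm le_rfl hsT.2)
      (memLp_top_Icc_mono hccm le_rfl hsT.2)]
    have e3 : rlIntegral α 0 (caputo γ') s - rlIntegral α 0 cc s =
        (AC.ext γ' s - nu r γ u s) - (AC.ext γ' 0 - AC.ext γ 0) := by
      rw [nu_eq hα0 hα1 γ hr hsT hu, AC.ext_eq hα0 hα1 γ' hsT]
      abel
    rw [e3]
    linarith [norm_sub_le (AC.ext γ' s - nu r γ u s) (AC.ext γ' 0 - AC.ext γ 0), hD s hs]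
  have h4 := norm_continuation_le hα0 hα1 hr'.1 h (hγm'.sub hcc') hG
  rw [e1]
  refine (norm_add_le _ _).trans ?_
  simp only [Pi.sub_apply] at h4
  linarith

theorem intervalIntegrable_norm_rpow {a b q : ℝ} {w : ℝ → E k} (hab : a ≤ b)
    (hq : 0 ≤ q) (hw : MemLp w ⊤ (volume.restrict (Icc a b))) :
    IntervalIntegrable (fun s => ‖w s‖ ^ q) volume a b := by
  obtain ⟨N, hN0, hN⟩ := hw.ae_norm_le_bound
  rw [intervalIntegrable_iff_integrableOn_Icc_of_le hab]
  refine Integrable.of_bound (hw.1.norm.aemeasurable.pow_const q).aestronglyMeasurable (N ^ q) ?_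
  filter_upwards [hN] with s hs
  rw [Real.norm_of_nonneg (by positivity)]
  exact Real.rpow_le_rpow (norm_nonneg _) hs hq

theorem integral_norm_rpow_mono {a b b' q : ℝ} {w : ℝ → E k} (hab : a ≤ b) (hb : b ≤ b')
    (hq : 0 ≤ q) (hw : MemLp w ⊤ (volume.restrict (Icc a b'))) :
    ∫ s in a..b, ‖w s‖ ^ q ≤ ∫ s in a..b', ‖w s‖ ^ q := by
  exact intervalIntegral.integral_mono_interval le_rfl hab hb
    (Eventually.of_forall fun s => by positivity)
    (intervalIntegrable_norm_rpow (hab.trans hb) hq hw)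

theorem norm_sub_rpow_le {q : ℝ} (hq : 0 ≤ q) (x y : E k) :
    ‖x - y‖ ^ q ≤ 2 ^ q * (‖x‖ ^ q + ‖y‖ ^ q) := by
  have h1 : ‖x - y‖ ≤ 2 * max ‖x‖ ‖y‖ := by
    linarith [norm_sub_le x y, le_max_left ‖x‖ ‖y‖, le_max_right ‖x‖ ‖y‖]
  calc ‖x - y‖ ^ q ≤ (2 * max ‖x‖ ‖y‖) ^ q := Real.rpow_le_rpow (norm_nonneg _) h1 hq
    _ = 2 ^ q * (max ‖x‖ ‖y‖) ^ q :=
        Real.mul_rpow (by norm_num) (le_max_of_le_left (norm_nonneg _))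
    _ ≤ 2 ^ q * (‖x‖ ^ q + ‖y‖ ^ q) := by
        have hx : 0 ≤ ‖x‖ ^ q := by positivity
        have hy : 0 ≤ ‖y‖ ^ q := by positivity
        gcongr
        rcases max_cases ‖x‖ ‖y‖ with ⟨h, _⟩ | ⟨h, _⟩ <;> rw [h] <;> linarith

theorem integral_norm_sub_rpow_le {a b q N : ℝ} {w v : ℝ → E k} (hab : a ≤ b) (hq : 0 ≤ q)
    (hw : MemLp w ⊤ (volume.restrict (Icc a b))) (hv : MemLp v ⊤ (volume.restrict (Icc a b)))
    (hN : ∀ᵐ s ∂volume.restrict (Icc a b), ‖v s‖ ≤ N) :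
    ∫ s in a..b, ‖w s - v s‖ ^ q ≤ 2 ^ q * ((∫ s in a..b, ‖w s‖ ^ q) + (b - a) * N ^ q) := by
  have i1 := intervalIntegrable_norm_rpow hab hq hw
  have i2 := intervalIntegrable_norm_rpow hab hq (hw.sub hv)
  have e : 2 ^ q * ((∫ s in a..b, ‖w s‖ ^ q) + (b - a) * N ^ q) =
      ∫ s in a..b, 2 ^ q * (‖w s‖ ^ q + N ^ q) := by
    rw [intervalIntegral.integral_const_mul, intervalIntegral.integral_add i1 (by simp)]
    simp
  rw [e]
  refine intervalIntegral.integral_mono_ae_restrict hab i2 ((i1.add (by simp)).const_mul _) ?_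
  filter_upwards [hN] with s hs
  refine (norm_sub_rpow_le hq _ _).trans ?_
  have : ‖v s‖ ^ q ≤ N ^ q := Real.rpow_le_rpow (norm_nonneg _) hs hq
  gcongr

/-- A control that differs from the derivative of `γ` only on `[r, b]` moves the path little in the
sup norm if `b - r` is small and the control is bounded in `L^q`. -/
theorem exists_norm_nu_sub_ext_le (hα0 : 0 < α) (hα1 : α < 1) {q : ℝ} (hq : 1 / α < q) :
    ∃ C : ℝ, 0 ≤ C ∧ ∀ (γ : AC α T k) (r b : ℝ) (u : ℝ → E k), 0 ≤ r → r ≤ b → b ≤ T →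
      MemLp u ⊤ (volume.restrict (Icc r T)) → (∀ s ∈ Ioc b T, u s = caputo γ s) →
      ∀ t ∈ Icc 0 T, ‖nu r γ u t - AC.ext γ t‖ ≤
        C * (b - r) ^ (α - 1 / q) * (∫ s in r..b, ‖u s - caputo γ s‖ ^ q) ^ (1 / q) := by
  obtain ⟨C, hC0, hC⟩ := exists_norm_abel_le_rpow (k := k) hα0 hα1 hq
  have hΓ := Real.Gamma_pos_of_pos hα0
  have hq0 : 0 < q := lt_trans (by positivity) hq
  have hqα : 0 ≤ α - 1 / q := by
    have : 1 / q < α := by rw [div_lt_comm₀ hq0 hα0]; exact hq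
    linarith
  refine ⟨(Real.Gamma α)⁻¹ * C, by positivity, fun γ r b u hr hrb hb hu huc t ht => ?_⟩
  have hI0 : 0 ≤ ∫ s in r..b, ‖u s - caputo γ s‖ ^ q :=
    intervalIntegral.integral_nonneg hrb fun s _ => by positivity
  have hbr : 0 ≤ b - r := by linarith
  rcases le_or_gt t r with h | h
  · rw [nu_of_le γ u h, sub_self, norm_zero]
    positivity
  have hrT : r ∈ Icc 0 T := ⟨hr, hrb.trans hb⟩
  have hγ := memLp_top_Icc_mono (memLp_caputo hα0 hα1 γ) hr le_rfl
  have e1 : nu r γ u t - AC.ext γ t = rlIntegral α r (fun s => u s - caputo γ s) t := by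
    rw [← nu_caputo hα0 hα1 γ hrT ht, nu_of_lt γ u h, nu_of_lt γ _ h, rlIntegral_sub hα0 h.le
      (memLp_top_Icc_mono hu le_rfl ht.2) (memLp_top_Icc_mono hγ le_rfl ht.2)]
    abel
  have hd : MemLp (fun s => u s - caputo γ s) ⊤ (volume.restrict (Icc r T)) := hu.sub hγ
  -- the integrand vanishes after time `b`
  set m := min t b with hm
  have hrm : r ≤ m := le_min h.le hrb
  have hmb : m ≤ b := min_le_right _ _
  have e2 : rlIntegral α r (fun s => u s - caputo γ s) t =
      (Real.Gamma α)⁻¹ • ∫ s in r..m, ((t - s) ^ (α - 1)) • (u s - caputo γ s) := by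
    rw [rlIntegral_eq_add hα0 hrm (min_le_left t b) (memLp_top_Icc_mono hd le_rfl ht.2)]
    have : rlIntegral α m (fun s => u s - caputo γ s) t = rlIntegral α m (fun _ => 0) t := by
      refine rlIntegral_congr_Ioo (min_le_left t b) fun s hs => ?_
      have : b < s := by
        rcases min_lt_iff.1 hs.1 with h' | h'
        · exact absurd hs.2 h'.not_gt
        · exact h'
      rw [huc s ⟨this, hs.2.le.trans ht.2⟩, sub_self]
    rw [this]
    simp [rlIntegral]
  rw [e1, e2, norm_smul, norm_inv, Real.norm_of_nonneg hΓ.le, mul_assoc, mul_assoc]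
  refine mul_le_mul_of_nonneg_left ?_ (by positivity)
  refine (hC r m t _ hrm (min_le_left t b)
    (memLp_top_Icc_mono hd le_rfl (hmb.trans hb))).trans ?_
  rw [mul_assoc]
  refine mul_le_mul_of_nonneg_left ?_ hC0
  refine mul_le_mul (Real.rpow_le_rpow (by linarith) (by linarith) hqα)
    (Real.rpow_le_rpow ?_ ?_ (by positivity)) ?_ (by positivity)
  · exact intervalIntegral.integral_nonneg hrm fun s _ => by positivity
  · exact integral_norm_rpow_mono hrm hmb hq0.le (memLp_top_Icc_mono hd le_rfl hb)
  · refine Real.rpow_nonneg ?_ _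
    exact intervalIntegral.integral_nonneg hrm fun s _ => by positivity

/-- Bound for a controlled path in terms of the `L^q` norm of the control. -/
theorem exists_norm_nu_le (hα0 : 0 < α) (hα1 : α < 1) {q : ℝ} (hq : 1 / α < q) :
    ∃ C : ℝ, 0 ≤ C ∧ ∀ (γ : AC α T k) (r : ℝ) (u : ℝ → E k), r ∈ Icc 0 T →
      MemLp u ⊤ (volume.restrict (Icc r T)) →
      ∀ t ∈ Icc 0 T, ‖nu r γ u t‖ ≤ 3 * ‖γ.1‖ + C * (∫ s in r..T, ‖u s‖ ^ q) ^ (1 / q) := by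
  obtain ⟨C, hC0, hC⟩ := exists_norm_abel_le_rpow (k := k) hα0 hα1 hq
  have hΓ := Real.Gamma_pos_of_pos hα0
  have hT0 := hT.out
  have hq0 : 0 < q := lt_trans (by positivity) hq
  have hqα : 0 ≤ α - 1 / q := by
    have : 1 / q < α := by rw [div_lt_comm₀ hq0 hα0]; exact hq
    linarith
  refine ⟨(Real.Gamma α)⁻¹ * (C * T ^ (α - 1 / q)), by positivity,
    fun γ r u hr hu t ht => ?_⟩
  have hI0 : 0 ≤ ∫ s in r..T, ‖u s‖ ^ q :=
    intervalIntegral.integral_nonneg hr.2 fun s _ => by positivity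
  have hγ0 := norm_nonneg γ.1
  rcases le_or_gt t r with h | h
  · rw [nu_of_le γ u h]
    have : 0 ≤ (Real.Gamma α)⁻¹ * (C * T ^ (α - 1 / q)) * (∫ s in r..T, ‖u s‖ ^ q) ^ (1 / q) := by
      positivity
    linarith [AC.norm_ext_le γ t]
  have hG : ∀ s ∈ Icc 0 r, ‖rlIntegral α 0 (caputo γ) s‖ ≤ 2 * ‖γ.1‖ := by
    intro s hs
    have : rlIntegral α 0 (caputo γ) s = AC.ext γ s - AC.ext γ 0 := by
      rw [AC.ext_eq hα0 hα1 γ ⟨hs.1, hs.2.trans hr.2⟩]; abel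
    rw [this]
    linarith [norm_sub_le (AC.ext γ s) (AC.ext γ 0), AC.norm_ext_le γ s, AC.norm_ext_le γ 0]
  have h1 := norm_continuation_le hα0 hα1 hr.1 h
    (memLp_top_Icc_mono (memLp_caputo hα0 hα1 γ) le_rfl hr.2) hG
  have h2 : ‖rlIntegral α r u t‖ ≤
      (Real.Gamma α)⁻¹ * (C * T ^ (α - 1 / q)) * (∫ s in r..T, ‖u s‖ ^ q) ^ (1 / q) := by
    rw [rlIntegral, norm_smul, norm_inv, Real.norm_of_nonneg hΓ.le, mul_assoc]
    refine mul_le_mul_of_nonneg_left ?_ (by positivity)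
    refine (hC r t t u h.le le_rfl (memLp_top_Icc_mono hu le_rfl ht.2)).trans ?_
    have h3 : ∫ s in r..t, ‖u s‖ ^ q ≤ ∫ s in r..T, ‖u s‖ ^ q :=
      integral_norm_rpow_mono h.le ht.2 hq0.le hu
    have h4 : 0 ≤ ∫ s in r..t, ‖u s‖ ^ q :=
      intervalIntegral.integral_nonneg h.le fun s _ => by positivity
    have h5 : t - r ≤ T := by linarith [hr.1, ht.2]
    have h6 : 0 ≤ t - r := by linarith
    gcongr
  rw [nu_of_lt γ u h]
  refine (norm_add_le _ _).trans (add_le_add ((norm_add_le _ _).trans ?_) h2)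
  linarith [AC.norm_ext_le γ 0]

end PathLemmas

/-! ### The controlled dynamics -/

section Dynamics

variable {e k d : ℕ}

/-- The velocity `b(x, a) + λ(x, a) η̇_s` of the controlled state. -/
noncomputable def Coeffs.field (c : Coeffs e k d) (T s : ℝ) (x : E e) (a : E k) : E e :=
  c.b x a + c.lam x a (c.etaDot T s)

/-- The full running cost `f(x, a, u) + ψ(x, a) η̇_s`. -/
noncomputable def Coeffs.running (c : Coeffs e k d) (T s : ℝ) (x : E e) (a u : E k) : ℝ :=
  c.f x a u + c.psi x a (c.etaDot T s)

/-- The consequences of the standing assumptions that the estimates use, with a bound `M` for the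
velocity and one Lipschitz (and growth) constant `L` for velocity and costs. -/
structure Coeffs.Bounds (c : Coeffs e k d) (T M L : ℝ) : Prop where
  L_pos : 0 < L
  M_nonneg : 0 ≤ M
  eta_cont : ContinuousOn (c.etaDot T) (Icc 0 T)
  b_cont : Continuous (fun p : E e × E k => c.b p.1 p.2)
  lam_cont : Continuous (fun p : E e × E k => c.lam p.1 p.2)
  f_cont : Continuous (fun p : E e × E k × E k => c.f p.1 p.2.1 p.2.2)
  psi_cont : Continuous (fun p : E e × E k => c.psi p.1 p.2)
  field_le : ∀ s ∈ Icc 0 T, ∀ x a, ‖c.field T s x a‖ ≤ M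
  field_lip : ∀ s ∈ Icc 0 T, ∀ x x' a a',
    ‖c.field T s x a - c.field T s x' a'‖ ≤ L * (‖x - x'‖ + ‖a - a'‖)
  running_lip : ∀ s ∈ Icc 0 T, ∀ x x' a a' u,
    |c.running T s x a u - c.running T s x' a' u| ≤ L * (‖x - x'‖ + ‖a - a'‖)
  g_lip : ∀ x x' a a', |c.g x a - c.g x' a'| ≤ L * (‖x - x'‖ + ‖a - a'‖)
  psi_le : ∀ s ∈ Icc 0 T, ∀ x a, |c.psi x a (c.etaDot T s)| ≤ L * (1 + ‖x‖ + ‖a‖)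

theorem norm_sub_le_of_lipschitzWith_prod {F : Type*} [SeminormedAddCommGroup F] {m n : ℕ}
    {K : ℝ≥0}
    {h : E m → E n → F} (hh : LipschitzWith K (fun p : E m × E n => h p.1 p.2)) (x x' : E m)
    (a a' : E n) : ‖h x a - h x' a'‖ ≤ K * (‖x - x'‖ + ‖a - a'‖) := by
  have h1 := hh.dist_le_mul (x, a) (x', a')
  rw [dist_eq_norm, dist_eq_norm] at h1
  refine h1.trans (mul_le_mul_of_nonneg_left ?_ K.2)
  simp only [Prod.mk_sub_mk, Prod.norm_mk]
  exact max_le (le_add_of_nonneg_right (norm_nonneg _)) (le_add_of_nonneg_left (norm_nonneg _))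

theorem Coeffs.exists_bounds (c : Coeffs e k d) {T : ℝ} (hT : 0 < T) (hdyn : c.RegularDynamics T)
    (hA1 : c.A1) (hA5 : c.A5) : ∃ M L : ℝ, c.Bounds T M L := by
  obtain ⟨Mb, hMb⟩ := hdyn.b_bounded
  obtain ⟨Lb, hLb⟩ := hdyn.b_lipschitz
  obtain ⟨Ml, hMl⟩ := hdyn.lam_bounded
  obtain ⟨Lf, hLf⟩ := hA5.f_lip
  obtain ⟨Lp, hLp⟩ := hA5.psi_lip
  obtain ⟨Lg, hLg⟩ := hA5.g_lip
  have heta : ContinuousOn (c.etaDot T) (Icc 0 T) :=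
    hdyn.eta_contDiff.continuousOn_derivWithin (uniqueDiffOn_Icc hT) le_rfl
  obtain ⟨Me, hMe⟩ := isCompact_Icc.exists_bound_of_continuousOn heta
  have hMe0 : 0 ≤ Me := (norm_nonneg _).trans (hMe 0 ⟨le_rfl, hT.le⟩)
  have hMl0 : 0 ≤ Ml := (norm_nonneg _).trans (hMl 0).1
  have hMb0 : 0 ≤ Mb := (norm_nonneg _).trans (hMb 0 0)
  have hLl : LipschitzWith Ml.toNNReal (fun p : E e × E k => c.lam p.1 p.2) := by
    refine lipschitzWith_of_nnnorm_fderiv_le (𝕜 := ℝ) (hdyn.lam_contDiff.differentiable (by simp))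
      fun p => ?_
    rw [← NNReal.coe_le_coe, coe_nnnorm, Real.coe_toNNReal _ hMl0]
    exact (hMl p).2
  set P := ‖c.psi 0 0‖ with hP
  have hP0 : 0 ≤ P := norm_nonneg _
  have l1 := Lb.2
  have l2 := Lf.2
  have l3 := Lp.2
  have l4 := Lg.2
  simp only [NNReal.val_eq_coe] at l1 l2 l3 l4
  have l5 : 0 ≤ Ml * Me := by positivity
  have l6 : 0 ≤ Lp * Me := by positivity
  have l7 : 0 ≤ P * Me := by positivity
  set L : ℝ := 1 + Lb + Ml * Me + Lf + Lp * Me + Lg + P * Me with hL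
  refine ⟨Mb + Ml * Me, L, by linarith, by positivity, heta, hLb.continuous, hLl.continuous,
    hA1.f_cont, hLp.continuous, ?_, ?_, ?_, ?_, ?_⟩
  · intro s hs x a
    refine (norm_add_le _ _).trans (add_le_add (hMb x a) (((c.lam x a).le_opNorm _).trans ?_))
    exact mul_le_mul (hMl (x, a)).1 (hMe s hs) (norm_nonneg _) hMl0
  · intro s hs x x' a a'
    have h1 := norm_sub_le_of_lipschitzWith_prod hLb x x' a a'
    have h2 := norm_sub_le_of_lipschitzWith_prod hLl x x' a a'
    rw [Real.coe_toNNReal _ hMl0] at h2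
    have e1 : c.field T s x a - c.field T s x' a' =
        (c.b x a - c.b x' a') + (c.lam x a - c.lam x' a') (c.etaDot T s) := by
      simp only [Coeffs.field, sub_apply]; abel
    rw [e1]
    set N := ‖x - x'‖ + ‖a - a'‖ with hN
    have hN0 : 0 ≤ N := by positivity
    have h3 : ‖(c.lam x a - c.lam x' a') (c.etaDot T s)‖ ≤ (Ml * N) * Me :=
      ((c.lam x a - c.lam x' a').le_opNorm _).trans
        (mul_le_mul h2 (hMe s hs) (norm_nonneg _) (by positivity))
    calc _ ≤ Lb * N + (Ml * N) * Me := (norm_add_le _ _).trans (add_le_add h1 h3)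
      _ = (Lb + Ml * Me) * N := by ring
      _ ≤ L * N := mul_le_mul_of_nonneg_right (by linarith) hN0
  · intro s hs x x' a a' u
    have h1 := norm_sub_le_of_lipschitzWith_prod (h := fun x a => c.f x a u) (hLf u) x x' a a'
    have h2 := norm_sub_le_of_lipschitzWith_prod hLp x x' a a'
    have e1 : c.running T s x a u - c.running T s x' a' u =
        (c.f x a u - c.f x' a' u) + (c.psi x a - c.psi x' a') (c.etaDot T s) := by
      simp only [Coeffs.running, sub_apply]; abel
    rw [e1, ← Real.norm_eq_abs]
    set N := ‖x - x'‖ + ‖a - a'‖ with hN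
    have hN0 : 0 ≤ N := by positivity
    have h3 : ‖(c.psi x a - c.psi x' a') (c.etaDot T s)‖ ≤ (Lp * N) * Me :=
      ((c.psi x a - c.psi x' a').le_opNorm _).trans
        (mul_le_mul h2 (hMe s hs) (norm_nonneg _) (by positivity))
    calc _ ≤ Lf * N + (Lp * N) * Me := (norm_add_le _ _).trans (add_le_add h1 h3)
      _ = (Lf + Lp * Me) * N := by ring
      _ ≤ L * N := mul_le_mul_of_nonneg_right (by linarith) hN0
  · intro x x' a a'
    have h1 := norm_sub_le_of_lipschitzWith_prod hLg x x' a a'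
    rw [Real.norm_eq_abs] at h1
    exact h1.trans (mul_le_mul_of_nonneg_right (by linarith) (by positivity))
  · intro s hs x a
    have h2 := norm_sub_le_of_lipschitzWith_prod hLp x 0 a 0
    rw [sub_zero, sub_zero] at h2
    have h3 : ‖c.psi x a‖ ≤ P + Lp * (‖x‖ + ‖a‖) := by
      have := norm_add_le (c.psi x a - c.psi 0 0) (c.psi 0 0)
      rw [sub_add_cancel] at this
      linarith
    have h4 : ‖c.psi x a (c.etaDot T s)‖ ≤ (P + Lp * (‖x‖ + ‖a‖)) * Me :=
      ((c.psi x a).le_opNorm _).trans (mul_le_mul h3 (hMe s hs) (norm_nonneg _) (by positivity))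
    rw [← Real.norm_eq_abs]
    refine h4.trans ?_
    have hx := norm_nonneg x
    have ha := norm_nonneg a
    calc (P + Lp * (‖x‖ + ‖a‖)) * Me = P * Me * 1 + Lp * Me * (‖x‖ + ‖a‖) := by ring
      _ ≤ L * 1 + L * (‖x‖ + ‖a‖) := by
          gcongr
          · linarith
          · linarith
      _ = L * (1 + ‖x‖ + ‖a‖) := by ring

variable {c : Coeffs e k d} {T M L : ℝ}

theorem Coeffs.Bounds.continuousOn_field (B : c.Bounds T M L) {r : ℝ} (hr : 0 ≤ r)
    {X : ℝ → E e} {w : ℝ → E k} (hX : ContinuousOn X (Icc r T)) (hw : ContinuousOn w (Icc r T)) :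
    ContinuousOn (fun s => c.field T s (X s) (w s)) (Icc r T) := by
  have hp : ContinuousOn (fun s => (X s, w s)) (Icc r T) := hX.prodMk hw
  have h1 : ContinuousOn (fun s => c.b (X s) (w s)) (Icc r T) := B.b_cont.comp_continuousOn hp
  have h2 : ContinuousOn (fun s => c.lam (X s) (w s)) (Icc r T) := B.lam_cont.comp_continuousOn hp
  exact h1.add (h2.clm_apply (B.eta_cont.mono (Icc_subset_Icc_left hr)))

theorem Coeffs.Bounds.continuousOn_psi (B : c.Bounds T M L) {r : ℝ} (hr : 0 ≤ r)
    {X : ℝ → E e} {w : ℝ → E k} (hX : ContinuousOn X (Icc r T)) (hw : ContinuousOn w (Icc r T)) :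
    ContinuousOn (fun s => c.psi (X s) (w s) (c.etaDot T s)) (Icc r T) := by
  have h2 : ContinuousOn (fun s => c.psi (X s) (w s)) (Icc r T) :=
    B.psi_cont.comp_continuousOn (hX.prodMk hw)
  exact h2.clm_apply (B.eta_cont.mono (Icc_subset_Icc_left hr))

theorem Coeffs.Bounds.memLp_f (B : c.Bounds T M L) {r : ℝ}
    {X : ℝ → E e} {w u : ℝ → E k} (hX : ContinuousOn X (Icc r T)) (hw : ContinuousOn w (Icc r T))
    (hu : MemLp u ⊤ (volume.restrict (Icc r T))) :
    MemLp (fun s => c.f (X s) (w s) (u s)) ⊤ (volume.restrict (Icc r T)) := by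
  obtain ⟨N, hN0, hN⟩ := hu.ae_norm_le_bound
  have hm : AEStronglyMeasurable (fun s => c.f (X s) (w s) (u s)) (volume.restrict (Icc r T)) :=
    B.f_cont.comp_aestronglyMeasurable ((hX.aestronglyMeasurable measurableSet_Icc).prodMk
      ((hw.aestronglyMeasurable measurableSet_Icc).prodMk hu.1))
  have hK : IsCompact ((X '' Icc r T) ×ˢ ((w '' Icc r T) ×ˢ Metric.closedBall (0 : E k) N)) :=
    (isCompact_Icc.image_of_continuousOn hX).prod
      ((isCompact_Icc.image_of_continuousOn hw).prod (isCompact_closedBall _ _))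
  obtain ⟨C, hC⟩ := hK.exists_bound_of_continuousOn B.f_cont.continuousOn
  refine memLp_top_of_bound hm C ?_
  filter_upwards [hN, ae_restrict_mem measurableSet_Icc] with s hs hm
  exact hC (X s, w s, u s) ⟨mem_image_of_mem X hm, mem_image_of_mem w hm, by simpa using hs⟩

theorem Coeffs.Bounds.memLp_running (B : c.Bounds T M L) {r : ℝ} (hr : 0 ≤ r)
    {X : ℝ → E e} {w u : ℝ → E k} (hX : ContinuousOn X (Icc r T)) (hw : ContinuousOn w (Icc r T))
    (hu : MemLp u ⊤ (volume.restrict (Icc r T))) :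
    MemLp (fun s => c.running T s (X s) (w s) (u s)) ⊤ (volume.restrict (Icc r T)) := by
  refine (B.memLp_f hX hw hu).add ?_
  have hc := B.continuousOn_psi hr hX hw
  obtain ⟨C, hC⟩ := isCompact_Icc.exists_bound_of_continuousOn hc
  refine memLp_top_of_bound (hc.aestronglyMeasurable measurableSet_Icc) C ?_
  filter_upwards [ae_restrict_mem measurableSet_Icc] with s hs using hC s hs

theorem Coeffs.Bounds.exists_isState (B : c.Bounds T M L) {r : ℝ} (hr : r ∈ Icc 0 T) (x : E e)
    {w : ℝ → E k} (hw : ContinuousOn w (Icc r T)) : ∃ X, c.IsState T r x w X := by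
  have hsub : Icc r T ⊆ Icc 0 T := Icc_subset_Icc_left hr.1
  have hMT : 0 ≤ M * (T - r) := mul_nonneg B.M_nonneg (by linarith [hr.2])
  -- the velocity is bounded by `M`, so the ball of radius `M (T - r)` is never left and the
  -- solution exists on all of `[r, T]`
  have hPL : IsPicardLindelof (fun s x => c.field T s x (w s)) (tmin := r) (tmax := T)
      ⟨r, le_rfl, hr.2⟩ x (M * (T - r)).toNNReal 0 M.toNNReal L.toNNReal := by
    refine ⟨fun t ht => ?_, fun y _ => ?_, fun t ht y _ => ?_, ?_⟩
    · refine LipschitzOnWith.of_dist_le_mul fun y _ z _ => ?_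
      have := B.field_lip t (hsub ht) y z (w t) (w t)
      rw [sub_self, norm_zero, add_zero] at this
      rwa [dist_eq_norm, dist_eq_norm, Real.coe_toNNReal _ B.L_pos.le]
    · exact B.continuousOn_field hr.1 continuousOn_const hw
    · rw [Real.coe_toNNReal _ B.M_nonneg]
      exact B.field_le t (hsub ht) _ _
    · simp only [sub_self, NNReal.coe_zero, sub_zero]
      rw [Real.coe_toNNReal _ B.M_nonneg, Real.coe_toNNReal _ hMT,
        max_eq_left (by linarith [hr.2])]
  obtain ⟨X, hX0, hX⟩ := hPL.exists_eq_forall_mem_Icc_hasDerivWithinAt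
    (x := x) (by simp)
  have hXc : ContinuousOn X (Icc r T) := fun t ht => (hX t ht).continuousWithinAt
  refine ⟨X, hXc, fun t ht => ?_⟩
  have hfc := (B.continuousOn_field hr.1 hXc hw).mono (Icc_subset_Icc_right ht.2)
  have := intervalIntegral.integral_eq_sub_of_hasDerivAt_of_le ht.1
    (hXc.mono (Icc_subset_Icc_right ht.2))
    (fun s hs => (hX s ⟨hs.1.le, hs.2.le.trans ht.2⟩).hasDerivAt
      (Icc_mem_nhds hs.1 (hs.2.trans_le ht.2)))
    (hfc.intervalIntegrable_of_Icc ht.1)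
  have h2 : X t = x + ∫ s in r..t, c.field T s (X s) (w s) := by
    rw [this]; simp only at hX0; rw [hX0]; abel
  exact h2

theorem Coeffs.IsState.apply_start {r : ℝ} {x : E e} {w : ℝ → E k} {X : ℝ → E e}
    (h : c.IsState T r x w X) (hr : r ≤ T) : X r = x := by
  have := h.2 r ⟨le_rfl, hr⟩
  simpa using this

theorem Coeffs.Bounds.state_sub_eq (B : c.Bounds T M L) {r : ℝ} (hr : 0 ≤ r) {x : E e}
    {w : ℝ → E k} {X : ℝ → E e} (h : c.IsState T r x w X) (hw : ContinuousOn w (Icc r T))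
    {s t : ℝ} (hs : r ≤ s) (hst : s ≤ t) (ht : t ≤ T) :
    X t - X s = ∫ y in s..t, c.field T y (X y) (w y) := by
  have hc := B.continuousOn_field hr h.1 hw
  have i1 := (hc.mono (Icc_subset_Icc_right (hst.trans ht))).intervalIntegrable_of_Icc
    (μ := volume) hs
  have i2 := (hc.mono (Icc_subset_Icc hs ht)).intervalIntegrable_of_Icc (μ := volume) hst
  have h1 : X t = x + ∫ y in r..t, c.field T y (X y) (w y) := h.2 t ⟨hs.trans hst, ht⟩
  have h2 : X s = x + ∫ y in r..s, c.field T y (X y) (w y) := h.2 s ⟨hs, hst.trans ht⟩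
  rw [h1, h2, ← intervalIntegral.integral_add_adjacent_intervals i1 i2]
  abel

theorem Coeffs.Bounds.norm_state_sub_le (B : c.Bounds T M L) {r : ℝ} (hr : 0 ≤ r) {x : E e}
    {w : ℝ → E k} {X : ℝ → E e} (h : c.IsState T r x w X) (hw : ContinuousOn w (Icc r T))
    {s t : ℝ} (hs : r ≤ s) (hst : s ≤ t) (ht : t ≤ T) : ‖X t - X s‖ ≤ M * (t - s) := by
  rw [B.state_sub_eq hr h hw hs hst ht]
  have := intervalIntegral.norm_integral_le_of_norm_le_const (a := s) (b := t) (C := M)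
    (f := fun y => c.field T y (X y) (w y)) fun y hy => by
      rw [uIoc_of_le hst] at hy
      exact B.field_le y ⟨hr.trans (hs.trans hy.1.le), hy.2.trans ht⟩ _ _
  rwa [abs_of_nonneg (sub_nonneg.2 hst)] at this

theorem Coeffs.Bounds.isState_restart (B : c.Bounds T M L) {r r' : ℝ} (hr : 0 ≤ r) {x : E e}
    {w : ℝ → E k} {X : ℝ → E e} (h : c.IsState T r x w X) (hw : ContinuousOn w (Icc r T))
    (hrr : r ≤ r') : c.IsState T r' (X r') w X := by
  refine ⟨h.1.mono (Icc_subset_Icc_left hrr), fun t ht => ?_⟩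
  have : X t = X r' + ∫ y in r'..t, c.field T y (X y) (w y) := by
    rw [← B.state_sub_eq hr h hw hrr ht.1 ht.2]; abel
  exact this

theorem Coeffs.Bounds.hasDerivWithinAt_state (B : c.Bounds T M L) {r : ℝ} (hr : 0 ≤ r) {x : E e}
    {w : ℝ → E k} {X : ℝ → E e} (h : c.IsState T r x w X) (hw : ContinuousOn w (Icc r T))
    {t : ℝ} (ht : t ∈ Ico r T) :
    HasDerivWithinAt X (c.field T t (X t) (w t)) (Ici t) t := by
  have hc := B.continuousOn_field hr h.1 hw
  have htI : t ∈ Icc r T := Ico_subset_Icc_self ht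
  have hmem : Icc r T ∈ 𝓝[>] t :=
    mem_of_superset (Ioo_mem_nhdsGT ht.2) fun s hs => ⟨ht.1.trans hs.1.le, hs.2.le⟩
  have hcw : ContinuousWithinAt (fun s => c.field T s (X s) (w s)) (Ioi t) t :=
    (hc t htI).mono_of_mem_nhdsWithin hmem
  have hmeas : StronglyMeasurableAtFilter (fun s => c.field T s (X s) (w s)) (𝓝[>] t) volume :=
    ⟨Icc r T, hmem, hc.aestronglyMeasurable measurableSet_Icc⟩
  have hd := intervalIntegral.integral_hasDerivWithinAt_right
    ((hc.mono (Icc_subset_Icc_right ht.2.le)).intervalIntegrable_of_Icc ht.1) (s := Ici t)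
    (t := Ioi t) hmeas hcw
  have hd' := hd.const_add x
  refine hd'.congr_of_eventuallyEq ?_ (h.2 t htI)
  have : Icc r T ∈ 𝓝[≥] t :=
    mem_of_superset (Ico_mem_nhdsGE ht.2) fun s hs => ⟨ht.1.trans hs.1, hs.2.le⟩
  filter_upwards [this] with s hs using h.2 s hs

/-- Grönwall stability of the state in the initial value and in the sup norm of the path. -/
theorem Coeffs.Bounds.norm_state_sub_state_le (B : c.Bounds T M L) {r : ℝ} (hr : 0 ≤ r)
    {x x' : E e} {w w' : ℝ → E k} {X X' : ℝ → E e} (h : c.IsState T r x w X)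
    (h' : c.IsState T r x' w' X') (hw : ContinuousOn w (Icc r T))
    (hw' : ContinuousOn w' (Icc r T)) {δ b : ℝ} (hb : b ≤ T)
    (hδ : ∀ s ∈ Icc r b, ‖w s - w' s‖ ≤ δ) {t : ℝ} (ht : t ∈ Icc r b) :
    ‖X t - X' t‖ ≤ Real.exp (L * T) * (‖x - x'‖ + δ) := by
  have hrb : r ≤ b := ht.1.trans ht.2
  have hrT : r ≤ T := hrb.trans hb
  have hδ0 : 0 ≤ δ := (norm_nonneg _).trans (hδ r ⟨le_rfl, hrb⟩)
  have hL := B.L_pos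
  have hg := norm_le_gronwallBound_of_norm_deriv_right_le (f := fun s => X s - X' s)
    (f' := fun s => c.field T s (X s) (w s) - c.field T s (X' s) (w' s))
    (δ := ‖x - x'‖) (K := L) (ε := L * δ) (a := r) (b := b)
    ((h.1.sub h'.1).mono (Icc_subset_Icc_right hb))
    (fun s hs => (B.hasDerivWithinAt_state hr h hw ⟨hs.1, hs.2.trans_le hb⟩).sub
      (B.hasDerivWithinAt_state hr h' hw' ⟨hs.1, hs.2.trans_le hb⟩))
    (by simp only [h.apply_start hrT, h'.apply_start hrT]; exact le_rfl)
    (fun s hs => by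
      refine (B.field_lip s ⟨hr.trans hs.1, hs.2.le.trans hb⟩ _ _ _ _).trans ?_
      rw [mul_add]
      gcongr
      exact hδ s (Ico_subset_Icc_self hs)) t ht
  refine hg.trans ?_
  rw [gronwallBound_of_K_ne_0 hL.ne']
  have h1 : Real.exp (L * (t - r)) ≤ Real.exp (L * T) :=
    Real.exp_le_exp.2 (mul_le_mul_of_nonneg_left (by linarith [ht.2]) hL.le)
  have h2 : L * δ / L = δ := by field_simp
  simp only [h2]
  calc ‖x - x'‖ * Real.exp (L * (t - r)) + δ * (Real.exp (L * (t - r)) - 1)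
      ≤ ‖x - x'‖ * Real.exp (L * T) + δ * Real.exp (L * T) := by
        gcongr
        linarith
    _ = _ := by ring

end Dynamics

/-! ### Stability of the cost, coercivity and dynamic programming -/

section Control

variable {α T : ℝ} [hT : Fact (0 < T)] {e k d : ℕ} {c : Coeffs e k d} {M L : ℝ}

theorem nu_congr {r t : ℝ} (γ : AC α T k) {u u' : ℝ → E k} (h : ∀ s ∈ Ioo r t, u s = u' s) :
    nu r γ u t = nu r γ u' t := by
  rcases le_or_gt t r with htr | htr
  · rw [nu_of_le γ u htr, nu_of_le γ u' htr]
  · rw [nu_of_lt γ u htr, nu_of_lt γ u' htr, rlIntegral_congr_Ioo htr.le h]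

theorem Coeffs.Bounds.cost_eq (B : c.Bounds T M L) {r : ℝ} (hr : r ∈ Icc 0 T) {γ : AC α T k}
    {u : ℝ → E k} {X : ℝ → E e} (hX : ContinuousOn X (Icc r T))
    (hw : ContinuousOn (nu r γ u) (Icc r T)) (hu : MemLp u ⊤ (volume.restrict (Icc r T))) :
    c.cost r γ u X =
      (∫ s in r..T, c.running T s (X s) (nu r γ u s) (u s)) + c.g (X T) (nu r γ u T) := by
  rw [Coeffs.cost, ← intervalIntegral.integral_add
    (intervalIntegrable_of_memLp_top hr.2 (B.memLp_f hX hw hu))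
    ((B.continuousOn_psi hr.1 hX hw).intervalIntegrable_of_Icc hr.2)]
  rfl

/-- The constant in the stability estimate for the cost. -/
noncomputable def stabConst (L T : ℝ) : ℝ := 3 * L * (T + 1) * (Real.exp (L * T) + 1)

/-- Stability of the cost to go: the costs after time `r'` of two control problems with a common
control there differ by the distance of the data at time `r'`. -/
theorem Coeffs.Bounds.abs_cost_sub_le (hα0 : 0 < α) (hα1 : α < 1) (B : c.Bounds T M L)
    {r r' : ℝ} (hr : r ∈ Icc 0 T) (hr' : r' ∈ Icc 0 T) (hrr : r ≤ r') {γ γ' : AC α T k}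
    {x x' : E e} {u u' : ℝ → E k} {X X' : ℝ → E e}
    (hu : MemLp u ⊤ (volume.restrict (Icc r T))) (hu' : MemLp u' ⊤ (volume.restrict (Icc r' T)))
    (huu : ∀ s ∈ Ioc r' T, u' s = u s) (hX : c.IsState T r x (nu r γ u) X)
    (hX' : c.IsState T r' x' (nu r' γ' u') X') {D : ℝ}
    (hD : ∀ s ∈ Icc 0 r', ‖AC.ext γ' s - nu r γ u s‖ ≤ D) :
    |c.cost r γ u X - (∫ s in r..r', c.running T s (X s) (nu r γ u s) (u s)) - c.cost r' γ' u' X'|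
      ≤ stabConst L T * (‖X r' - x'‖ + D) := by
  have hT0 := hT.out
  have hL := B.L_pos
  have hD0 : 0 ≤ D := (norm_nonneg _).trans (hD 0 ⟨le_rfl, hr'.1⟩)
  set w := nu r γ u with hw
  set w' := nu r' γ' u' with hw'
  have hwc : ContinuousOn w (Icc r T) :=
    (continuousOn_nu hα0 hα1 γ hr hu).mono (Icc_subset_Icc_left hr.1)
  have hwc' : ContinuousOn w' (Icc r' T) :=
    (continuousOn_nu hα0 hα1 γ' hr' hu').mono (Icc_subset_Icc_left hr'.1)
  have hww : ∀ s ∈ Icc r' T, ‖w s - w' s‖ ≤ 3 * D := fun s hs => by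
    rw [norm_sub_rev]
    exact norm_nu_sub_nu_le hα0 hα1 γ γ' hr hr' hrr hu huu hD ⟨hr'.1.trans hs.1, hs.2⟩
  have hXr := B.isState_restart hr.1 hX hwc hrr
  have hsub : Icc r' T ⊆ Icc r T := Icc_subset_Icc_left hrr
  set S := ‖X r' - x'‖ + 3 * D with hS
  have hS0 : 0 ≤ S := by positivity
  set A := (Real.exp (L * T) + 1) * S with hA
  have hA0 : 0 ≤ A := by positivity
  have hXX : ∀ s ∈ Icc r' T, ‖X s - X' s‖ + ‖w s - w' s‖ ≤ A := fun s hs => by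
    have h1 := B.norm_state_sub_state_le hr'.1 hXr hX' (hwc.mono hsub) hwc' le_rfl hww hs
    have h2 := hww s hs
    have h3 := norm_nonneg (X r' - x')
    rw [hA, add_mul, one_mul]
    linarith
  have m1 := B.memLp_running hr.1 hX.1 hwc hu
  have i1 := intervalIntegrable_of_memLp_top hrr (memLp_top_Icc_mono m1 le_rfl hr'.2)
  have i2 := intervalIntegrable_of_memLp_top hr'.2 (memLp_top_Icc_mono m1 hrr le_rfl)
  have i3 := intervalIntegrable_of_memLp_top hr'.2 (B.memLp_running hr'.1 hX'.1 hwc' hu')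
  rw [B.cost_eq hr hX.1 hwc hu, B.cost_eq hr' hX'.1 hwc' hu',
    ← intervalIntegral.integral_add_adjacent_intervals i1 i2]
  have e1 : ∀ a b b' g g' : ℝ, a + b + g - a - (b' + g') = (b - b') + (g - g') := by intros; ring
  rw [e1, ← intervalIntegral.integral_sub i2 i3]
  have h1 : |∫ s in r'..T, (c.running T s (X s) (w s) (u s) -
      c.running T s (X' s) (w' s) (u' s))| ≤ L * A * (T - r') := by
    have := intervalIntegral.norm_integral_le_of_norm_le_const (a := r') (b := T) (C := L * A)
      (f := fun s => c.running T s (X s) (w s) (u s) - c.running T s (X' s) (w' s) (u' s))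
      fun s hs => by
        rw [uIoc_of_le hr'.2] at hs
        rw [huu s hs, Real.norm_eq_abs]
        refine (B.running_lip s ⟨hr'.1.trans hs.1.le, hs.2⟩ _ _ _ _ _).trans ?_
        exact mul_le_mul_of_nonneg_left (hXX s ⟨hs.1.le, hs.2⟩) hL.le
    rwa [abs_of_nonneg (sub_nonneg.2 hr'.2), Real.norm_eq_abs] at this
  have h2 : |c.g (X T) (w T) - c.g (X' T) (w' T)| ≤ L * A :=
    (B.g_lip _ _ _ _).trans (mul_le_mul_of_nonneg_left (hXX T ⟨hr'.2, le_rfl⟩) hL.le)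
  refine (abs_add_le _ _).trans ((add_le_add h1 h2).trans ?_)
  have h3 : S ≤ 3 * (‖X r' - x'‖ + D) := by have := norm_nonneg (X r' - x'); linarith
  calc L * A * (T - r') + L * A ≤ L * A * T + L * A := by
        gcongr
        linarith [hr'.1]
    _ = L * (T + 1) * (Real.exp (L * T) + 1) * S := by rw [hA]; ring
    _ ≤ L * (T + 1) * (Real.exp (L * T) + 1) * (3 * (‖X r' - x'‖ + D)) := by gcongr
    _ = _ := by rw [stabConst]; ring

theorem exists_mul_le_rpow_add {q a b : ℝ} (hq : 1 < q) (ha : 0 < a) (hb : 0 ≤ b) :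
    ∃ A : ℝ, 0 ≤ A ∧ ∀ y : ℝ, 0 ≤ y → b * y ≤ a * y ^ q + A := by
  refine ⟨b * (b / a) ^ (1 / (q - 1)), by positivity, fun y hy => ?_⟩
  have hq1 : 0 < q - 1 := by linarith
  rcases le_total y ((b / a) ^ (1 / (q - 1))) with h | h
  · have : 0 ≤ a * y ^ q := by positivity
    linarith [mul_le_mul_of_nonneg_left h hb]
  · have h1 : b / a ≤ y ^ (q - 1) := by
      have := Real.rpow_le_rpow (by positivity) h hq1.le
      rwa [← Real.rpow_mul (by positivity), one_div, inv_mul_cancel₀ hq1.ne', Real.rpow_one] at this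
    have h2 : b ≤ a * y ^ (q - 1) := by rwa [div_le_iff₀' ha] at h1
    have h3 : y ^ q = y ^ (q - 1) * y := by
      rcases hy.eq_or_lt with rfl | hy
      · simp [Real.zero_rpow (by linarith : q ≠ 0)]
      · rw [Real.rpow_sub_one hy.ne']; field_simp
    have h4 : 0 ≤ b * (b / a) ^ (1 / (q - 1)) := by positivity
    rw [h3]
    nlinarith [mul_le_mul_of_nonneg_right h2 hy]

/-- Coercivity: a control of bounded cost is bounded in `L^q`.  The terms with `ψ` and `g` grow
linearly in the state and the path, hence linearly in the `L^q` norm of the control, and are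
absorbed because `q > 1`. -/
theorem Coeffs.Bounds.exists_le_cost (hα0 : 0 < α) (hα1 : α < 1) (B : c.Bounds T M L)
    {q f₀ C₀ : ℝ} (hq : 1 / α < q) (hf₀ : 0 < f₀) (hC₀ : 0 < C₀)
    (hf : ∀ x a u, f₀ * ‖u‖ ^ q - C₀ ≤ c.f x a u) :
    ∃ A : ℝ, 0 ≤ A ∧ ∀ (r : ℝ) (x : E e) (γ : AC α T k) (u : ℝ → E k) (X : ℝ → E e),
      r ∈ Icc 0 T → MemLp u ⊤ (volume.restrict (Icc r T)) → c.IsState T r x (nu r γ u) X →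
      f₀ / 2 * (∫ s in r..T, ‖u s‖ ^ q) - A * (1 + ‖x‖ + ‖γ.1‖) ≤ c.cost r γ u X := by
  have hT0 := hT.out
  have hL := B.L_pos
  have hM := B.M_nonneg
  have hq1 : 1 < q := lt_trans (by rw [lt_div_iff₀ hα0]; linarith) hq
  have hq0 : 0 < q := by linarith
  obtain ⟨C, hC0, hC⟩ := exists_norm_nu_le (T := T) (k := k) hα0 hα1 hq
  obtain ⟨A', hA'0, hA'⟩ := exists_mul_le_rpow_add (b := L * (T + 1) * C) hq1 (half_pos hf₀)
    (by positivity)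
  set G0 := |c.g 0 0| with hG0
  have hG00 : 0 ≤ G0 := abs_nonneg _
  refine ⟨C₀ * T + L * T + G0 + A' + L * (T + 1) * (M * T) + 3 * (L * (T + 1)), by positivity,
    fun r x γ u X hr hu hX => ?_⟩
  set w := nu r γ u with hw
  have hwc : ContinuousOn w (Icc r T) :=
    (continuousOn_nu hα0 hα1 γ hr hu).mono (Icc_subset_Icc_left hr.1)
  set I := ∫ s in r..T, ‖u s‖ ^ q with hI
  have hI0 : 0 ≤ I := intervalIntegral.integral_nonneg hr.2 fun s _ => by positivity
  set Y := I ^ (1 / q) with hY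
  have hY0 : 0 ≤ Y := by positivity
  have hYq : Y ^ q = I := by
    rw [hY, ← Real.rpow_mul hI0, one_div, inv_mul_cancel₀ hq0.ne', Real.rpow_one]
  have hYA := hA' Y hY0
  rw [hYq] at hYA
  have hx := norm_nonneg x
  have hγ := norm_nonneg γ.1
  set S := ‖x‖ + M * T + 3 * ‖γ.1‖ + C * Y with hS
  have hXw : ∀ s ∈ Icc r T, ‖X s‖ + ‖w s‖ ≤ S := fun s hs => by
    have h1 := B.norm_state_sub_le hr.1 hX hwc le_rfl hs.1 hs.2
    rw [hX.apply_start hr.2] at h1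
    have h2 := norm_add_le (X s - x) x
    rw [sub_add_cancel] at h2
    have h3 : M * (s - r) ≤ M * T := mul_le_mul_of_nonneg_left (by linarith [hs.2, hr.1]) hM
    have h4 := hC γ r u hr hu s ⟨hr.1.trans hs.1, hs.2⟩
    rw [hS]; linarith
  have hS0 : 0 ≤ S := by positivity
  have h1 : f₀ * I - C₀ * T ≤ ∫ s in r..T, c.f (X s) (w s) (u s) := by
    have iu := intervalIntegrable_norm_rpow hr.2 hq0.le hu
    have h := intervalIntegral.integral_mono_on hr.2 ((iu.const_mul f₀).sub (by simp))
      (intervalIntegrable_of_memLp_top hr.2 (B.memLp_f hX.1 hwc hu))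
      (fun s _ => hf (X s) (w s) (u s))
    rw [intervalIntegral.integral_sub (iu.const_mul f₀) (by simp),
      intervalIntegral.integral_const_mul] at h
    simp only [intervalIntegral.integral_const, smul_eq_mul] at h
    have : (T - r) * C₀ ≤ C₀ * T := by nlinarith [hr.1]
    linarith
  have h2 : -(L * (1 + S) * T) ≤ ∫ s in r..T, c.psi (X s) (w s) (c.etaDot T s) := by
    have := intervalIntegral.norm_integral_le_of_norm_le_const (a := r) (b := T)
      (C := L * (1 + S)) (f := fun s => c.psi (X s) (w s) (c.etaDot T s)) fun s hs => by
        rw [uIoc_of_le hr.2] at hs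
        refine (B.psi_le s ⟨hr.1.trans hs.1.le, hs.2⟩ _ _).trans ?_
        have := hXw s ⟨hs.1.le, hs.2⟩
        exact mul_le_mul_of_nonneg_left (by linarith) hL.le
    rw [abs_of_nonneg (sub_nonneg.2 hr.2), Real.norm_eq_abs] at this
    have h3 : L * (1 + S) * (T - r) ≤ L * (1 + S) * T :=
      mul_le_mul_of_nonneg_left (by linarith [hr.1]) (by positivity)
    linarith [(abs_le.1 this).1]
  have h3 : -(G0 + L * S) ≤ c.g (X T) (w T) := by
    have h4 := B.g_lip (X T) 0 (w T) 0
    rw [sub_zero, sub_zero] at h4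
    have h5 := mul_le_mul_of_nonneg_left (hXw T ⟨hr.2, le_rfl⟩) hL.le
    linarith [(abs_le.1 h4).1, neg_abs_le (c.g 0 0)]
  have h4 : L * (1 + S) * T + (G0 + L * S) ≤
      f₀ / 2 * I + A' + L * T + G0 + L * (T + 1) * (‖x‖ + M * T + 3 * ‖γ.1‖) := by
    rw [hS]; linarith
  have h5 : C₀ * T + L * T + G0 + A' + L * (T + 1) * (‖x‖ + M * T + 3 * ‖γ.1‖) ≤
      (C₀ * T + L * T + G0 + A' + L * (T + 1) * (M * T) + 3 * (L * (T + 1))) *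
        (1 + ‖x‖ + ‖γ.1‖) := by
    have e0 : 0 ≤ C₀ * T + L * T + G0 + A' + L * (T + 1) * (M * T) := by positivity
    have e1 : 0 ≤ L * (T + 1) := by positivity
    have e2 := mul_nonneg e0 hx
    have e3 := mul_nonneg e0 hγ
    have e4 := mul_nonneg e1 hx
    linarith
  rw [Coeffs.cost]
  linarith

/-- The controls admissible for the initial data `p`, together with the state they drive. -/
def Coeffs.Admissible (c : Coeffs e k d) (p : Pt α T e k) (u : ℝ → E k) (X : ℝ → E e) : Prop :=
  MemLp u ⊤ (volume.restrict (Icc (p.1 : ℝ) T)) ∧ c.IsState T p.1 p.2.1 (nu p.1 p.2.2 u) X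

theorem Coeffs.Bounds.exists_admissible (hα0 : 0 < α) (hα1 : α < 1) (B : c.Bounds T M L)
    (p : Pt α T e k) {u : ℝ → E k} (hu : MemLp u ⊤ (volume.restrict (Icc (p.1 : ℝ) T))) :
    ∃ X, c.Admissible p u X := by
  obtain ⟨X, hX⟩ := B.exists_isState p.1.2 p.2.1
    ((continuousOn_nu hα0 hα1 p.2.2 p.1.2 hu).mono (Icc_subset_Icc_left p.1.2.1))
  exact ⟨X, hu, hX⟩

theorem Coeffs.Bounds.costSet_nonempty (hα0 : 0 < α) (hα1 : α < 1) (B : c.Bounds T M L)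
    (p : Pt α T e k) : (c.costSet p).Nonempty := by
  obtain ⟨X, hX⟩ := B.exists_admissible hα0 hα1 p (u := 0) MemLp.zero
  exact ⟨_, 0, X, hX.1, hX.2, rfl⟩

theorem Coeffs.Bounds.isGLB_costSet (hα0 : 0 < α) (hα1 : α < 1) (B : c.Bounds T M L)
    {q f₀ C₀ : ℝ} (hq : 1 / α < q) (hf₀ : 0 < f₀) (hC₀ : 0 < C₀)
    (hf : ∀ x a u, f₀ * ‖u‖ ^ q - C₀ ≤ c.f x a u) (p : Pt α T e k) :
    IsGLB (c.costSet p) (c.value p) := by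
  obtain ⟨A, hA0, hA⟩ := B.exists_le_cost (T := T) hα0 hα1 hq hf₀ hC₀ hf
  refine isGLB_csInf (B.costSet_nonempty hα0 hα1 p) ⟨-(A * (1 + ‖p.2.1‖ + ‖p.2.2.1‖)), ?_⟩
  rintro y ⟨u, X, hu, hX, rfl⟩
  refine le_trans ?_ (hA p.1 p.2.1 p.2.2 u X p.1.2 hu hX)
  have : 0 ≤ ∫ s in (p.1 : ℝ)..T, ‖u s‖ ^ q :=
    intervalIntegral.integral_nonneg p.1.2.2 fun s _ => by positivity
  have : 0 ≤ f₀ / 2 * ∫ s in (p.1 : ℝ)..T, ‖u s‖ ^ q := by positivity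
  linarith

theorem Coeffs.exists_cost_lt {p : Pt α T e k} (hglb : IsGLB (c.costSet p) (c.value p)) {η : ℝ}
    (hη : 0 < η) :
    ∃ u X, c.Admissible p u X ∧ c.cost p.1 p.2.2 u X < c.value p + η := by
  obtain ⟨y, ⟨u, X, hu, hX, rfl⟩, -, hy⟩ := hglb.exists_between (lt_add_of_pos_right _ hη)
  exact ⟨u, X, ⟨hu, hX⟩, hy⟩

/-- One half of dynamic programming, with an error term for a later data point `p'` that need not
lie on the controlled trajectory. -/
theorem Coeffs.Bounds.value_le_cost_sub (hα0 : 0 < α) (hα1 : α < 1) (B : c.Bounds T M L)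
    {p p' : Pt α T e k} (hpp : (p.1 : ℝ) ≤ p'.1) (hglb : IsGLB (c.costSet p') (c.value p'))
    {u : ℝ → E k} {X : ℝ → E e} (hX : c.Admissible p u X) {D : ℝ}
    (hD : ∀ s ∈ Icc 0 (p'.1 : ℝ), ‖AC.ext p'.2.2 s - nu p.1 p.2.2 u s‖ ≤ D) :
    c.value p' ≤ c.cost p.1 p.2.2 u X
      - (∫ s in (p.1 : ℝ)..p'.1, c.running T s (X s) (nu p.1 p.2.2 u s) (u s))
      + stabConst L T * (‖X p'.1 - p'.2.1‖ + D) := by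
  have hu' := memLp_top_Icc_mono hX.1 hpp le_rfl
  obtain ⟨X', hX'⟩ := B.exists_admissible hα0 hα1 p' hu'
  have h1 := B.abs_cost_sub_le hα0 hα1 p.1.2 p'.1.2 hpp hX.1 hu' (fun _ _ => rfl) hX.2 hX'.2 hD
  have h2 : c.value p' ≤ c.cost p'.1 p'.2.2 u X' := hglb.1 ⟨u, X', hu', hX'.2, rfl⟩
  linarith [(abs_le.1 h1).1]

/-- The other half: follow the control `u` up to the time of `p'`, then a nearly optimal control
for `p'`. -/
theorem Coeffs.Bounds.value_le_integral_add (hα0 : 0 < α) (hα1 : α < 1) (B : c.Bounds T M L)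
    {p p' : Pt α T e k} (hpp : (p.1 : ℝ) ≤ p'.1) (hglb : IsGLB (c.costSet p) (c.value p))
    (hglb' : IsGLB (c.costSet p') (c.value p'))
    {u : ℝ → E k} {X : ℝ → E e} (hX : c.Admissible p u X) {D : ℝ}
    (hD : ∀ s ∈ Icc 0 (p'.1 : ℝ), ‖AC.ext p'.2.2 s - nu p.1 p.2.2 u s‖ ≤ D) :
    c.value p ≤ (∫ s in (p.1 : ℝ)..p'.1, c.running T s (X s) (nu p.1 p.2.2 u s) (u s))
      + c.value p' + stabConst L T * (‖X p'.1 - p'.2.1‖ + D) := by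
  refine le_of_forall_pos_le_add fun η hη => ?_
  obtain ⟨u', X', hX', hcost⟩ := Coeffs.exists_cost_lt hglb' hη
  have hv : MemLp (concat p'.1 u u') ⊤ (volume.restrict (Icc (p.1 : ℝ) T)) :=
    memLp_concat (memLp_top_Icc_mono hX.1 le_rfl p'.1.2.2) hX'.1
  obtain ⟨Z, hZ⟩ := B.exists_admissible hα0 hα1 p hv
  have hnu : ∀ s : ℝ, s ≤ p'.1 → nu p.1 p.2.2 (concat p'.1 u u') s = nu p.1 p.2.2 u s := fun s hs =>
    nu_congr _ fun y hy => concat_of_le _ _ (hy.2.le.trans hs)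
  have hwc := (continuousOn_nu hα0 hα1 p.2.2 p.1.2 hX.1).mono (Icc_subset_Icc_left p.1.2.1)
  have hwc' := (continuousOn_nu hα0 hα1 p.2.2 p.1.2 hv).mono (Icc_subset_Icc_left p.1.2.1)
  -- uniqueness of the state up to the time of `p'`
  have hZX : ∀ s ∈ Icc (p.1 : ℝ) p'.1, Z s = X s := fun s hs => by
    have := B.norm_state_sub_state_le p.1.2.1 hZ.2 hX.2 hwc' hwc (δ := 0) p'.1.2.2
      (fun y hy => by rw [hnu y hy.2, sub_self, norm_zero]) hs
    rw [sub_self, norm_zero, add_zero, mul_zero] at this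
    exact sub_eq_zero.1 (norm_le_zero_iff.1 this)
  have h1 := B.abs_cost_sub_le hα0 hα1 p.1.2 p'.1.2 hpp hv hX'.1
    (fun s hs => (concat_of_lt _ _ hs.1).symm) hZ.2 hX'.2 (D := D)
    (fun s hs => by rw [hnu s hs.2]; exact hD s hs)
  have h2 : c.value p ≤ c.cost p.1 p.2.2 (concat p'.1 u u') Z := hglb.1 ⟨_, Z, hv, hZ.2, rfl⟩
  have h3 : ∫ s in (p.1 : ℝ)..p'.1, c.running T s (Z s) (nu p.1 p.2.2 (concat p'.1 u u') s)
      (concat p'.1 u u' s) =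
      ∫ s in (p.1 : ℝ)..p'.1, c.running T s (X s) (nu p.1 p.2.2 u s) (u s) := by
    refine intervalIntegral.integral_congr fun s hs => ?_
    rw [uIcc_of_le hpp] at hs
    rw [hZX s hs, hnu s hs.2, concat_of_le _ _ hs.2]
  rw [h3, hZX p'.1 ⟨hpp, le_rfl⟩] at h1
  linarith [(abs_le.1 h1).2]

end Control

/-! ### Functional chain rule for ci-smooth functionals -/

theorem le_of_eventually_sub_le {h : ℝ → ℝ} {a b : ℝ} (hab : a ≤ b) (hc : ContinuousOn h (Icc a b))
    (hd : ∀ s ∈ Ico a b, ∀ κ > 0, ∀ᶠ z in 𝓝[>] s, h z - h s ≤ κ * (z - s)) : h b ≤ h a := by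
  have key : ∀ κ > 0, h b ≤ h a + κ * (b - a) := by
    intro κ hκ
    refine image_le_of_liminf_slope_right_lt_deriv_boundary' (f' := fun _ => 0)
      (B := fun x => h a + κ * (x - a)) (B' := fun _ => κ) hc ?_ (by simp)
      (by fun_prop) ?_ (fun _ _ _ => hκ) ⟨hab, le_rfl⟩
    · intro x hx r hr
      refine Eventually.frequently ?_
      filter_upwards [hd x hx (r / 2) (half_pos hr), self_mem_nhdsWithin] with z hz hxz
      have hzx : 0 < z - x := sub_pos.2 hxz
      rw [slope_def_field, div_lt_iff₀ hzx]
      nlinarith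
    · intro x _
      have : HasDerivAt (fun x => h a + κ * (x - a)) (κ * 1) x :=
        (((hasDerivAt_id x).sub_const a).const_mul κ).const_add _
      simpa using this.hasDerivWithinAt
  refine le_of_forall_pos_le_add fun η hη => ?_
  rcases hab.eq_or_lt with rfl | hlt
  · linarith
  · have hba : 0 < b - a := sub_pos.2 hlt
    have := key (η / (b - a)) (by positivity)
    rwa [div_mul_cancel₀ _ hba.ne'] at this

section ChainRule

variable {α T : ℝ} [hT : Fact (0 < T)] {e k : ℕ}

/-- A real time as a point of `[0, T]`. -/
noncomputable def timeOf (T : ℝ) [hT : Fact (0 < T)] (z : ℝ) : Icc (0 : ℝ) T :=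
  projIcc 0 T hT.out.le z

theorem timeOf_coe {z : ℝ} (hz : z ∈ Icc 0 T) : (timeOf T z : ℝ) = z := by
  rw [timeOf, projIcc_of_mem _ hz]

theorem timeOf_eq (t : Icc (0 : ℝ) T) : timeOf T t = t := projIcc_val _ t

theorem continuous_timeOf : Continuous (timeOf T) :=
  continuous_projIcc (h := hT.out.le)

theorem tendsto_curve {X : ℝ → E e} {s b : ℝ} (hs : 0 ≤ s) (hsb : s < b) (hb : b ≤ T)
    (hX : ContinuousWithinAt X (Ioi s) s) :
    Tendsto (fun z => (timeOf T z, X z)) (𝓝[>] s)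
      (𝓝[{q : Icc (0 : ℝ) T × E e | timeOf T s < q.1}] (timeOf T s, X s)) := by
  refine tendsto_nhdsWithin_iff.2 ⟨?_, ?_⟩
  · exact ((continuous_timeOf.tendsto s).mono_left nhdsWithin_le_nhds).prodMk_nhds hX
  · filter_upwards [Ioo_mem_nhdsGT hsb] with z hz
    have h1 := timeOf_coe (T := T) (z := s) ⟨hs, hsb.le.trans hb⟩
    have h2 := timeOf_coe (T := T) (z := z) ⟨hs.trans hz.1.le, hz.2.le.trans hb⟩
    show (timeOf T s : ℝ) < timeOf T z
    rw [h1, h2]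
    exact hz.1

variable {φ Dt : Pt α T e k → ℝ} {Dx : Pt α T e k → E e} {Dγ : Pt α T e k → E k}

theorem IsCiSmooth.neg (h : IsCiSmooth φ Dt Dx Dγ) :
    IsCiSmooth (fun p => -φ p) (fun p => -Dt p) (fun p => -Dx p) (fun p => -Dγ p) := by
  refine ⟨fun p hp ν hν => ?_, h.continuous.neg, h.continuousOn_t.neg, h.continuousOn_x.neg,
    h.continuousOn_γ.neg⟩
  refine (h.hasCiDeriv p hp ν hν).neg_left.congr_left fun q => ?_
  simp only [inner_neg_left]
  ring

/-- The value of a ci-smooth functional depends only on the past of the path. -/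
theorem IsCiSmooth.apply_eq (hα0 : 0 < α) (hα1 : α < 1) (h : IsCiSmooth φ Dt Dx Dγ)
    (p : Pt α T e k) (hp : (p.1 : ℝ) < T) (ν : AC α T k)
    (hν : ∀ s : Icc (0 : ℝ) T, s ≤ p.1 → ν.1 s = p.2.2.1 s) : φ (p.1, p.2.1, ν) = φ p := by
  have hT0 := hT.out
  have hr0 : (0 : ℝ) ≤ p.1 := p.1.2.1
  have hext : ∀ s ∈ Icc 0 (p.1 : ℝ), AC.ext ν s = AC.ext p.2.2 s := fun s hs => by
    have hsT : s ∈ Icc 0 T := ⟨hs.1, hs.2.trans hp.le⟩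
    have := hν ⟨s, hsT⟩ (Subtype.coe_le_coe.1 hs.2)
    rwa [← AC.ext_apply, ← AC.ext_apply] at this
  have ht := tendsto_curve (T := T) (X := fun _ => p.2.1) hr0 hp le_rfl
    continuousWithinAt_const
  rw [timeOf_eq] at ht
  have ho := (h.hasCiDeriv p hp ν hν).comp_tendsto ht
  have hI : Tendsto (fun z => rlIntegral (1 - α) 0 (fun s => AC.ext ν s - AC.ext p.2.2 0)
      (timeOf T z : ℝ)) (𝓝[>] (p.1 : ℝ))
      (𝓝 (rlIntegral (1 - α) 0 (fun s => AC.ext p.2.2 s - AC.ext p.2.2 0) (p.1 : ℝ))) := by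
    have e1 : rlIntegral (1 - α) 0 (fun s => AC.ext p.2.2 s - AC.ext p.2.2 0) (p.1 : ℝ) =
        ∫ s in (0 : ℝ)..p.1, caputo ν s := by
      rw [← rlIntegral_increment hα0 hα1 ν p.1.2]
      refine rlIntegral_congr_Ioo hr0 fun s hs => ?_
      rw [hext s (Ioo_subset_Icc_self hs), hext 0 ⟨le_rfl, hr0⟩]
    have e2 : ∀ z, rlIntegral (1 - α) 0 (fun s => AC.ext ν s - AC.ext p.2.2 0)
        (timeOf T z : ℝ) = ∫ s in (0 : ℝ)..(timeOf T z : ℝ), caputo ν s := fun z => by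
      rw [← rlIntegral_increment hα0 hα1 ν (timeOf T z).2, hext 0 ⟨le_rfl, hr0⟩]
    simp_rw [e1, e2]
    have hc := intervalIntegral.continuousOn_primitive_interval (μ := volume) (a := 0) (b := T)
      (f := caputo ν) (by
        rw [uIcc_of_le hT0.le]
        exact (intervalIntegrable_iff_integrableOn_Icc_of_le hT0.le).1
          (intervalIntegrable_of_memLp_top hT0.le (memLp_caputo hα0 hα1 ν)))
    rw [uIcc_of_le hT0.le] at hc
    have h3 : Continuous fun z => ∫ s in (0 : ℝ)..(timeOf T z : ℝ), caputo ν s :=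
      hc.comp_continuous (continuous_subtype_val.comp continuous_timeOf) fun z => (timeOf T z).2
    have := (h3.tendsto (p.1 : ℝ)).mono_left (nhdsWithin_le_nhds (s := Ioi (p.1 : ℝ)))
    rwa [timeOf_eq] at this
  have htime : Tendsto (fun z => ((timeOf T z : Icc (0 : ℝ) T) : ℝ)) (𝓝[>] (p.1 : ℝ))
      (𝓝 (p.1 : ℝ)) := by
    have := ((continuous_subtype_val.comp (continuous_timeOf (T := T))).tendsto
      (p.1 : ℝ)).mono_left (nhdsWithin_le_nhds (s := Ioi (p.1 : ℝ)))
    rwa [Function.comp_apply, timeOf_eq] at this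
  have h0 : Tendsto (fun z => (((timeOf T z : Icc (0 : ℝ) T) : ℝ) - (p.1 : ℝ)) +
      ‖p.2.1 - p.2.1‖) (𝓝[>] (p.1 : ℝ)) (𝓝 0) := by
    have := (htime.sub_const (p.1 : ℝ)).add_const ‖p.2.1 - p.2.1‖
    simpa using this
  have h1 := ho.trans_tendsto h0
  have hφ : Tendsto (fun z => φ (timeOf T z, p.2.1, ν)) (𝓝[>] (p.1 : ℝ))
      (𝓝 (φ (p.1, p.2.1, ν))) := by
    have hc : Continuous fun z => φ (timeOf T z, p.2.1, ν) :=
      h.continuous.comp (continuous_timeOf.prodMk (continuous_const.prodMk continuous_const))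
    have := (hc.tendsto (p.1 : ℝ)).mono_left (nhdsWithin_le_nhds (s := Ioi (p.1 : ℝ)))
    rwa [timeOf_eq] at this
  have h2 := (hφ.sub_const (φ p)).sub ((((htime.sub_const (p.1 : ℝ)).const_mul (Dt p)).add_const
    (inner ℝ (Dx p) (p.2.1 - p.2.1))).add
      ((tendsto_const_nhds (x := Dγ p)).inner (𝕜 := ℝ) (hI.sub_const
        (rlIntegral (1 - α) 0 (fun s => AC.ext p.2.2 s - AC.ext p.2.2 0) (p.1 : ℝ)))))
  -- compare two limits as the time decreases to `p.1` along `ν`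
  have h3 := tendsto_nhds_unique h1 h2
  simp only [sub_self, mul_zero, inner_zero_right, add_zero, sub_zero] at h3
  linarith

/-- Functional chain rule in integrated form, for a functional whose derivatives along the curve
`(s, X_s, ν)` are within `ε` of constants.  Only right increments enter, so the Caputo derivative
of `ν` need not exist pointwise. -/
theorem IsCiSmooth.le_increment (hα0 : 0 < α) (hα1 : α < 1) (h : IsCiSmooth φ Dt Dx Dγ)
    {r r' M ε τ : ℝ} {ξ : E e} {ζ : E k} (hr : 0 ≤ r) (hrr : r ≤ r') (hr' : r' ≤ T)
    (hM : 0 ≤ M) (ν : AC α T k) {X : ℝ → E e}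
    (hX : ∀ s t, r ≤ s → s ≤ t → t ≤ r' → ‖X t - X s‖ ≤ M * (t - s))
    (hτ : ∀ s ∈ Ico r r', |Dt (timeOf T s, X s, ν) - τ| ≤ ε)
    (hξ : ∀ s ∈ Ico r r', ‖Dx (timeOf T s, X s, ν) - ξ‖ ≤ ε)
    (hζ : ∀ s ∈ Ico r r', ‖Dγ (timeOf T s, X s, ν) - ζ‖ ≤ ε) :
    τ * (r' - r) + inner ℝ ξ (X r' - X r) + inner ℝ ζ (∫ s in r..r', caputo ν s)
      - ε * ((1 + M) * (r' - r) + ∫ s in r..r', ‖caputo ν s‖) ≤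
      φ (timeOf T r', X r', ν) - φ (timeOf T r, X r, ν) := by
  have hT0 := hT.out
  have hν := memLp_caputo hα0 hα1 ν
  have hi : ∀ {a b : ℝ}, 0 ≤ a → a ≤ b → b ≤ T → IntervalIntegrable (caputo ν) volume a b :=
    fun ha hab hb => intervalIntegrable_of_memLp_top hab (memLp_top_Icc_mono hν ha hb)
  have hXc : ContinuousOn X (Icc r r') := by
    have : LipschitzOnWith M.toNNReal X (Icc r r') := by
      refine LipschitzOnWith.of_dist_le_mul fun s hs t ht => ?_
      rw [Real.coe_toNNReal _ hM, dist_eq_norm, Real.dist_eq]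
      rcases le_total s t with hst | hst
      · rw [norm_sub_rev, abs_sub_comm, abs_of_nonneg (sub_nonneg.2 hst)]
        exact hX s t hs.1 hst ht.2
      · rw [abs_of_nonneg (sub_nonneg.2 hst)]
        exact hX t s ht.1 hst hs.2
    exact this.continuousOn
  have hUc : ContinuousOn (fun z => ∫ s in r..z, caputo ν s) (Icc r r') := by
    have := intervalIntegral.continuousOn_primitive_interval (μ := volume) (a := r) (b := r')
      (f := caputo ν) (by
        rw [uIcc_of_le hrr]
        exact (intervalIntegrable_iff_integrableOn_Icc_of_le hrr).1 (hi hr hrr hr'))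
    rwa [uIcc_of_le hrr] at this
  have hVc : ContinuousOn (fun z => ∫ s in r..z, ‖caputo ν s‖) (Icc r r') := by
    have := intervalIntegral.continuousOn_primitive_interval (μ := volume) (a := r) (b := r')
      (f := fun s => ‖caputo ν s‖) (by
        rw [uIcc_of_le hrr]
        exact (intervalIntegrable_iff_integrableOn_Icc_of_le hrr).1 (hi hr hrr hr').norm)
    rwa [uIcc_of_le hrr] at this
  set g : ℝ → ℝ := fun z => τ * (z - r) + inner ℝ ξ (X z - X r) +
    inner ℝ ζ (∫ s in r..z, caputo ν s) - ε * ((1 + M) * (z - r) + ∫ s in r..z, ‖caputo ν s‖)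
    - φ (timeOf T z, X z, ν) with hg
  have hφc : ContinuousOn (fun z => φ (timeOf T z, X z, ν)) (Icc r r') :=
    h.continuous.comp_continuousOn (continuous_timeOf.continuousOn.prodMk
      (hXc.prodMk continuousOn_const))
  have hgc : ContinuousOn g (Icc r r') := by
    have h1 : ContinuousOn (fun z => inner ℝ ξ (X z - X r)) (Icc r r') :=
      continuousOn_const.inner (hXc.sub continuousOn_const)
    have h2 : ContinuousOn (fun z => inner ℝ ζ (∫ s in r..z, caputo ν s)) (Icc r r') :=
      continuousOn_const.inner hUc
    have h3 : ContinuousOn (fun z => τ * (z - r)) (Icc r r') := by fun_prop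
    have h4 : ContinuousOn (fun z => (1 + M) * (z - r)) (Icc r r') := by fun_prop
    exact (((h3.add h1).add h2).sub (continuousOn_const.mul (h4.add hVc))).sub hφc
  -- `g` is decreasing, as its right increments are at most `o(z - s)`
  have key : g r' ≤ g r := by
    refine le_of_eventually_sub_le hrr hgc fun s hs κ hκ => ?_
    have hs0 : 0 ≤ s := hr.trans hs.1
    have hsT : s ∈ Icc 0 T := ⟨hs0, hs.2.le.trans hr'⟩
    have hmem : Icc r r' ∈ 𝓝[>] s :=
      mem_of_superset (Ioo_mem_nhdsGT hs.2) fun z hz => ⟨hs.1.trans hz.1.le, hz.2.le⟩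
    have ht := tendsto_curve (T := T) (X := X) hs0 hs.2 hr'
      ((hXc s (Ico_subset_Icc_self hs)).mono_of_mem_nhdsWithin hmem)
    have hlt : ((timeOf T s : Icc (0 : ℝ) T) : ℝ) < T := by
      rw [timeOf_coe hsT]; exact hs.2.trans_le hr'
    have hM1 : 0 < 1 + M := by linarith
    have ho := ht.eventually
      ((h.hasCiDeriv (timeOf T s, X s, ν) hlt ν fun _ _ => rfl).def (div_pos hκ hM1))
    filter_upwards [ho, Ioo_mem_nhdsGT hs.2] with z hz hsz
    have hzT : z ∈ Icc 0 T := ⟨hs0.trans hsz.1.le, hsz.2.le.trans hr'⟩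
    have hzs : 0 ≤ z - s := by linarith [hsz.1]
    simp only [timeOf_coe hsT, timeOf_coe hzT] at hz
    rw [rlIntegral_increment hα0 hα1 ν hsT, rlIntegral_increment hα0 hα1 ν hzT,
      intervalIntegral.integral_interval_sub_left (hi le_rfl hzT.1 hzT.2)
        (hi le_rfl hs0 hsT.2)] at hz
    have hX' := hX s z hs.1 hsz.1.le hsz.2.le
    set Δ := X z - X s with hΔ
    set U := ∫ y in s..z, caputo ν y with hU
    set V := ∫ y in s..z, ‖caputo ν y‖ with hV
    have hUV : ‖U‖ ≤ V := intervalIntegral.norm_integral_le_integral_norm hsz.1.le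
    have hrem : κ / (1 + M) * ‖z - s + ‖Δ‖‖ ≤ κ * (z - s) := by
      rw [Real.norm_of_nonneg (by positivity)]
      calc κ / (1 + M) * (z - s + ‖Δ‖) ≤ κ / (1 + M) * (z - s + M * (z - s)) := by gcongr
        _ = κ * (z - s) := by field_simp
    have hz' := (abs_le.1 (hz.trans hrem)).1
    have h1 := hτ s hs
    have h2 := hξ s hs
    have h3 := hζ s hs
    set D1 := Dt (timeOf T s, X s, ν)
    set D2 := Dx (timeOf T s, X s, ν)
    set D3 := Dγ (timeOf T s, X s, ν)
    have hε : 0 ≤ ε := (abs_nonneg _).trans h1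
    have b1 : (τ - D1) * (z - s) ≤ ε * (z - s) :=
      mul_le_mul_of_nonneg_right (by linarith [(abs_le.1 h1).1]) hzs
    have b2 : inner ℝ ξ Δ - inner ℝ D2 Δ ≤ ε * (M * (z - s)) := by
      rw [← inner_sub_left]
      refine (real_inner_le_norm _ _).trans ?_
      rw [norm_sub_rev]
      exact mul_le_mul h2 hX' (norm_nonneg _) hε
    have b3 : inner ℝ ζ U - inner ℝ D3 U ≤ ε * V := by
      rw [← inner_sub_left]
      refine (real_inner_le_norm _ _).trans ?_
      rw [norm_sub_rev]
      exact mul_le_mul h3 hUV (norm_nonneg _) hε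
    have e1 : (∫ y in r..z, caputo ν y) - ∫ y in r..s, caputo ν y = U :=
      intervalIntegral.integral_interval_sub_left (hi hr (hs.1.trans hsz.1.le) hzT.2)
        (hi hr hs.1 hsT.2)
    have e2 : (∫ y in r..z, ‖caputo ν y‖) - ∫ y in r..s, ‖caputo ν y‖ = V :=
      intervalIntegral.integral_interval_sub_left (hi hr (hs.1.trans hsz.1.le) hzT.2).norm
        (hi hr hs.1 hsT.2).norm
    have e3 : inner ℝ ξ (X z - X r) - inner ℝ ξ (X s - X r) = inner ℝ ξ Δ := by
      rw [← inner_sub_right]; congr 1; rw [hΔ]; abel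
    have e4 : inner ℝ ζ (∫ y in r..z, caputo ν y) - inner ℝ ζ (∫ y in r..s, caputo ν y) =
        inner ℝ ζ U := by
      rw [← inner_sub_right, e1]
    have e5 : g z - g s = τ * (z - s) + inner ℝ ξ Δ + inner ℝ ζ U -
        ε * ((1 + M) * (z - s) + V) - (φ (timeOf T z, X z, ν) - φ (timeOf T s, X s, ν)) := by
      rw [← e3, ← e4, ← e2, hg]; ring
    rw [e5]
    linarith
  have hgr : g r = - φ (timeOf T r, X r, ν) := by simp [hg]
  rw [hgr] at key
  simp only [hg] at key
  linarith

end ChainRule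

/-! ### Short-time behaviour along controlled trajectories -/

theorem eventually_forall_Icc {r T : ℝ} (hr : 0 ≤ r) (hrT : r < T) {P : ℝ → Prop}
    (h : ∀ᶠ s in 𝓝[Icc 0 T] r, P s) :
    ∀ᶠ δ in 𝓝[>] (0 : ℝ), ∀ s ∈ Icc r (r + δ), P s := by
  obtain ⟨ρ, hρ, hb⟩ := Metric.mem_nhdsWithin_iff.1 h
  filter_upwards [Ioo_mem_nhdsGT hρ, Ioo_mem_nhdsGT (sub_pos.2 hrT)] with δ h1 h2 s hs
  refine hb ⟨?_, hr.trans hs.1, by linarith [hs.2, h2.2]⟩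
  rw [Metric.mem_ball, Real.dist_eq, abs_of_nonneg (by linarith [hs.1])]
  linarith [hs.2, h1.2]

section ShortTime

variable {α T : ℝ} [hT : Fact (0 < T)] {e k d : ℕ} {c : Coeffs e k d} {M L : ℝ}

theorem exists_norm_nu_concat_sub_le (hα0 : 0 < α) (hα1 : α < 1) {q : ℝ} (hq : 1 / α < q)
    (γ : AC α T k) {Q : ℝ} (hQ : 0 ≤ Q) :
    ∃ A : ℝ, 0 ≤ A ∧ ∀ (r b : ℝ) (u : ℝ → E k), 0 ≤ r → r ≤ b → b ≤ T →
      MemLp u ⊤ (volume.restrict (Icc r T)) → ∫ s in r..T, ‖u s‖ ^ q ≤ Q →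
      ∀ t ∈ Icc 0 T, ‖nu r γ (concat b u (caputo γ)) t - AC.ext γ t‖ ≤
        A * (b - r) ^ (α - 1 / q) := by
  have hT0 := hT.out
  have hq0 : 0 < q := lt_trans (by positivity) hq
  obtain ⟨C, hC0, hC⟩ := exists_norm_nu_sub_ext_le (T := T) (k := k) hα0 hα1 hq
  have hγ := memLp_caputo hα0 hα1 γ
  obtain ⟨N, hN0, hN⟩ := hγ.ae_norm_le_bound
  refine ⟨C * (2 ^ q * (Q + T * N ^ q)) ^ (1 / q), by positivity,
    fun r b u hr hrb hb hu hI t ht => ?_⟩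
  have huc : MemLp (concat b u (caputo γ)) ⊤ (volume.restrict (Icc r T)) :=
    memLp_concat (memLp_top_Icc_mono hu le_rfl hb)
      (memLp_top_Icc_mono hγ (hr.trans hrb) le_rfl)
  refine (hC γ r b _ hr hrb hb huc (fun s hs => concat_of_lt _ _ hs.1) t ht).trans ?_
  have e1 : ∫ s in r..b, ‖concat b u (caputo γ) s - caputo γ s‖ ^ q =
      ∫ s in r..b, ‖u s - caputo γ s‖ ^ q := by
    refine intervalIntegral.integral_congr fun s hs => ?_
    rw [uIcc_of_le hrb] at hs
    simp only [concat_of_le _ _ hs.2]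
  have h1 := integral_norm_sub_rpow_le hrb hq0.le (memLp_top_Icc_mono hu le_rfl hb)
    (memLp_top_Icc_mono hγ hr hb)
    (ae_restrict_of_ae_restrict_of_subset (Icc_subset_Icc hr hb) hN)
  have h2 := integral_norm_rpow_mono hrb hb hq0.le hu
  have h3 : (b - r) * N ^ q ≤ T * N ^ q :=
    mul_le_mul_of_nonneg_right (by linarith) (by positivity)
  have h4 : ∫ s in r..b, ‖u s - caputo γ s‖ ^ q ≤ 2 ^ q * (Q + T * N ^ q) :=
    h1.trans (mul_le_mul_of_nonneg_left (by linarith) (by positivity))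
  have h5 : 0 ≤ ∫ s in r..b, ‖u s - caputo γ s‖ ^ q :=
    intervalIntegral.integral_nonneg hrb fun s _ => by positivity
  rw [e1, mul_right_comm]
  have h6 : 0 ≤ b - r := by linarith
  gcongr

theorem AC.dist_le {γ γ' : AC α T k} {D : ℝ} (hD : 0 ≤ D)
    (h : ∀ t ∈ Icc 0 T, ‖AC.ext γ t - AC.ext γ' t‖ ≤ D) : dist γ γ' ≤ D := by
  rw [Subtype.dist_eq, ContinuousMap.dist_le hD]
  intro t
  rw [dist_eq_norm, ← AC.ext_apply, ← AC.ext_apply]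
  exact h t t.2

/-- Along the trajectory of a control bounded in `L^q`, modified after the short time `δ` so that
the path stays near `γ` in the sup norm, a ci-smooth functional and the running cost behave to
first order as at the initial point, up to an error `ε (1 + |u|)`, uniformly in the control. -/
theorem Coeffs.Bounds.eventually_increment (hα0 : 0 < α) (hα1 : α < 1) (B : c.Bounds T M L)
    {q : ℝ} (hq : 1 / α < q) {φ Dt : Pt α T e k → ℝ} {Dx : Pt α T e k → E e}
    {Dγ : Pt α T e k → E k} (hφ : IsCiSmooth φ Dt Dx Dγ) (p : Pt α T e k) (hp : (p.1 : ℝ) < T)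
    {W : Set (Pt α T e k)} (hW : W ∈ 𝓝 p) {ε Q : ℝ} (hε : 0 < ε) (hQ : 0 ≤ Q) :
    ∀ᶠ δ in 𝓝[>] (0 : ℝ), ∀ u X, c.Admissible p u X → ∫ s in (p.1 : ℝ)..T, ‖u s‖ ^ q ≤ Q →
      ∃ p' ∈ W, (p'.1 : ℝ) = p.1 + δ ∧ p'.2.1 = X p'.1 ∧
        (∀ s ∈ Icc 0 (p'.1 : ℝ), AC.ext p'.2.2 s = nu p.1 p.2.2 u s) ∧
        (Dt p + inner ℝ (Dx p) (c.field T p.1 p.2.1 (p.2.2.1 p.1))) * δ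
            + (∫ s in (p.1 : ℝ)..p'.1, inner ℝ (Dγ p) (u s))
            - ε * ((1 + M + ‖Dx p‖) * δ + ∫ s in (p.1 : ℝ)..p'.1, ‖u s‖) ≤ φ p' - φ p ∧
        ∀ s ∈ Icc (p.1 : ℝ) p'.1, |c.running T s (X s) (nu p.1 p.2.2 u s) (u s)
          - c.running T p.1 p.2.1 (p.2.2.1 p.1) (u s)| ≤ ε := by
  obtain ⟨t₀, x, γ⟩ := p
  obtain ⟨r, hr⟩ := t₀
  simp only at hp hW ⊢
  have hT0 := hT.out
  have hL := B.L_pos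
  have hM := B.M_nonneg
  set p : Pt α T e k := (⟨r, hr⟩, x, γ) with hpdef
  have hγr : γ.1 ⟨r, hr⟩ = AC.ext γ r := (AC.ext_apply γ ⟨r, hr⟩).symm
  rw [hγr]
  set a := AC.ext γ r with ha
  have hq0 : 0 < q := lt_trans (by positivity) hq
  have hβ0 : 0 < α - 1 / q := by
    have : 1 / q < α := by rw [div_lt_comm₀ hq0 hα0]; exact hq
    linarith
  obtain ⟨A, hA0, hA⟩ := exists_norm_nu_concat_sub_le hα0 hα1 hq γ hQ
  -- a ball on which the derivatives are nearly constant
  have hopen : {q : Pt α T e k | (q.1 : ℝ) < T} ∈ 𝓝 p :=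
    (isOpen_lt (continuous_subtype_val.comp continuous_fst) continuous_const).mem_nhds hp
  have n1 : ∀ᶠ q in 𝓝 p, |Dt q - Dt p| ≤ ε := by
    have := (hφ.continuousOn_t.continuousAt hopen).eventually (Metric.closedBall_mem_nhds _ hε)
    simpa [Real.dist_eq] using this
  have n2 : ∀ᶠ q in 𝓝 p, ‖Dx q - Dx p‖ ≤ ε := by
    have := (hφ.continuousOn_x.continuousAt hopen).eventually (Metric.closedBall_mem_nhds _ hε)
    simpa [dist_eq_norm] using this
  have n3 : ∀ᶠ q in 𝓝 p, ‖Dγ q - Dγ p‖ ≤ ε := by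
    have := (hφ.continuousOn_γ.continuousAt hopen).eventually (Metric.closedBall_mem_nhds _ hε)
    simpa [dist_eq_norm] using this
  obtain ⟨ρ, hρ, hball⟩ := Metric.mem_nhds_iff.1
    (Filter.inter_mem hW (n1.and (n2.and n3)))
  -- moduli of continuity in time
  have hε4 : 0 < ε / 2 := half_pos hε
  have hsm : 0 < ε / (4 * L) := by positivity
  have t1 : ∀ᶠ s in 𝓝[Icc 0 T] r, ‖c.field T s x a - c.field T r x a‖ ≤ ε / 2 := by
    have := (B.continuousOn_field le_rfl (X := fun _ => x) (w := fun _ => a) continuousOn_const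
      continuousOn_const r hr).eventually (Metric.closedBall_mem_nhds _ hε4)
    simpa [dist_eq_norm] using this
  have t2 : ∀ᶠ s in 𝓝[Icc 0 T] r,
      |c.psi x a (c.etaDot T s) - c.psi x a (c.etaDot T r)| ≤ ε / 2 := by
    have := (B.continuousOn_psi le_rfl (X := fun _ => x) (w := fun _ => a) continuousOn_const
      continuousOn_const r hr).eventually (Metric.closedBall_mem_nhds _ hε4)
    simpa [Real.dist_eq] using this
  have t3 : ∀ᶠ s in 𝓝[Icc 0 T] r, ‖AC.ext γ s - a‖ ≤ ε / (4 * L) := by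
    have := ((AC.continuous_ext γ).continuousWithinAt (s := Icc 0 T) (x := r)).eventually
      (Metric.closedBall_mem_nhds _ hsm)
    simpa [dist_eq_norm] using this
  have hmod : Tendsto (fun δ : ℝ => δ + M * δ + A * δ ^ (α - 1 / q)) (𝓝[>] 0) (𝓝 0) := by
    have hc : Continuous fun δ : ℝ => δ + M * δ + A * δ ^ (α - 1 / q) := by
      have : Continuous fun δ : ℝ => δ ^ (α - 1 / q) :=
        continuous_id.rpow_const fun _ => Or.inr hβ0.le
      fun_prop
    have := (hc.tendsto 0).mono_left (nhdsWithin_le_nhds (s := Ioi 0))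
    simpa only [Real.zero_rpow hβ0.ne', mul_zero, add_zero] using this
  filter_upwards [eventually_forall_Icc hr.1 hp (t1.and (t2.and t3)),
    Ioo_mem_nhdsGT (sub_pos.2 hp), hmod.eventually (gt_mem_nhds hρ),
    hmod.eventually (gt_mem_nhds hsm)] with δ hs1 hδ hδρ hδs u X hX hI
  have hδ0 : 0 < δ := hδ.1
  have hb : r + δ ≤ T := by linarith [hδ.2]
  have hrb : r ≤ r + δ := by linarith
  have hu : MemLp u ⊤ (volume.restrict (Icc r T)) := hX.1
  have hXs : c.IsState T r x (nu r γ u) X := hX.2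
  have hwc : ContinuousOn (nu r γ u) (Icc r T) :=
    (continuousOn_nu hα0 hα1 γ hr hu).mono (Icc_subset_Icc_left hr.1)
  have hX0 : X r = x := hXs.apply_start hr.2
  have hXlip : ∀ s t, r ≤ s → s ≤ t → t ≤ r + δ → ‖X t - X s‖ ≤ M * (t - s) :=
    fun s t h1 h2 h3 => B.norm_state_sub_le hr.1 hXs hwc h1 h2 (h3.trans hb)
  -- the path steered back to the derivative of `γ` after time `r + δ`
  have hv : MemLp (concat (r + δ) u (caputo γ)) ⊤ (volume.restrict (Icc r T)) :=
    memLp_concat (memLp_top_Icc_mono hu le_rfl hb)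
      (memLp_top_Icc_mono (memLp_caputo hα0 hα1 γ) (hr.1.trans hrb) le_rfl)
  obtain ⟨ν, hν1, hν2⟩ := exists_nu_path hα0 hα1 γ hr hv
  have hνγ : ∀ t ∈ Icc 0 T, ‖AC.ext ν t - AC.ext γ t‖ ≤ A * δ ^ (α - 1 / q) := fun t ht => by
    have := hA r (r + δ) u hr.1 hrb hb hu hI t ht
    rwa [← hν1 t ht, add_sub_cancel_left] at this
  have hAδ : 0 ≤ A * δ ^ (α - 1 / q) := by positivity
  have hνd := AC.dist_le hAδ hνγ
  have hνu : ∀ s ∈ Icc 0 (r + δ), AC.ext ν s = nu r γ u s := fun s hs => by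
    rw [hν1 s ⟨hs.1, hs.2.trans hb⟩]
    exact nu_congr _ fun y hy => concat_of_le _ _ (hy.2.le.trans hs.2)
  have hMδ : 0 ≤ M * δ := by positivity
  have hXx : ∀ s ∈ Icc r (r + δ), ‖X s - x‖ ≤ M * δ := fun s hs => by
    have := hXlip r s le_rfl hs.1 hs.2
    rw [hX0] at this
    exact this.trans (mul_le_mul_of_nonneg_left (by linarith [hs.2]) hM)
  have hin : ∀ s ∈ Icc r (r + δ), (timeOf T s, X s, ν) ∈ Metric.ball p ρ := fun s hs => by
    have hsT : s ∈ Icc 0 T := ⟨hr.1.trans hs.1, hs.2.trans hb⟩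
    rw [Metric.mem_ball, hpdef, Prod.dist_eq, Prod.dist_eq]
    refine max_lt ?_ (max_lt ?_ ?_)
    · rw [Subtype.dist_eq, timeOf_coe hsT, Real.dist_eq, abs_of_nonneg (by linarith [hs.1])]
      linarith [hs.2]
    · rw [dist_eq_norm]
      simp only
      linarith [hXx s hs]
    · simp only
      linarith
  have hend := hball (hin (r + δ) ⟨hrb, le_rfl⟩)
  have hbT : r + δ ∈ Icc 0 T := ⟨hr.1.trans hrb, hb⟩
  refine ⟨(timeOf T (r + δ), X (r + δ), ν), hend.1, timeOf_coe hbT, ?_, ?_, ?_, ?_⟩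
  · simp only [timeOf_coe hbT]
  · simp only [timeOf_coe hbT]
    exact hνu
  · simp only [timeOf_coe hbT]
    have hch := hφ.le_increment hα0 hα1 (ε := ε) (τ := Dt p) (ξ := Dx p) (ζ := Dγ p) hr.1 hrb hb
      hM ν hXlip
      (fun s hs => (hball (hin s (Ico_subset_Icc_self hs))).2.1)
      (fun s hs => (hball (hin s (Ico_subset_Icc_self hs))).2.2.1)
      (fun s hs => (hball (hin s (Ico_subset_Icc_self hs))).2.2.2)
    have hae : ∀ᵐ s ∂volume.restrict (Ioo r (r + δ)), caputo ν s = u s := by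
      filter_upwards [ae_restrict_of_ae_restrict_of_subset
        (Ioo_subset_Icc_self.trans (Icc_subset_Icc hr.1 hb)) hν2,
        ae_restrict_mem measurableSet_Ioo] with s h1 h2
      rw [h1, concat_of_lt _ _ h2.1, concat_of_le _ _ h2.2.le]
    have i1 : ∫ s in r..r + δ, caputo ν s = ∫ s in r..r + δ, u s := by
      rw [intervalIntegral_eq_integral_Ioo hrb, intervalIntegral_eq_integral_Ioo hrb]
      exact integral_congr_ae hae
    have i2 : ∫ s in r..r + δ, ‖caputo ν s‖ = ∫ s in r..r + δ, ‖u s‖ := by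
      rw [intervalIntegral_eq_integral_Ioo hrb, intervalIntegral_eq_integral_Ioo hrb]
      refine integral_congr_ae ?_
      filter_upwards [hae] with s hs
      rw [hs]
    have hui := intervalIntegrable_of_memLp_top hrb (memLp_top_Icc_mono hu le_rfl hb)
    have i3 : ∫ s in r..r + δ, inner ℝ (Dγ p) (u s) = inner ℝ (Dγ p) (∫ s in r..r + δ, u s) :=
      (innerSL ℝ (Dγ p)).intervalIntegral_comp_comm hui
    have hφ0 : φ (timeOf T r, X r, ν) = φ p := by
      have ht : timeOf T r = ⟨r, hr⟩ := Subtype.ext (timeOf_coe hr)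
      rw [hX0, ht]
      refine hφ.apply_eq hα0 hα1 p hp ν fun s hs => ?_
      have hs' : (s : ℝ) ≤ r := hs
      have := hνu s ⟨s.2.1, hs'.trans hrb⟩
      rw [nu_of_le γ u hs', AC.ext_apply, AC.ext_apply] at this
      exact this
    have hF : ‖X (r + δ) - X r - δ • c.field T r x a‖ ≤ ε * δ := by
      have hfc := (B.continuousOn_field hr.1 hXs.1 hwc).mono (Icc_subset_Icc_right hb)
      have e1 : X (r + δ) - X r - δ • c.field T r x a =
          ∫ s in r..r + δ, (c.field T s (X s) (nu r γ u s) - c.field T r x a) := by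
        rw [intervalIntegral.integral_sub (hfc.intervalIntegrable_of_Icc hrb) (by simp),
          B.state_sub_eq hr.1 hXs hwc le_rfl hrb hb]
        simp
      rw [e1]
      have := intervalIntegral.norm_integral_le_of_norm_le_const (a := r) (b := r + δ) (C := ε)
        (f := fun s => c.field T s (X s) (nu r γ u s) - c.field T r x a) fun s hs => by
          rw [uIoc_of_le hrb] at hs
          have hs' : s ∈ Icc r (r + δ) := ⟨hs.1.le, hs.2⟩
          have hsT : s ∈ Icc 0 T := ⟨hr.1.trans hs.1.le, hs.2.trans hb⟩
          have h1 := B.field_lip s hsT (X s) x (nu r γ u s) a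
          have h2 : ‖nu r γ u s - a‖ ≤ A * δ ^ (α - 1 / q) + ε / (4 * L) := by
            rw [← hνu s ⟨hsT.1, hs.2⟩]
            have := norm_sub_le_norm_sub_add_norm_sub (AC.ext ν s) (AC.ext γ s) a
            linarith [hνγ s hsT, (hs1 s hs').2.2]
          have h3 : L * (‖X s - x‖ + ‖nu r γ u s - a‖) ≤ ε / 2 := by
            calc _ ≤ L * (ε / (4 * L) + ε / (4 * L)) := by
                  refine mul_le_mul_of_nonneg_left ?_ hL.le
                  linarith [hXx s hs']
              _ = ε / 2 := by field_simp; ring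
          have h4 := norm_sub_le_norm_sub_add_norm_sub (c.field T s (X s) (nu r γ u s))
            (c.field T s x a) (c.field T r x a)
          linarith [(hs1 s hs').1]
      rwa [add_sub_cancel_left, abs_of_pos hδ0] at this
    have hin2 : inner ℝ (Dx p) (c.field T r x a) * δ - ‖Dx p‖ * (ε * δ) ≤
        inner ℝ (Dx p) (X (r + δ) - X r) := by
      have h1 := abs_real_inner_le_norm (Dx p) (X (r + δ) - X r - δ • c.field T r x a)
      have h2 := mul_le_mul_of_nonneg_left hF (norm_nonneg (Dx p))
      rw [inner_sub_right, inner_smul_right] at h1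
      linarith [(abs_le.1 h1).1]
    rw [i1, i2, hφ0, ← i3] at hch
    simp only [add_sub_cancel_left] at hch
    linarith
  · simp only [timeOf_coe hbT]
    intro s hs
    have hsT : s ∈ Icc 0 T := ⟨hr.1.trans hs.1, hs.2.trans hb⟩
    have h1 := B.running_lip s hsT (X s) x (nu r γ u s) a (u s)
    have h2 : ‖nu r γ u s - a‖ ≤ A * δ ^ (α - 1 / q) + ε / (4 * L) := by
      rw [← hνu s ⟨hsT.1, hs.2⟩]
      have := norm_sub_le_norm_sub_add_norm_sub (AC.ext ν s) (AC.ext γ s) a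
      linarith [hνγ s hsT, (hs1 s hs).2.2]
    have h3 : L * (‖X s - x‖ + ‖nu r γ u s - a‖) ≤ ε / 2 := by
      calc _ ≤ L * (ε / (4 * L) + ε / (4 * L)) := by
            refine mul_le_mul_of_nonneg_left ?_ hL.le
            linarith [hXx s hs]
        _ = ε / 2 := by field_simp; ring
    have h4 := abs_sub_le (c.running T s (X s) (nu r γ u s) (u s)) (c.running T s x a (u s))
      (c.running T r x a (u s))
    have h5 : c.running T s x a (u s) - c.running T r x a (u s) =
        c.psi x a (c.etaDot T s) - c.psi x a (c.etaDot T r) := by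
      simp only [Coeffs.running]; ring
    rw [h5] at h4
    linarith [(hs1 s hs).2.1]

end ShortTime

/-! ### The Hamiltonian and the viscosity inequalities -/

section Viscosity

variable {e k d : ℕ} {c : Coeffs e k d}

theorem Coeffs.isLUB_hamiltonian {q f₀ C₀ : ℝ} (hq : 1 < q) (hf₀ : 0 < f₀)
    (hf : ∀ x a u, f₀ * ‖u‖ ^ q - C₀ ≤ c.f x a u) (x : E e) (a φ : E k) :
    IsLUB (Set.range fun u : E k => -(inner ℝ φ u) - c.f x a u) (c.hamiltonian x a φ) := by
  obtain ⟨A, -, hA⟩ := exists_mul_le_rpow_add hq hf₀ (norm_nonneg φ)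
  refine isLUB_ciSup ⟨A + C₀, ?_⟩
  rintro _ ⟨u, rfl⟩
  have h1 := neg_le_of_abs_le (abs_real_inner_le_norm φ u)
  have h2 := hA ‖u‖ (norm_nonneg u)
  have h3 := hf x a u
  simp only
  linarith

/-- By coercivity an extra term `-ε |u|` changes the Hamiltonian only by `O(ε)`. -/
theorem Coeffs.exists_neg_hamiltonian_sub_le {q f₀ C₀ : ℝ} (hq : 1 < q) (hf₀ : 0 < f₀)
    (hf : ∀ x a u, f₀ * ‖u‖ ^ q - C₀ ≤ c.f x a u) (x : E e) (a φ : E k) :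
    ∃ R : ℝ, 0 ≤ R ∧ ∀ ε : ℝ, 0 ≤ ε → ε ≤ 1 → ∀ u : E k,
      -c.hamiltonian x a φ - ε * R ≤ inner ℝ φ u + c.f x a u - ε * ‖u‖ := by
  obtain ⟨A, hA0, hA⟩ := exists_mul_le_rpow_add (b := ‖φ‖ + 2) hq hf₀ (by positivity)
  set H := c.hamiltonian x a φ with hH
  refine ⟨max 0 (A + C₀ - H), le_max_left _ _, fun ε h0 h1 u => ?_⟩
  have hu := norm_nonneg u
  rcases le_total ‖u‖ (max 0 (A + C₀ - H)) with h | h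
  · have h2 := (Coeffs.isLUB_hamiltonian hq hf₀ hf x a φ).1 ⟨u, rfl⟩
    simp only at h2
    have h3 := mul_le_mul_of_nonneg_left h h0
    linarith
  · have h2 := neg_le_of_abs_le (abs_real_inner_le_norm φ u)
    have h3 := hA ‖u‖ hu
    have h4 := hf x a u
    have h5 : A + C₀ - H ≤ ‖u‖ := (le_max_right _ _).trans h
    have h6 : ε * ‖u‖ ≤ ‖u‖ := mul_le_of_le_one_left hu h1
    have h7 : 0 ≤ ε * max 0 (A + C₀ - H) := mul_nonneg h0 (le_max_left _ _)
    linarith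

theorem nonneg_of_forall_nonneg_add_mul {y C : ℝ}
    (h : ∀ ε : ℝ, 0 < ε → ε ≤ 1 → 0 ≤ y + ε * C) : 0 ≤ y := by
  have ht : Tendsto (fun ε : ℝ => y + ε * C) (𝓝[>] 0) (𝓝 y) := by
    have hc : Continuous fun ε : ℝ => y + ε * C := by fun_prop
    have := (hc.tendsto 0).mono_left (nhdsWithin_le_nhds (s := Ioi 0))
    simpa using this
  refine ge_of_tendsto ht ?_
  filter_upwards [Ioc_mem_nhdsGT (zero_lt_one' ℝ)] with ε hε using h ε hε.1 hε.2

variable {α T : ℝ} [hT : Fact (0 < T)] {M L : ℝ}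

theorem Coeffs.Bounds.supersolution_test (hα0 : 0 < α) (hα1 : α < 1) (B : c.Bounds T M L)
    {q f₀ C₀ : ℝ} (hq : 1 / α < q) (hf₀ : 0 < f₀) (hC₀ : 0 < C₀)
    (hf : ∀ x a u, f₀ * ‖u‖ ^ q - C₀ ≤ c.f x a u)
    {φ Dt : Pt α T e k → ℝ} {Dx : Pt α T e k → E e}
    {Dγ : Pt α T e k → E k} (hφ : IsCiSmooth φ Dt Dx Dγ) (p : Pt α T e k) (hp : (p.1 : ℝ) < T)
    (hmin : IsLocalMin (fun q => c.value q - φ q) p) :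
    0 ≤ c.hjb p (Dt p) (Dx p) (Dγ p) := by
  have hM := B.M_nonneg
  have hq1 : 1 < q := lt_trans (by rw [lt_div_iff₀ hα0]; linarith) hq
  have hglb := fun p => B.isGLB_costSet (T := T) hα0 hα1 hq hf₀ hC₀ hf p
  obtain ⟨A, hA0, hA⟩ := B.exists_le_cost (T := T) hα0 hα1 hq hf₀ hC₀ hf
  set a := p.2.2.1 p.1 with ha
  obtain ⟨R, hR0, hR⟩ := Coeffs.exists_neg_hamiltonian_sub_le hq1 hf₀ hf p.2.1 a (Dγ p)
  -- an `L^q` bound for all controls that are optimal up to an error of at most `1`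
  set Q := 2 / f₀ * (|c.value p| + 1 + A * (1 + ‖p.2.1‖ + ‖p.2.2.1‖)) with hQ
  have hQ0 : 0 ≤ Q := by positivity
  refine nonneg_of_forall_nonneg_add_mul (C := R + 1 + M + ‖Dx p‖ + 1 + 1) fun ε hε hε1 => ?_
  have hev := B.eventually_increment hα0 hα1 hq hφ p hp hmin hε hQ0
  have hsmall : ∀ᶠ δ in 𝓝[>] (0 : ℝ), δ ∈ Ioc 0 ε := Ioc_mem_nhdsGT hε
  obtain ⟨δ, hδ, hδε⟩ := (hev.and hsmall).exists
  have hδ0 : 0 < δ := hδε.1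
  have hδ1 : δ ≤ 1 := hδε.2.trans hε1
  obtain ⟨u, X, hX, hcost⟩ := Coeffs.exists_cost_lt (hglb p) (η := δ ^ 2) (by positivity)
  have hδ2 : δ ^ 2 ≤ 1 := pow_le_one₀ hδ0.le hδ1
  have hI : ∫ s in (p.1 : ℝ)..T, ‖u s‖ ^ q ≤ Q := by
    have h1 := hA p.1 p.2.1 p.2.2 u X p.1.2 hX.1 hX.2
    have h2 := le_abs_self (c.value p)
    rw [hQ, div_mul_eq_mul_div, le_div_iff₀ hf₀]
    linarith
  obtain ⟨p', hp'W, hp't, hp'x, hp'γ, hinc, hrun⟩ := hδ u X hX hI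
  have hpp : (p.1 : ℝ) ≤ p'.1 := by rw [hp't]; linarith
  have hdpp := B.value_le_cost_sub hα0 hα1 hpp (hglb p') hX (D := 0)
    (fun s hs => by rw [hp'γ s hs, sub_self, norm_zero])
  rw [hp'x, sub_self, norm_zero, add_zero, mul_zero, add_zero] at hdpp
  have hW : c.value p - φ p ≤ c.value p' - φ p' := hp'W
  have hu := memLp_top_Icc_mono hX.1 le_rfl p'.1.2.2
  have hwc := (continuousOn_nu hα0 hα1 p.2.2 p.1.2 hX.1).mono (Icc_subset_Icc_left p.1.2.1)
  have i1 := intervalIntegrable_of_memLp_top hpp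
    (memLp_top_Icc_mono (B.memLp_running p.1.2.1 hX.2.1 hwc hX.1) le_rfl p'.1.2.2)
  have iu := intervalIntegrable_of_memLp_top hpp hu
  have i2 : IntervalIntegrable (fun s => inner ℝ (Dγ p) (u s)) volume p.1 p'.1 := by
    rw [intervalIntegrable_iff] at iu ⊢
    exact iu.const_inner _
  have i3 : IntervalIntegrable (fun s => ε * ‖u s‖) volume p.1 p'.1 := iu.norm.const_mul ε
  set m := -c.hamiltonian p.2.1 a (Dγ p) - ε * R + c.psi p.2.1 a (c.etaDot T p.1) - ε with hm
  have hlow : m * δ ≤ (∫ s in (p.1 : ℝ)..p'.1, c.running T s (X s) (nu p.1 p.2.2 u s) (u s)) +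
      (∫ s in (p.1 : ℝ)..p'.1, inner ℝ (Dγ p) (u s)) - ε * ∫ s in (p.1 : ℝ)..p'.1, ‖u s‖ := by
    rw [← intervalIntegral.integral_const_mul, ← intervalIntegral.integral_add i1 i2,
      ← intervalIntegral.integral_sub (i1.add i2) i3]
    have e1 : m * δ = ∫ s in (p.1 : ℝ)..p'.1, m := by
      rw [intervalIntegral.integral_const, hp't, smul_eq_mul]; ring
    rw [e1]
    refine intervalIntegral.integral_mono_on hpp (by simp) ((i1.add i2).sub i3) fun s hs => ?_
    have h1 := (abs_le.1 (hrun s hs)).1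
    have h2 := hR ε hε.le hε1 (u s)
    simp only [Coeffs.running] at h1
    simp only [Coeffs.running]
    linarith
  have hfin : (Dt p + inner ℝ (Dx p) (c.field T p.1 p.2.1 a) + m
      - ε * (1 + M + ‖Dx p‖)) * δ ≤ δ * δ := by
    have e : δ ^ 2 = δ * δ := sq δ
    linarith
  have hfin' := le_of_mul_le_mul_right hfin hδ0
  have hδε' := hδε.2
  have e : c.hjb p (Dt p) (Dx p) (Dγ p) = -Dt p - inner ℝ (Dx p) (c.field T p.1 p.2.1 a)
      + c.hamiltonian p.2.1 a (Dγ p) - c.psi p.2.1 a (c.etaDot T p.1) := rfl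
  rw [e]
  linarith

theorem Coeffs.Bounds.subsolution_test (hα0 : 0 < α) (hα1 : α < 1) (B : c.Bounds T M L)
    {q f₀ C₀ : ℝ} (hq : 1 / α < q) (hf₀ : 0 < f₀) (hC₀ : 0 < C₀)
    (hf : ∀ x a u, f₀ * ‖u‖ ^ q - C₀ ≤ c.f x a u)
    {φ Dt : Pt α T e k → ℝ} {Dx : Pt α T e k → E e}
    {Dγ : Pt α T e k → E k} (hφ : IsCiSmooth φ Dt Dx Dγ) (p : Pt α T e k) (hp : (p.1 : ℝ) < T)
    (hmax : IsLocalMax (fun q => c.value q - φ q) p) :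
    c.hjb p (Dt p) (Dx p) (Dγ p) ≤ 0 := by
  have hq1 : 1 < q := lt_trans (by rw [lt_div_iff₀ hα0]; linarith) hq
  have hglb := fun p => B.isGLB_costSet (T := T) hα0 hα1 hq hf₀ hC₀ hf p
  set a := p.2.2.1 p.1 with ha
  -- it suffices to test every constant control
  suffices hu : ∀ u₀ : E k, -(inner ℝ (Dγ p) u₀) - c.f p.2.1 a u₀ ≤
      Dt p + inner ℝ (Dx p) (c.field T p.1 p.2.1 a) + c.psi p.2.1 a (c.etaDot T p.1) by
    have h1 : c.hamiltonian p.2.1 a (Dγ p) ≤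
        Dt p + inner ℝ (Dx p) (c.field T p.1 p.2.1 a) + c.psi p.2.1 a (c.etaDot T p.1) := by
      refine (Coeffs.isLUB_hamiltonian hq1 hf₀ hf p.2.1 a (Dγ p)).2 ?_
      rintro _ ⟨u₀, rfl⟩
      exact hu u₀
    have e : c.hjb p (Dt p) (Dx p) (Dγ p) = -Dt p - inner ℝ (Dx p) (c.field T p.1 p.2.1 a)
        + c.hamiltonian p.2.1 a (Dγ p) - c.psi p.2.1 a (c.etaDot T p.1) := rfl
    rw [e]
    linarith
  intro u₀
  rw [← sub_nonneg]
  have hu : MemLp (fun _ : ℝ => u₀) ⊤ (volume.restrict (Icc (p.1 : ℝ) T)) := memLp_top_const u₀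
  obtain ⟨X, hX⟩ := B.exists_admissible hα0 hα1 p hu
  have hQ0 : 0 ≤ ∫ _s in (p.1 : ℝ)..T, ‖u₀‖ ^ q :=
    intervalIntegral.integral_nonneg p.1.2.2 fun s _ => by positivity
  refine nonneg_of_forall_nonneg_add_mul (C := 1 + (1 + M + ‖Dx p‖) + ‖u₀‖) fun ε hε _ => ?_
  have hev := B.eventually_increment hα0 hα1 hq hφ.neg p hp hmax hε hQ0
  have hsmall : ∀ᶠ δ in 𝓝[>] (0 : ℝ), 0 < δ := self_mem_nhdsWithin
  obtain ⟨δ, hδ, hδ0⟩ := (hev.and hsmall).exists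
  obtain ⟨p', hp'W, hp't, hp'x, hp'γ, hinc, hrun⟩ := hδ _ X hX le_rfl
  have hpp : (p.1 : ℝ) ≤ p'.1 := by rw [hp't]; linarith
  have hdpp := B.value_le_integral_add hα0 hα1 hpp (hglb p) (hglb p') hX (D := 0)
    (fun s hs => by rw [hp'γ s hs, sub_self, norm_zero])
  rw [hp'x, sub_self, norm_zero, add_zero, mul_zero, add_zero] at hdpp
  have hW : c.value p' - φ p' ≤ c.value p - φ p := hp'W
  have hwc := (continuousOn_nu hα0 hα1 p.2.2 p.1.2 hX.1).mono (Icc_subset_Icc_left p.1.2.1)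
  have i1 := intervalIntegrable_of_memLp_top hpp
    (memLp_top_Icc_mono (B.memLp_running p.1.2.1 hX.2.1 hwc hX.1) le_rfl p'.1.2.2)
  have hup : ∫ s in (p.1 : ℝ)..p'.1, c.running T s (X s) (nu p.1 p.2.2 (fun _ => u₀) s) u₀ ≤
      (c.running T p.1 p.2.1 a u₀ + ε) * δ := by
    have e1 : (c.running T p.1 p.2.1 a u₀ + ε) * δ =
        ∫ _s in (p.1 : ℝ)..p'.1, (c.running T p.1 p.2.1 a u₀ + ε) := by
      rw [intervalIntegral.integral_const, hp't, smul_eq_mul]; ring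
    rw [e1]
    refine intervalIntegral.integral_mono_on hpp i1 (by simp) fun s hs => ?_
    linarith [(abs_le.1 (hrun s hs)).2]
  simp only [intervalIntegral.integral_const, smul_eq_mul, inner_neg_left, norm_neg, hp't,
    add_sub_cancel_left] at hinc
  have hfin : 0 * δ ≤ (Dt p + inner ℝ (Dx p) (c.field T p.1 p.2.1 a) + inner ℝ (Dγ p) u₀
      + c.running T p.1 p.2.1 a u₀ + ε * (1 + (1 + M + ‖Dx p‖) + ‖u₀‖)) * δ := by
    linarith
  have hfin' := le_of_mul_le_mul_right hfin hδ0
  simp only [Coeffs.running] at hfin'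
  linarith

end Viscosity

/-! ### Continuity of the value functional -/

section Continuity

variable {α T : ℝ} [hT : Fact (0 < T)] {e k d : ℕ} {c : Coeffs e k d} {M L : ℝ}

theorem abs_time_sub_le_dist (p p₀ : Pt α T e k) : |(p.1 : ℝ) - p₀.1| ≤ dist p p₀ :=
  le_max_left _ _

theorem norm_state_sub_le_dist (p p₀ : Pt α T e k) : ‖p.2.1 - p₀.2.1‖ ≤ dist p p₀ := by
  rw [← dist_eq_norm]
  exact (le_max_left _ _).trans (le_max_right _ _)

theorem norm_ext_sub_le_dist (p p₀ : Pt α T e k) (s : ℝ) :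
    ‖AC.ext p.2.2 s - AC.ext p₀.2.2 s‖ ≤ dist p p₀ :=
  (AC.norm_ext_sub_le _ _ s).trans ((le_max_right _ _).trans (le_max_right _ _))

theorem eventually_dist_lt {X : Type*} [PseudoMetricSpace X] (p₀ : X) {ρ : ℝ} (hρ : 0 < ρ) :
    ∀ᶠ p in 𝓝 p₀, dist p p₀ < ρ := Metric.ball_mem_nhds p₀ hρ

theorem eventually_mul_dist_add_lt {X : Type*} [PseudoMetricSpace X] (p₀ : X) (a b : ℝ) {β ρ : ℝ}
    (hβ : 0 < β) (hρ : 0 < ρ) : ∀ᶠ p in 𝓝 p₀, a * dist p p₀ + b * dist p p₀ ^ β < ρ := by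
  have hc : Continuous fun p => a * dist p p₀ + b * dist p p₀ ^ β := by
    have h1 : Continuous fun p => dist p p₀ := continuous_id.dist continuous_const
    exact (h1.const_mul a).add ((h1.rpow_const fun _ => Or.inr hβ.le).const_mul b)
  have := hc.tendsto p₀
  rw [dist_self, Real.zero_rpow hβ.ne', mul_zero, mul_zero, add_zero] at this
  exact this.eventually (gt_mem_nhds hρ)

theorem abs_integral_le_of_ae_bound {a b a' b' C : ℝ} {F : ℝ → ℝ} (ha : a' ≤ a) (hab : a ≤ b)
    (hb : b ≤ b') (hF : ∀ᵐ s ∂volume.restrict (Icc a' b'), ‖F s‖ ≤ C) :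
    |∫ s in a..b, F s| ≤ C * (b - a) := by
  have h := intervalIntegral.norm_integral_le_of_norm_le_const_ae (a := a) (b := b) (C := C)
    (f := F) (by
      rw [uIoc_of_le hab]
      filter_upwards [(ae_restrict_iff' measurableSet_Icc).1 hF] with s hs hm
      exact hs ⟨ha.trans hm.1.le, hm.2.trans hb⟩)
  rwa [abs_of_nonneg (sub_nonneg.2 hab)] at h

theorem stabConst_nonneg (B : c.Bounds T M L) : 0 ≤ stabConst L T := by
  have := hT.out
  have := B.L_pos
  rw [stabConst]
  positivity

theorem Coeffs.Bounds.norm_state_sub_start_le (hα0 : 0 < α) (hα1 : α < 1) (B : c.Bounds T M L)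
    {p : Pt α T e k} {u : ℝ → E k} {X : ℝ → E e} (hX : c.Admissible p u X) {t : ℝ}
    (ht : (p.1 : ℝ) ≤ t) (htT : t ≤ T) : ‖X t - p.2.1‖ ≤ M * (t - p.1) := by
  have hwc := (continuousOn_nu hα0 hα1 p.2.2 p.1.2 hX.1).mono (Icc_subset_Icc_left p.1.2.1)
  have := B.norm_state_sub_le p.1.2.1 hX.2 hwc le_rfl ht htT
  rwa [hX.2.apply_start p.1.2.2] at this

theorem Coeffs.Bounds.memLp_running_of_admissible (hα0 : 0 < α) (hα1 : α < 1)
    (B : c.Bounds T M L) {p : Pt α T e k} {u : ℝ → E k} {X : ℝ → E e}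
    (hX : c.Admissible p u X) :
    MemLp (fun s => c.running T s (X s) (nu p.1 p.2.2 u s) (u s)) ⊤
      (volume.restrict (Icc (p.1 : ℝ) T)) :=
  B.memLp_running p.1.2.1 hX.2.1
    ((continuousOn_nu hα0 hα1 p.2.2 p.1.2 hX.1).mono (Icc_subset_Icc_left p.1.2.1)) hX.1

/-- For data with a later initial time, restrict a nearly optimal control for `p₀`. -/
theorem Coeffs.Bounds.eventually_value_le_of_le (hα0 : 0 < α) (hα1 : α < 1)
    (B : c.Bounds T M L) (hglb : ∀ p : Pt α T e k, IsGLB (c.costSet p) (c.value p))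
    (p₀ : Pt α T e k) {η : ℝ} (hη : 0 < η) :
    ∀ᶠ p in 𝓝 p₀, (p₀.1 : ℝ) ≤ p.1 → c.value p ≤ c.value p₀ + η := by
  have hM := B.M_nonneg
  have hK := stabConst_nonneg B
  set K := stabConst L T
  obtain ⟨u, X, hX, hcost⟩ := Coeffs.exists_cost_lt (hglb p₀) (half_pos hη)
  obtain ⟨C, hC0, hC⟩ := (B.memLp_running_of_admissible hα0 hα1 hX).ae_norm_le_bound
  set κ := η / (4 * (K + 1)) with hκ
  have hκ0 : 0 < κ := by positivity
  have hKκ : K * κ ≤ η / 4 := by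
    rw [hκ, mul_div_assoc', div_le_div_iff₀ (by positivity) (by norm_num)]
    nlinarith
  have hm : ∀ᶠ s in 𝓝[Icc 0 T] (p₀.1 : ℝ),
      ‖AC.ext p₀.2.2 s - nu p₀.1 p₀.2.2 u s‖ ≤ κ := by
    have hc : ContinuousOn (fun s => AC.ext p₀.2.2 s - nu p₀.1 p₀.2.2 u s) (Icc 0 T) :=
      (AC.continuous_ext _).continuousOn.sub (continuousOn_nu hα0 hα1 p₀.2.2 p₀.1.2 hX.1)
    have h := (hc p₀.1 p₀.1.2).eventually (Metric.closedBall_mem_nhds _ hκ0)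
    simpa [dist_eq_norm, nu_of_le] using h
  obtain ⟨ρ, hρ, hball⟩ := Metric.mem_nhdsWithin_iff.1 hm
  filter_upwards [eventually_dist_lt p₀ hρ, eventually_mul_dist_add_lt p₀ (C + K * (M + 2)) 0
    one_pos (by positivity : 0 < η / 4)] with p h1 h2 hpp
  set δ := dist p p₀ with hδ
  have hδ0 : 0 ≤ δ := dist_nonneg
  have ht := abs_time_sub_le_dist p p₀
  rw [abs_of_nonneg (sub_nonneg.2 hpp)] at ht
  have hD : ∀ s ∈ Icc 0 (p.1 : ℝ), ‖AC.ext p.2.2 s - nu p₀.1 p₀.2.2 u s‖ ≤ δ + κ := by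
    intro s hs
    have h3 := norm_sub_le_norm_sub_add_norm_sub (AC.ext p.2.2 s) (AC.ext p₀.2.2 s)
      (nu p₀.1 p₀.2.2 u s)
    have h4 := norm_ext_sub_le_dist p p₀ s
    have h5 : ‖AC.ext p₀.2.2 s - nu p₀.1 p₀.2.2 u s‖ ≤ κ := by
      rcases le_or_gt s p₀.1 with h | h
      · rw [nu_of_le _ _ h, sub_self, norm_zero]; exact hκ0.le
      · refine hball ⟨?_, hs.1, hs.2.trans p.1.2.2⟩
        rw [Metric.mem_ball, Real.dist_eq, abs_of_pos (sub_pos.2 h)]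
        linarith [hs.2]
    linarith
  have hv := B.value_le_cost_sub hα0 hα1 hpp (hglb p) hX hD
  have h3 := abs_integral_le_of_ae_bound le_rfl hpp p.1.2.2 hC
  have h4 := mul_le_mul_of_nonneg_left ht hC0
  have h5 : ‖X p.1 - p.2.1‖ ≤ M * δ + δ := by
    have e1 := norm_sub_le_norm_sub_add_norm_sub (X p.1) p₀.2.1 p.2.1
    have e2 := B.norm_state_sub_start_le hα0 hα1 hX hpp p.1.2.2
    have e3 := norm_state_sub_le_dist p p₀
    rw [norm_sub_rev] at e3
    linarith [mul_le_mul_of_nonneg_left ht hM]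
  have h6 : K * (‖X p.1 - p.2.1‖ + (δ + κ)) ≤ K * (M * δ + δ + (δ + κ)) :=
    mul_le_mul_of_nonneg_left (by linarith) hK
  linarith [(abs_le.1 h3).1]

/-- For data with an earlier initial time, follow the derivative of the limit path `γ₀` up to the
time of `p₀`. -/
theorem Coeffs.Bounds.eventually_value_le_of_ge (hα0 : 0 < α) (hα1 : α < 1)
    (B : c.Bounds T M L) (hglb : ∀ p : Pt α T e k, IsGLB (c.costSet p) (c.value p))
    (p₀ : Pt α T e k) {η : ℝ} (hη : 0 < η) :
    ∀ᶠ p in 𝓝 p₀, (p.1 : ℝ) ≤ p₀.1 → c.value p ≤ c.value p₀ + η := by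
  have hM := B.M_nonneg
  have hL := B.L_pos
  have hT0 := hT.out
  have hK := stabConst_nonneg B
  set K := stabConst L T
  have hγ₀ := memLp_caputo hα0 hα1 p₀.2.2
  obtain ⟨C, hC0, hC⟩ := (B.memLp_running le_rfl (X := fun _ => p₀.2.1) (w := fun _ => 0)
    continuousOn_const continuousOn_const hγ₀).ae_norm_le_bound
  set C' := C + L * (M * T + ‖p₀.2.2.1‖ + 4) with hC'
  have hC'0 : 0 ≤ C' := by have := norm_nonneg p₀.2.2.1; positivity
  filter_upwards [eventually_dist_lt p₀ one_pos, eventually_mul_dist_add_lt p₀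
    (C' + K * (M + 4)) 0 one_pos hη] with p h1 h2 hpp
  set δ := dist p p₀ with hδ
  have hδ0 : 0 ≤ δ := dist_nonneg
  have ht := abs_time_sub_le_dist p p₀
  rw [abs_of_nonpos (sub_nonpos.2 hpp), neg_sub] at ht
  have hu := memLp_top_Icc_mono hγ₀ p.1.2.1 le_rfl
  obtain ⟨X, hX⟩ := B.exists_admissible hα0 hα1 p hu
  have hnu : ∀ t ∈ Icc 0 T,
      ‖AC.ext p₀.2.2 t - nu p.1 p.2.2 (caputo p₀.2.2) t‖ ≤ 3 * δ := fun t htT => by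
    have := norm_nu_sub_nu_le hα0 hα1 p.2.2 p₀.2.2 p.1.2 p.1.2 le_rfl hu (fun _ _ => rfl)
      (D := δ) (fun s hs => by
        rw [nu_of_le _ _ hs.2, norm_sub_rev]; exact norm_ext_sub_le_dist p p₀ s) htT
    rwa [nu_caputo hα0 hα1 p₀.2.2 p.1.2 htT] at this
  have hv := B.value_le_integral_add hα0 hα1 hpp (hglb p) (hglb p₀) hX (D := 3 * δ)
    (fun s hs => hnu s ⟨hs.1, hs.2.trans p₀.1.2.2⟩)
  have e3 := norm_state_sub_le_dist p p₀
  have hXx : ∀ t, (p.1 : ℝ) ≤ t → t ≤ T → ‖X t - p₀.2.1‖ ≤ M * (t - p.1) + δ :=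
    fun t h3 h4 => by
      have e1 := norm_sub_le_norm_sub_add_norm_sub (X t) p.2.1 p₀.2.1
      have e2 := B.norm_state_sub_start_le hα0 hα1 hX h3 h4
      linarith
  have hrun : ∀ᵐ s ∂volume.restrict (Icc (p.1 : ℝ) p₀.1),
      ‖c.running T s (X s) (nu p.1 p.2.2 (caputo p₀.2.2) s) (caputo p₀.2.2 s)‖ ≤ C' := by
    filter_upwards [ae_restrict_of_ae_restrict_of_subset (Icc_subset_Icc p.1.2.1 p₀.1.2.2) hC,
      ae_restrict_mem measurableSet_Icc] with s hs hm
    have hsT : s ∈ Icc 0 T := ⟨p.1.2.1.trans hm.1, hm.2.trans p₀.1.2.2⟩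
    have b1 := B.running_lip s hsT (X s) p₀.2.1 (nu p.1 p.2.2 (caputo p₀.2.2) s) 0
      (caputo p₀.2.2 s)
    rw [sub_zero] at b1
    have b2 := hXx s hm.1 hsT.2
    have b3 : M * (s - p.1) ≤ M * T := mul_le_mul_of_nonneg_left (by linarith [p.1.2.1, hsT.2]) hM
    have b4 := norm_sub_norm_le (nu p.1 p.2.2 (caputo p₀.2.2) s) (AC.ext p₀.2.2 s)
    rw [norm_sub_rev] at b4
    have b5 := hnu s hsT
    have b6 := AC.norm_ext_le p₀.2.2 s
    have b7 : L * (‖X s - p₀.2.1‖ + ‖nu p.1 p.2.2 (caputo p₀.2.2) s‖) ≤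
        L * (M * T + ‖p₀.2.2.1‖ + 4) := mul_le_mul_of_nonneg_left (by linarith) hL.le
    rw [Real.norm_eq_abs] at hs ⊢
    have b8 := abs_sub_abs_le_abs_sub
      (c.running T s (X s) (nu p.1 p.2.2 (caputo p₀.2.2) s) (caputo p₀.2.2 s))
      (c.running T s p₀.2.1 0 (caputo p₀.2.2 s))
    linarith
  have h3 := abs_integral_le_of_ae_bound le_rfl hpp le_rfl hrun
  have h4 := mul_le_mul_of_nonneg_left ht hC'0
  have h5 := hXx p₀.1 hpp p₀.1.2.2
  have h6 := mul_le_mul_of_nonneg_left ht hM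
  have h7 : K * (‖X p₀.1 - p₀.2.1‖ + 3 * δ) ≤ K * (M * δ + δ + 3 * δ) :=
    mul_le_mul_of_nonneg_left (by linarith) hK
  linarith [(abs_le.1 h3).2]

/-- From `p₀`, follow the derivative of the limit path `γ₀` up to a later initial time. -/
theorem Coeffs.Bounds.eventually_le_value_of_le (hα0 : 0 < α) (hα1 : α < 1)
    (B : c.Bounds T M L) (hglb : ∀ p : Pt α T e k, IsGLB (c.costSet p) (c.value p))
    (p₀ : Pt α T e k) {η : ℝ} (hη : 0 < η) :
    ∀ᶠ p in 𝓝 p₀, (p₀.1 : ℝ) ≤ p.1 → c.value p₀ ≤ c.value p + η := by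
  have hM := B.M_nonneg
  have hK := stabConst_nonneg B
  set K := stabConst L T
  have hu := memLp_top_Icc_mono (memLp_caputo hα0 hα1 p₀.2.2) p₀.1.2.1 le_rfl
  obtain ⟨X, hX⟩ := B.exists_admissible hα0 hα1 p₀ hu
  obtain ⟨C, hC0, hC⟩ := (B.memLp_running_of_admissible hα0 hα1 hX).ae_norm_le_bound
  filter_upwards [eventually_mul_dist_add_lt p₀ (C + K * (M + 2)) 0 one_pos hη] with p h2 hpp
  set δ := dist p p₀ with hδ
  have hδ0 : 0 ≤ δ := dist_nonneg
  have ht := abs_time_sub_le_dist p p₀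
  rw [abs_of_nonneg (sub_nonneg.2 hpp)] at ht
  have hv := B.value_le_integral_add hα0 hα1 hpp (hglb p₀) (hglb p) hX (D := δ)
    (fun s hs => by
      rw [nu_caputo hα0 hα1 p₀.2.2 p₀.1.2 ⟨hs.1, hs.2.trans p.1.2.2⟩]
      exact norm_ext_sub_le_dist p p₀ s)
  have h3 := abs_integral_le_of_ae_bound le_rfl hpp p.1.2.2 hC
  have h4 := mul_le_mul_of_nonneg_left ht hC0
  have h5 : ‖X p.1 - p.2.1‖ ≤ M * δ + δ := by
    have e1 := norm_sub_le_norm_sub_add_norm_sub (X p.1) p₀.2.1 p.2.1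
    have e2 := B.norm_state_sub_start_le hα0 hα1 hX hpp p.1.2.2
    have e3 := norm_state_sub_le_dist p p₀
    rw [norm_sub_rev] at e3
    linarith [mul_le_mul_of_nonneg_left ht hM]
  have h6 : K * (‖X p.1 - p.2.1‖ + δ) ≤ K * (M * δ + δ + δ) :=
    mul_le_mul_of_nonneg_left (by linarith) hK
  linarith [(abs_le.1 h3).2]

/-- From `p₀`, use the restriction of a nearly optimal control for data with an earlier initial
time.  These controls are not bounded uniformly, but by coercivity they are bounded in `L^q`. -/
theorem Coeffs.Bounds.eventually_le_value_of_ge (hα0 : 0 < α) (hα1 : α < 1)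
    (B : c.Bounds T M L) {q f₀ C₀ : ℝ} (hq : 1 / α < q) (hf₀ : 0 < f₀) (hC₀ : 0 < C₀)
    (hf : ∀ x a u, f₀ * ‖u‖ ^ q - C₀ ≤ c.f x a u)
    (p₀ : Pt α T e k) {η : ℝ} (hη : 0 < η) :
    ∀ᶠ p in 𝓝 p₀, (p.1 : ℝ) ≤ p₀.1 → c.value p₀ ≤ c.value p + η := by
  have hglb := fun p => B.isGLB_costSet (T := T) hα0 hα1 hq hf₀ hC₀ hf p
  have hM := B.M_nonneg
  have hL := B.L_pos
  have hT0 := hT.out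
  have hK := stabConst_nonneg B
  set K := stabConst L T
  have hq0 : 0 < q := lt_trans (by positivity) hq
  have hβ0 : 0 < α - 1 / q := by
    have : 1 / q < α := by rw [div_lt_comm₀ hq0 hα0]; exact hq
    linarith
  obtain ⟨A₁, hA₁0, hA₁⟩ := B.exists_le_cost (T := T) hα0 hα1 hq hf₀ hC₀ hf
  have hx₀ := norm_nonneg p₀.2.1
  have hγ₀ := norm_nonneg p₀.2.2.1
  set Q := 2 / f₀ * (|c.value p₀| + 2 + A₁ * (3 + ‖p₀.2.1‖ + ‖p₀.2.2.1‖)) with hQ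
  have hQ0 : 0 ≤ Q := by positivity
  obtain ⟨A, hA0, hA⟩ := exists_norm_nu_concat_sub_le hα0 hα1 hq p₀.2.2 hQ0
  set C := C₀ + L * (1 + ‖p₀.2.1‖) + L * (M * T + 1 + ‖p₀.2.2.1‖ + (3 + A * T ^ (α - 1 / q)))
    with hC
  have hC0 : 0 ≤ C := by positivity
  filter_upwards [eventually_dist_lt p₀ one_pos,
    B.eventually_value_le_of_ge hα0 hα1 hglb p₀ one_pos, eventually_mul_dist_add_lt p₀
    (C + K * (M + 4)) (K * A) hβ0 (half_pos hη)] with p h1 hvp h2 hpp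
  have hvp := hvp hpp
  set δ := dist p p₀ with hδ
  have hδ0 : 0 ≤ δ := dist_nonneg
  have ht := abs_time_sub_le_dist p p₀
  rw [abs_of_nonpos (sub_nonpos.2 hpp), neg_sub] at ht
  have e3 := norm_state_sub_le_dist p p₀
  obtain ⟨u, X, hX, hcost⟩ := Coeffs.exists_cost_lt (hglb p) (η := min (η / 2) 1)
    (lt_min (half_pos hη) one_pos)
  have hm1 := min_le_left (η / 2) 1
  have hm2 := min_le_right (η / 2) 1
  have hI : ∫ s in (p.1 : ℝ)..T, ‖u s‖ ^ q ≤ Q := by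
    have a1 := hA₁ p.1 p.2.1 p.2.2 u X p.1.2 hX.1 hX.2
    have a2 := le_abs_self (c.value p₀)
    have a3 : ‖p.2.1‖ ≤ ‖p₀.2.1‖ + 1 := by
      linarith [norm_sub_norm_le p.2.1 p₀.2.1]
    have a4 : ‖p.2.2.1‖ ≤ ‖p₀.2.2.1‖ + 1 := by
      have b1 : dist p.2.2.1 p₀.2.2.1 ≤ δ := (le_max_right _ _).trans (le_max_right _ _)
      rw [dist_eq_norm] at b1
      linarith [norm_sub_norm_le p.2.2.1 p₀.2.2.1]
    have a5 : A₁ * (1 + ‖p.2.1‖ + ‖p.2.2.1‖) ≤ A₁ * (3 + ‖p₀.2.1‖ + ‖p₀.2.2.1‖) :=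
      mul_le_mul_of_nonneg_left (by linarith) hA₁0
    rw [hQ, div_mul_eq_mul_div, le_div_iff₀ hf₀]
    linarith
  have hpow : ((p₀.1 : ℝ) - p.1) ^ (α - 1 / q) ≤ δ ^ (α - 1 / q) :=
    Real.rpow_le_rpow (sub_nonneg.2 hpp) ht hβ0.le
  have hpow' : ((p₀.1 : ℝ) - p.1) ^ (α - 1 / q) ≤ T ^ (α - 1 / q) :=
    Real.rpow_le_rpow (sub_nonneg.2 hpp) (by linarith [p₀.1.2.2, p.1.2.1]) hβ0.le
  have hnu : ∀ t ∈ Icc 0 (p₀.1 : ℝ), ‖AC.ext p₀.2.2 t - nu p.1 p.2.2 u t‖ ≤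
      3 * δ + A * ((p₀.1 : ℝ) - p.1) ^ (α - 1 / q) := fun t htI => by
    have htT : t ∈ Icc 0 T := ⟨htI.1, htI.2.trans p₀.1.2.2⟩
    have b1 := norm_nu_sub_nu_le hα0 hα1 p.2.2 p₀.2.2 p.1.2 p.1.2 le_rfl hX.1 (fun _ _ => rfl)
      (D := δ) (fun s hs => by
        rw [nu_of_le _ _ hs.2, norm_sub_rev]; exact norm_ext_sub_le_dist p p₀ s) htT
    have b2 := hA p.1 p₀.1 u p.1.2.1 hpp p₀.1.2.2 hX.1 hI t htT
    rw [nu_congr (u' := u) _ fun y hy => concat_of_le _ _ (hy.2.le.trans htI.2),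
      norm_sub_rev] at b2
    linarith [norm_sub_le_norm_sub_add_norm_sub (AC.ext p₀.2.2 t) (nu p.1 p₀.2.2 u t)
      (nu p.1 p.2.2 u t)]
  have hv := B.value_le_cost_sub hα0 hα1 hpp (hglb p₀) hX hnu
  have hXx : ∀ t, (p.1 : ℝ) ≤ t → t ≤ T → ‖X t - p₀.2.1‖ ≤ M * (t - p.1) + δ :=
    fun t h3 h4 => by
      have e1 := norm_sub_le_norm_sub_add_norm_sub (X t) p.2.1 p₀.2.1
      have e2 := B.norm_state_sub_start_le hα0 hα1 hX h3 h4
      linarith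
  have h3 : -(C * ((p₀.1 : ℝ) - p.1)) ≤
      ∫ s in (p.1 : ℝ)..p₀.1, c.running T s (X s) (nu p.1 p.2.2 u s) (u s) := by
    have i1 := intervalIntegrable_of_memLp_top hpp
      (memLp_top_Icc_mono (B.memLp_running_of_admissible hα0 hα1 hX) le_rfl p₀.1.2.2)
    have e1 : -(C * ((p₀.1 : ℝ) - p.1)) = ∫ _s in (p.1 : ℝ)..p₀.1, -C := by
      rw [intervalIntegral.integral_const, smul_eq_mul]; ring
    rw [e1]
    refine intervalIntegral.integral_mono_on hpp (by simp) i1 fun s hm => ?_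
    have hsT : s ∈ Icc 0 T := ⟨p.1.2.1.trans hm.1, hm.2.trans p₀.1.2.2⟩
    have b1 := (abs_le.1 (B.running_lip s hsT (X s) p₀.2.1 (nu p.1 p.2.2 u s) 0 (u s))).1
    rw [sub_zero] at b1
    have b2 := hXx s hm.1 hsT.2
    have b3 : M * (s - p.1) ≤ M * T := mul_le_mul_of_nonneg_left (by linarith [p.1.2.1, hsT.2]) hM
    have b4 := norm_sub_norm_le (nu p.1 p.2.2 u s) (AC.ext p₀.2.2 s)
    rw [norm_sub_rev] at b4
    have b5 := hnu s ⟨hsT.1, hm.2⟩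
    have b6 := AC.norm_ext_le p₀.2.2 s
    have b6' := mul_le_mul_of_nonneg_left hpow' hA0
    have b7 : L * (‖X s - p₀.2.1‖ + ‖nu p.1 p.2.2 u s‖) ≤
        L * (M * T + 1 + ‖p₀.2.2.1‖ + (3 + A * T ^ (α - 1 / q))) :=
      mul_le_mul_of_nonneg_left (by linarith) hL.le
    have b8 : -C₀ - L * (1 + ‖p₀.2.1‖) ≤ c.running T s p₀.2.1 0 (u s) := by
      have d1 := hf p₀.2.1 0 (u s)
      have d2 := (abs_le.1 (B.psi_le s hsT p₀.2.1 0)).1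
      have d3 : 0 ≤ f₀ * ‖u s‖ ^ q := by positivity
      rw [norm_zero, add_zero] at d2
      rw [Coeffs.running]
      linarith
    linarith
  have h4 := mul_le_mul_of_nonneg_left ht hC0
  have h5 := hXx p₀.1 hpp p₀.1.2.2
  have h6 := mul_le_mul_of_nonneg_left ht hM
  have h8 := mul_le_mul_of_nonneg_left hpow hA0
  have h7 : K * (‖X p₀.1 - p₀.2.1‖ + (3 * δ + A * ((p₀.1 : ℝ) - p.1) ^ (α - 1 / q))) ≤
      K * (M * δ + δ + (3 * δ + A * δ ^ (α - 1 / q))) :=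
    mul_le_mul_of_nonneg_left (by linarith) hK
  linarith

theorem Coeffs.Bounds.continuous_value (hα0 : 0 < α) (hα1 : α < 1)
    (B : c.Bounds T M L) {q f₀ C₀ : ℝ} (hq : 1 / α < q) (hf₀ : 0 < f₀) (hC₀ : 0 < C₀)
    (hf : ∀ x a u, f₀ * ‖u‖ ^ q - C₀ ≤ c.f x a u) :
    Continuous fun p : Pt α T e k => c.value p := by
  have hglb := fun p => B.isGLB_costSet (T := T) hα0 hα1 hq hf₀ hC₀ hf p
  rw [continuous_iff_continuousAt]
  intro p₀
  rw [ContinuousAt, Metric.tendsto_nhds]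
  intro η hη
  have hη2 := half_pos hη
  filter_upwards [B.eventually_value_le_of_le hα0 hα1 hglb p₀ hη2,
    B.eventually_value_le_of_ge hα0 hα1 hglb p₀ hη2,
    B.eventually_le_value_of_le hα0 hα1 hglb p₀ hη2,
    B.eventually_le_value_of_ge hα0 hα1 hq hf₀ hC₀ hf p₀ hη2] with p h1 h2 h3 h4
  rw [Real.dist_eq, abs_lt]
  rcases le_total (p₀.1 : ℝ) p.1 with h | h
  · constructor <;> linarith [h1 h, h3 h]
  · constructor <;> linarith [h2 h, h4 h]

theorem Coeffs.value_endTime {x : E e} {γ : AC α T k}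
    (hne : (c.costSet ((endTime T, x, γ) : Pt α T e k)).Nonempty) :
    c.value ((endTime T, x, γ) : Pt α T e k) = c.g x (γ.1 (endTime T)) := by
  have hsub : ∀ y ∈ c.costSet ((endTime T, x, γ) : Pt α T e k), y = c.g x (γ.1 (endTime T)) := by
    rintro y ⟨u, X, hu, hX, rfl⟩
    have hXT : X T = x := hX.apply_start le_rfl
    have hnu : nu T γ u T = γ.1 (endTime T) := by
      rw [nu_of_le γ u le_rfl, ← AC.ext_apply]; rfl
    simp only [endTime, Coeffs.cost, intervalIntegral.integral_same, zero_add]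
    rw [hXT, hnu]; rfl
  obtain ⟨y, hy⟩ := hne
  have : c.costSet ((endTime T, x, γ) : Pt α T e k) = {c.g x (γ.1 (endTime T))} :=
    Set.eq_singleton_iff_unique_mem.2 ⟨hsub y hy ▸ hy, hsub⟩
  rw [Coeffs.value, this, csInf_singleton]

end Continuity

end FracHJB

open FracHJB
theorem mainTheorem3 {e k d : ℕ} (α T : ℝ) [Fact (0 < T)] (hα0 : 0 < α) (hα1 : α < 1)
    (c : Coeffs e k d) (hdyn : c.RegularDynamics T)
    (hA1 : c.A1) (hA2 : c.A2)
    (pt : ℝ) (hpt : 1 < pt) (hA3 : c.A3 α T pt)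
    (q : ℝ) (hq : max pt (1 / α) < q) (hA4 : c.A4 q)
    (hA5 : c.A5) :
    (∀ p : Pt α T e k, IsGLB (c.costSet p) (c.value p)) ∧
    (∀ (x : E e) (a φ : E k),
      IsLUB (Set.range fun u : E k => -(inner ℝ φ u) - c.f x a u) (c.hamiltonian x a φ)) ∧
    c.IsViscositySolution (fun p : Pt α T e k => c.value p) := by
  obtain ⟨M, L, B⟩ := c.exists_bounds (Fact.out : 0 < T) hdyn hA1 hA5
  obtain ⟨f₀, hf₀, C₀, hC₀, hf⟩ := hA4
  have hqα : 1 / α < q := (le_max_right _ _).trans_lt hq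
  have hq1 : 1 < q := (hpt.trans_le (le_max_left _ _)).trans hq
  have hcont := B.continuous_value (α := α) hα0 hα1 hqα hf₀ hC₀ hf
  have hterm : ∀ (x : E e) (γ : AC α T k),
      c.value ((endTime T, x, γ) : Pt α T e k) = c.g x (γ.1 (endTime T)) := fun x γ =>
    Coeffs.value_endTime (B.costSet_nonempty hα0 hα1 _)
  refine ⟨fun p => B.isGLB_costSet hα0 hα1 hqα hf₀ hC₀ hf p,
    Coeffs.isLUB_hamiltonian hq1 hf₀ hf, ⟨hcont, hterm, ?_⟩, ⟨hcont, hterm, ?_⟩⟩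
  · intro φ Dt Dx Dγ hφ n p hp _ _ hmax
    exact B.subsolution_test hα0 hα1 hqα hf₀ hC₀ hf hφ p hp hmax
  · intro φ Dt Dx Dγ hφ n p hp _ _ hmin
    exact B.supersolution_test hα0 hα1 hqα hf₀ hC₀ hf hφ p hp hmin
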